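/- **Setting.** Let $X$ (positions) and $\mathcal V$ (velocities) be standard Borel spaces, $E = X \times \mathcal V$, and let $\pi$ be a probability measure on $E$. A *PDMP* on $E$ is given by a jointly measurable flow $(\Phi_t)_{t\in\mathbb R}$ (a one-parameter group of maps of $E$), a measurable rate $\lambda : E \to [0,\infty)$ with $\int_0^t \lambda(\Phi_s z)\,ds < \infty$ for all $z\in E$, $t\ge 0$, and a Markov kernel $Q$ on $E$: from $z$ the process follows $\Phi_t z$ until the first event of an inhomogeneous Poisson process of rate $\lambda(\Phi_t z)$, jumps according to $Q(\Phi_t z,\cdot)$ at that event, and starts afresh. It is assumed to be non-explosive: from every initial state there are almost surely finitely many events in bounded time. A path on $[0,T]$ is described by its initial state, its event times, and the states just after the events; $R_T$ denotes the map that reverses such a path, $(z_t)_{t\in[0,T]} \mapsto (z_{T-t})_{t\in[0,T]}$. A non-explosive PDMP with flow $\Phi_{-t}$ is the *time-reversal* of the given one at $\pi$ if for every $T>0$ the law of its path on $[0,T]$ started from $\pi$ is the image under $R_T$ of the law of the path on $[0,T]$ of the given PDMP started from $\pi$. The full path $(Z_t)_{t\in\mathbb R}$ from $Z_0=z$ consists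 of the PDMP forward in time and of its time-reversal backward in time, independent given $z$. A *stopping criterion* declares, measurably, each piece $(Z_s)_{s\in[a,b]}$ of a full path valid or not valid. It is *consistent* if, whenever $(Z_s)_{s\in I}$ is valid, $(Z_s)_{s\in J}$ is valid for every interval $J\subset I$. It is *event-based* if the validity of a piece depends only on the points where its events occur: two pieces whose events agree up to a time shift (same times, same states before and after each event, and an end of one piece is an event if and only if the corresponding end of the other is) are both valid or both not valid. A *velocity refreshment* replaces $(x,v)$ by $(x,v')$, $v'$ being drawn from a Markov kernel $\rho((x,v),\cdot)$, and preserves $\pi$ (for example $v'\sim\psi$ if $\pi=\mu\otimes\psi$, or $v'$ drawn from the conditional law of the velocity given the position). **Algorithm (No-U-Turn PDMP sampler).** Input: $z=(x,v)$. 1. Refresh the velocity, and call the resulting state again $z$. 2. Sample $\alpha\sim \mathrm{unif}(0,1)$ and, independently, a full path $(Z_t)_{t\in\mathbb R}$ with $Z_0=z$. Let $T=\sup\{t\ge 0 : (Z_s)_{s\in[-\alpha t,(1-\alpha)t]} \text{ is valid}\}$ (with $T=0$ if the set is empty), and let $X_s = Z_{s-\alpha T}$ for $s\in[0,T]$. 3.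 If $0<T<\infty$, sample $l'\in[0,T]$ with density $2(T-l)/T^2$ if the criterion was hit going forward (the forward end $(1-\alpha)T$ is an event time), and with density $2l/T^2$ otherwise; output $X_{l'}$. If $T\in\{0,\infty\}$, output $z$. **Theorem.** Assume that $\pi$ is invariant for a non-explosive PDMP, that a non-explosive PDMP is its time-reversal at $\pi$, that the velocity refreshment preserves $\pi$, and that the stopping criterion is consistent and event-based. Then the algorithm defines a Markov chain on $E$ (the law of its output is a Markov kernel as a function of its input), and $\pi$ is an invariant distribution of this chain. (No regularity of $R_t$ in $t$, and no volume change $\Psi_t$ of $R_t$, is assumed; in particular the theorem holds whenever $R_t$ and $\Psi_t$ are continuous in $t$.) -/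

import Mathlib

open MeasureTheory ProbabilityTheory Filter Topology
open scoped ENNReal NNReal

noncomputable section

/-! ### Piecewise deterministic Markov processes -/

/-- The characteristics of a PDMP on a state space `E`: a deterministic flow (a measurable
one-parameter group), an event rate, locally integrable along the flow, and a jump kernel. -/
structure PDMP (E : Type*) [MeasurableSpace E] where
  flow : ℝ → E → E
  measurable_flow : Measurable (fun p : ℝ × E => flow p.1 p.2)
  flow_zero : ∀ z, flow 0 z = z
  flow_add : ∀ s t z, flow (s + t) z = flow s (flow t z)
  rate : E → ℝ≥0
  measurable_rate : Measurable rate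
  rate_integrable : ∀ z (t : ℝ≥0), ∫⁻ s in Set.Icc (0 : ℝ) t, (rate (flow s z) : ℝ≥0∞) < ∞
  jump : Kernel E E
  markov_jump : IsMarkovKernel jump

/-- An infinite skeleton: entry `0` is `(0, initial state)`; entry `n ≥ 1` is the waiting time
between the events `n - 1` and `n` (equal to `∞` if there is no further event), together with the
state immediately after event `n`. -/
abbrev Skeleton (E : Type*) : Type _ := ℕ → ℝ≥0∞ × E

namespace Skeleton

variable {E : Type*}

/-- Time of event `n` (time `0` for `n = 0`). -/
def time (ω : Skeleton E) (n : ℕ) : ℝ≥0∞ := ∑ i ∈ Finset.range (n + 1), (ω i).1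

/-- Index of the last event at a time `≤ t` (`0` if there is none). -/
def lastLE (ω : Skeleton E) (t : ℝ) : ℕ := sSup {n | ω.time n ≤ ENNReal.ofReal t}

/-- Index of the last event at a time `< t` (`0` if there is none). -/
def lastLT (ω : Skeleton E) (t : ℝ) : ℕ := sSup {n | ω.time n < ENNReal.ofReal t}

end Skeleton

/-- Paths on a bounded time interval `[0, T]`: the initial state and the finite ordered list of
the event times with the states immediately after the events. -/
abbrev FinPath (E : Type*) : Type _ := E × (Σ k : ℕ, Fin k → ℝ × E)

namespace PDMP

variable {E : Type*} [MeasurableSpace E]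

/-- The integrated rate `∫₀ᵗ λ(φ_s z) ds`. -/
def cumRate (D : PDMP E) (z : E) (t : ℝ≥0) : ℝ≥0∞ :=
  ∫⁻ s in Set.Icc (0 : ℝ) t, (D.rate (D.flow s z) : ℝ≥0∞)

/-- The first event time, started from `z` and driven by the exponential variable `u`: the first
time at which the integrated rate reaches `u`, or `∞` if it never does. -/
def waiting (D : PDMP E) (p : E × ℝ) : ℝ≥0∞ :=
  ⨅ (t : ℝ≥0) (_ : ENNReal.ofReal p.2 ≤ D.cumRate p.1 t), (t : ℝ≥0∞)

lemma cumRate_mono (D : PDMP E) (z : E) {s t : ℝ≥0} (h : s ≤ t) :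
    D.cumRate z s ≤ D.cumRate z t :=
  lintegral_mono_set (Set.Icc_subset_Icc_right (by exact_mod_cast h))

lemma measurable_cumRate (D : PDMP E) (t : ℝ≥0) : Measurable fun z => D.cumRate z t := by
  unfold cumRate
  have h : Measurable (fun p : E × ℝ => (D.rate (D.flow p.2 p.1) : ℝ≥0∞)) :=
    (D.measurable_rate.comp (D.measurable_flow.comp measurable_swap)).coe_nnreal_ennreal
  exact h.lintegral_prod_right'

lemma measurable_waiting (D : PDMP E) : Measurable D.waiting := by
  refine measurable_of_Iio fun c => ?_
  have h : D.waiting ⁻¹' Set.Iio c = ⋃ (q : ℚ) (_ : ((Real.toNNReal q : ℝ≥0) : ℝ≥0∞) < c),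
      {p : E × ℝ | ENNReal.ofReal p.2 ≤ D.cumRate p.1 (Real.toNNReal q)} := by
    ext p
    simp only [waiting, Set.mem_preimage, Set.mem_Iio, iInf_lt_iff, Set.mem_iUnion,
      Set.mem_ofPred_eq, exists_prop]
    constructor
    · rintro ⟨t, ht, htc⟩
      obtain ⟨q, -, h1, h2⟩ := ENNReal.lt_iff_exists_rat_btwn.1 htc
      exact ⟨q, h2, ht.trans (D.cumRate_mono _ (by exact_mod_cast h1.le))⟩
    · rintro ⟨q, hq, h⟩
      exact ⟨_, h, hq⟩
  rw [h]
  refine MeasurableSet.iUnion fun q => MeasurableSet.iUnion fun _ => ?_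
  exact measurableSet_le (by fun_prop) ((D.measurable_cumRate _).comp measurable_fst)

/-- The law of the first event time, started from `z`: that of an inhomogeneous Poisson process
with rate `t ↦ λ(φ_t z)`. -/
def waitingKernel (D : PDMP E) : Kernel E ℝ≥0∞ :=
  (Kernel.id ×ₖ Kernel.const E (expMeasure 1)).map D.waiting

instance (D : PDMP E) : IsMarkovKernel D.waitingKernel := by
  have := isProbabilityMeasure_expMeasure (r := 1) one_pos
  exact Kernel.IsMarkovKernel.map _ D.measurable_waiting

/-- The law of the state after a jump that occurs at time `t`, started from `z`, is
`Q(φ_t z, ·)`. When there is no further event (`t = ∞`) the value is never used. -/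
def afterJump (D : PDMP E) : Kernel (E × ℝ≥0∞) E :=
  D.jump.comap (fun p => D.flow p.2.toReal p.1)
    (D.measurable_flow.comp (measurable_snd.ennreal_toReal.prodMk measurable_fst))

instance (D : PDMP E) : IsMarkovKernel D.afterJump := by
  have := D.markov_jump
  unfold afterJump
  infer_instance

/-- One step of the skeleton chain: the next waiting time and the next post-jump state. -/
def step (D : PDMP E) : Kernel E (ℝ≥0∞ × E) := D.waitingKernel ⊗ₖ D.afterJump

instance (D : PDMP E) : IsMarkovKernel D.step := by
  unfold step
  infer_instance

/-- The step kernel as a function of the whole past of the skeleton. -/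
def stepFrom (D : PDMP E) (n : ℕ) : Kernel (Π _ : Finset.Iic n, ℝ≥0∞ × E) (ℝ≥0∞ × E) :=
  D.step.comap (fun x => (x ⟨n, Finset.mem_Iic.2 le_rfl⟩).2) (by fun_prop)

instance (D : PDMP E) (n : ℕ) : IsMarkovKernel (D.stepFrom n) := by
  unfold stepFrom
  infer_instance

/-- The law of the (skeleton of the) PDMP on `[0, ∞)`, as a function of its initial state. -/
def pathLaw (D : PDMP E) : Kernel E (Skeleton E) :=
  (Kernel.traj (X := fun _ => ℝ≥0∞ × E) D.stepFrom 0).comap (fun z _ => ((0 : ℝ≥0∞), z))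
    (by fun_prop)

instance (D : PDMP E) : IsMarkovKernel D.pathLaw := by
  unfold pathLaw
  infer_instance

/-- Almost surely there are finitely many events in bounded time, for every initial state. -/
def NonExplosive (D : PDMP E) : Prop :=
  ∀ z, ∀ᵐ ω ∂(D.pathLaw z), Tendsto ω.time atTop (𝓝 ∞)

/-- The state at time `t ≥ 0` (right-continuous version). -/
def stateAt (D : PDMP E) (ω : Skeleton E) (t : ℝ) : E :=
  D.flow (t - (ω.time (ω.lastLE t)).toReal) (ω (ω.lastLE t)).2

/-- The left limit of the state at time `t > 0`. -/
def stateBefore (D : PDMP E) (ω : Skeleton E) (t : ℝ) : E :=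
  D.flow (t - (ω.time (ω.lastLT t)).toReal) (ω (ω.lastLT t)).2

/-- `π` is an invariant distribution of the PDMP. -/
def IsInvariant (D : PDMP E) (π : Measure E) : Prop :=
  ∀ t : ℝ, 0 ≤ t → (π.bind D.pathLaw).map (fun ω => D.stateAt ω t) = π

/-! ### Time reversal -/

/-- The restriction of a path to `[0, T]`. -/
def restrictTo (T : ℝ) (ω : Skeleton E) : FinPath E :=
  ((ω 0).2, ⟨ω.lastLE T, fun i => ((ω.time (i + 1)).toReal, (ω (i + 1)).2)⟩)

/-- Entry `0` is `(0, initial state)`, entry `i ≥ 1` is event `i`. -/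
def nodes (w : FinPath E) : Fin (w.2.1 + 1) → ℝ × E := Fin.cons (0, w.1) w.2.2

/-- The reversal map `R_T`: the path `(z_t)` on `[0, T]` is sent to `(z_{T - t})`. It starts at
`z_T`; each event of the path at time `τ` becomes an event at time `T - τ`, after which the
reversed path is in the state that the original path had just before its event. -/
def reversal (D : PDMP E) (T : ℝ) (w : FinPath E) : FinPath E :=
  (D.flow (T - (nodes w (Fin.last _)).1) (nodes w (Fin.last _)).2,
    ⟨w.2.1, fun i =>
      (T - (nodes w i.rev.succ).1,
        D.flow ((nodes w i.rev.succ).1 - (nodes w i.rev.castSucc).1)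
          (nodes w i.rev.castSucc).2)⟩)

/-- `Dr` is the time-reversal of the PDMP `D` at equilibrium `π`: it has the reverse deterministic
flow, and, on every `[0, T]`, the law of its path started from `π` is the law of the reversed path
of `D` started from `π`. -/
def IsTimeReversal (D Dr : PDMP E) (π : Measure E) : Prop :=
  (∀ t z, Dr.flow t z = D.flow (-t) z) ∧
  ∀ T : ℝ, 0 < T →
    (π.bind Dr.pathLaw).map (restrictTo T) =
      (π.bind D.pathLaw).map (fun ω => D.reversal T (restrictTo T ω))

end PDMP

/-! ### Full paths, indexed by all real times -/

/-- A full path `(Z_t)`, `t ∈ ℝ`: its forward skeleton and its backward skeleton from time `0`. -/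
abbrev FullPath (E : Type*) : Type _ := Skeleton E × Skeleton E

namespace FullPath

variable {E : Type*} [MeasurableSpace E]

/-- Both skeletons start from the same state, events are separated by positive times, and there
are finitely many events in bounded time. -/
def IsProper (ω : FullPath E) : Prop :=
  ω.1 0 = ω.2 0 ∧ (ω.1 0).1 = 0 ∧ (∀ n, 0 < n → 0 < (ω.1 n).1 ∧ 0 < (ω.2 n).1) ∧
    Tendsto ω.1.time atTop (𝓝 ∞) ∧ Tendsto ω.2.time atTop (𝓝 ∞)

/-- The set of the times of the events, the backward ones being negative. -/
def events (ω : FullPath E) : Set ℝ :=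
  {t | ∃ n, 0 < n ∧ ((0 < t ∧ ω.1.time n = ENNReal.ofReal t) ∨
    (t < 0 ∧ ω.2.time n = ENNReal.ofReal (-t)))}

/-- The state `Z_t` at a time `t ∈ ℝ` (right-continuous version). -/
def state (D : PDMP E) (ω : FullPath E) (t : ℝ) : E :=
  if 0 ≤ t then D.stateAt ω.1 t
  else D.flow (t + (ω.2.time (ω.2.lastLT (-t))).toReal) (ω.2 (ω.2.lastLT (-t))).2

/-- The left limit `Z_{t-}` at a time `t ∈ ℝ`. -/
def stateLeft (D : PDMP E) (ω : FullPath E) (t : ℝ) : E :=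
  if 0 < t then D.stateBefore ω.1 t
  else D.flow (t + (ω.2.time (ω.2.lastLE (-t))).toReal) (ω.2 (ω.2.lastLE (-t))).2

/-- The piece of `ω` on `[a, b]` and the piece of `ω'` on `[a', b']` have the same events: up to a
shift of time, the events occur at the same times, from and to the same states, and an end of one
piece is an event exactly when the corresponding end of the other piece is. -/
def SameEvents (D : PDMP E) (ω : FullPath E) (a b : ℝ) (ω' : FullPath E) (a' b' : ℝ) : Prop :=
  ∃ c : ℝ,
    (∀ t, t ∈ ω.events ∩ Set.Icc a b ↔ t + c ∈ ω'.events ∩ Set.Icc a' b') ∧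
    (∀ t ∈ ω.events ∩ Set.Icc a b,
      stateLeft D ω t = stateLeft D ω' (t + c) ∧ state D ω t = state D ω' (t + c)) ∧
    (a ∈ ω.events ↔ a' ∈ ω'.events) ∧ (b ∈ ω.events ↔ b' ∈ ω'.events)

end FullPath

/-! ### Stopping criteria -/

/-- A stopping criterion: `C ω a b` says that the piece `(Z_s)`, `s ∈ [a, b]`, of the full path
`ω` is valid. -/
abbrev Criterion (E : Type*) : Type _ := FullPath E → ℝ → ℝ → Prop

namespace Criterion

variable {E : Type*} [MeasurableSpace E]

def IsMeasurable (C : Criterion E) : Prop :=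
  MeasurableSet {p : FullPath E × ℝ × ℝ | C p.1 p.2.1 p.2.2}

/-- Consistency: a sub-interval of a valid interval is valid (equivalently, an interval that
contains an invalid one is invalid). -/
def IsConsistent (C : Criterion E) : Prop :=
  ∀ ω : FullPath E, ω.IsProper → ∀ a b c d : ℝ, a ≤ c → c ≤ d → d ≤ b → C ω a b → C ω c d

/-- The validity of a piece of path depends only on the points where its events occur. -/
def DependsOnlyOnEvents (D : PDMP E) (C : Criterion E) : Prop :=
  ∀ ω ω' : FullPath E, ω.IsProper → ω'.IsProper → ∀ a b a' b' : ℝ, a ≤ b → a' ≤ b' →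
    FullPath.SameEvents D ω a b ω' a' b' → (C ω a b ↔ C ω' a' b')

end Criterion

/-! ### The No-U-Turn PDMP sampler -/

namespace NUTS

section

variable {E : Type*} [MeasurableSpace E]

/-- `T = sup {t ≥ 0 | the piece on [-αt, (1-α)t] is valid}`. -/
def stopLength (C : Criterion E) (ω : FullPath E) (α : ℝ) : ℝ≥0∞ :=
  ⨆ (t : ℝ≥0) (_ : C ω (-(α * t)) ((1 - α) * t)), (t : ℝ≥0∞)

/-- The law on `[0, T]` with density proportional to `T - s`. -/
def lawForward (T : ℝ) : Measure ℝ :=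
  (volume.restrict (Set.Icc 0 T)).withDensity fun s => ENNReal.ofReal (2 * (T - s) / T ^ 2)

/-- The law on `[0, T]` with density proportional to `s`. -/
def lawBackward (T : ℝ) : Measure ℝ :=
  (volume.restrict (Set.Icc 0 T)).withDensity fun s => ENNReal.ofReal (2 * s / T ^ 2)

open Classical in
/-- The law of the output, given the full path and `α`. With `T` the stopping length and
`X_s = Z_{s - αT}`, `s ∈ [0, T]`, the output is `X_{l'}`, where `l'` is drawn from `lawForward T`
if the criterion was hit going forward, that is if the forward end `(1 - α)T` is an event, and
from `lawBackward T` otherwise. If `T` is `0` or `∞`, the state is left unchanged. -/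
def outputLaw (D : PDMP E) (C : Criterion E) (ω : FullPath E) (α : ℝ) : Measure E :=
  let T : ℝ := (stopLength C ω α).toReal
  if stopLength C ω α = 0 ∨ stopLength C ω α = ∞ then Measure.dirac (ω.1 0).2
  else (if (1 - α) * T ∈ ω.events then lawForward T else lawBackward T).map
    (fun l' => FullPath.state D ω (l' - α * T))

/-- The law of the full path started at time `0` from `z`: given `z`, the forward and the backward
path are independent, and the backward path follows the PDMP `Dr`. -/
def fullPathLaw (D Dr : PDMP E) : Kernel E (FullPath E) := D.pathLaw ×ₖ Dr.pathLaw

end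

section

variable {X V : Type*} [MeasurableSpace X] [MeasurableSpace V]

/-- The update `(x, v) ↦ (x, v')` with `v' ∼ ρ((x, v), ·)`. -/
def refresh (ρ : Kernel (X × V) V) : Kernel (X × V) (X × V) :=
  Kernel.deterministic Prod.fst measurable_fst ×ₖ ρ

/-- `ρ` is a velocity refreshment for `π`: the velocity is redrawn from `ρ`, the position being
held fixed, and `π` is preserved. -/
def IsRefreshment (ρ : Kernel (X × V) V) (π : Measure (X × V)) : Prop :=
  (refresh ρ).Invariant π

/-- Full refreshment, i.e. drawing the velocity from its conditional law given the position, is a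
velocity refreshment. -/
lemma isRefreshment_cond (μ : Measure X) [SFinite μ] (ψ : Kernel X V) [IsMarkovKernel ψ] :
    IsRefreshment (ψ.comap Prod.fst measurable_fst) (μ ⊗ₘ ψ) := by
  have h : ∀ z : X × V, refresh (ψ.comap Prod.fst measurable_fst) z = (Kernel.id ×ₖ ψ) z.1 := by
    intro z
    rw [refresh, Kernel.prod_apply, Kernel.comap_apply, Kernel.prod_apply,
      Kernel.deterministic_apply, Kernel.id_apply]
  unfold IsRefreshment Kernel.Invariant
  have h2 : (μ ⊗ₘ ψ).bind (refresh (ψ.comap Prod.fst measurable_fst)) =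
      ((μ ⊗ₘ ψ).map Prod.fst).bind (Kernel.id ×ₖ ψ) := by
    ext s hs
    rw [Measure.bind_apply hs (Kernel.aemeasurable _), Measure.bind_apply hs (Kernel.aemeasurable _),
      lintegral_map (Kernel.measurable_coe _ hs) measurable_fst]
    simp_rw [h]
  rw [h2, ← Measure.fst, Measure.fst_compProd, ← Measure.compProd_eq_comp_prod]

/-- Drawing the velocity from `ψ`, independently of the current state, is a velocity refreshment
for `μ ⊗ ψ`. -/
lemma isRefreshment_prod (μ : Measure X) [SFinite μ] (ψ : Measure V) [IsProbabilityMeasure ψ] :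
    IsRefreshment (Kernel.const (X × V) ψ) (μ.prod ψ) := by
  rw [← Measure.compProd_const]
  exact isRefreshment_cond μ (Kernel.const X ψ)

/-- The law of the output of the algorithm with input `z`: refresh the velocity, draw the full
path and, independently, `α ∼ unif(0, 1)`, then draw the output. -/
def samplerLaw (D Dr : PDMP (X × V)) (ρ : Kernel (X × V) V) (C : Criterion (X × V))
    (z : X × V) : Measure (X × V) :=
  (refresh ρ z).bind fun z' =>
    (fullPathLaw D Dr z').bind fun ω =>
      (volume.restrict (Set.Ioo (0 : ℝ) 1)).bind fun α => outputLaw D C ω α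

end

end NUTS

end

/-!
The theorem rests on an exact symmetry between the input and the output of the sampler, given the
longest valid pieces of the path.

*Stationarity.* Let the full path `(Z_t)` start at time `0` from `π`, and let `p > 0`. As `Dr` is
the time-reversal of `D` at `π`, the part of the path after time `-p`, seen from `-p`, has the law
of the PDMP started from `π` (`PDMP.lintegral_fullPath_eq`; this uses the Markov property at the
fixed time `p`, `PDMP.lintegral_pathLaw_after`, itself a consequence of the lack of memory of the
exponential clock). A fixed time is almost surely not an event and the criterion only sees events,
so the length `L p` of the longest valid piece starting at `-p`, together with the state
`Z_{q - p}`, has a law that depends on `q` but not on `p` (`NUTS.lintegral_validLength`).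

*Change of variables.* Fix a path. Its events are isolated and validity is monotone and only
changes across events, so a ray `t ↦ [-αt, (1 - α)t]` that stops at length `T` stops because one
of its ends meets an event, and for all but countably many `α` only one of them does. If it is the
forward end, then with `p = αT` the piece `[-p, T - p]` is the longest valid piece starting at
`-p`, i.e. `T = L p`; as long as `-p` does not cross an event the right end `L p - p` is constant,
so that `α = p / L p` has derivative `(L p - p) / (L p)²`. Hence integrating over these `α` is the
same as integrating over `0 < p < L p < ∞` with this density (`IsLocalValidity.lintegral_ray`).

*Symmetry.* The output is `Z_{q - p}`, where `q` has density `2 (L p - q) / (L p)²` on `[0, L p]`.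
The joint density of `p` and `q` is therefore `2 (l - p) (l - q) / l⁴` with `l = L p`, which is
symmetric. By stationarity the mean of `f (Z_{q - p})` is the integral over `p` and `q` of the
mean, for the PDMP started from `π`, of this density times `f` at time `q`, whereas the mean of
`f (Z_0) = f (Z_{p - p})` is the same integral with `f` at time `p`; so the two are equal
(`NUTS.lintegral_turnMean_symm`). The case of a criterion hit at the backward end is the forward
case for the path read in the opposite direction of time, in which `D` and `Dr` are exchanged
(`NUTS.lintegral_backwardSet`), and if `T` is `0` or `∞` nothing moves. Adding up the three cases
gives the invariance (`NUTS.bind_pathOutputKernel`).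

The output law is only well behaved on proper paths, so the Markov kernel is built from a
measurable version of the stopping length (`NUTS.outputKernel`), which agrees with the sampler on
proper paths.
-/

noncomputable section

/-! ### The Markov property at an event -/

namespace Skeleton

variable {E : Type*}

/-- The skeleton frozen at event `n`: the later entries are filled with the state after event `n`,
so that `upTo n ω` carries the same information as the first `n + 1` entries of `ω`. -/
def upTo (n : ℕ) (ω : Skeleton E) : Skeleton E := fun k => if k ≤ n then ω k else (0, (ω n).2)

/-- The skeleton restarted at event `n`, with event `n` as its new origin of time. -/
def tail (n : ℕ) (ω : Skeleton E) : Skeleton E :=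
  fun k => if k = 0 then (0, (ω n).2) else ω (n + k)

/-- The skeleton that follows `ω` up to event `n` and the events of `ω'` from then on. -/
def concat (n : ℕ) (ω ω' : Skeleton E) : Skeleton E :=
  fun k => if k ≤ n then ω k else ω' (k - n)

variable [MeasurableSpace E]

@[fun_prop]
lemma measurable_upTo (n : ℕ) : Measurable (upTo n : Skeleton E → Skeleton E) := by
  refine measurable_pi_lambda _ fun k => ?_
  unfold upTo
  split_ifs <;> fun_prop

@[fun_prop]
lemma measurable_tail (n : ℕ) : Measurable (tail n : Skeleton E → Skeleton E) := by
  refine measurable_pi_lambda _ fun k => ?_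
  unfold tail
  split_ifs <;> fun_prop

@[fun_prop]
lemma measurable_concat (n : ℕ) :
    Measurable (fun p : Skeleton E × Skeleton E => concat n p.1 p.2) := by
  refine measurable_pi_lambda _ fun k => ?_
  unfold concat
  split_ifs <;> fun_prop

end Skeleton

namespace PDMP

variable {E : Type*} [MeasurableSpace E] (D : PDMP E)

open Skeleton

lemma lintegral_pathLaw_congr_zero (z : E) {F : Skeleton E → ℝ≥0∞} (hF : Measurable F) :
    ∫⁻ ω, F ω ∂(D.pathLaw z) =
      ∫⁻ ω, F (Function.updateFinset ω (Finset.Iic 0) fun _ => ((0 : ℝ≥0∞), z)) ∂(D.pathLaw z) := by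
  rw [pathLaw, Kernel.comap_apply]
  exact Kernel.lintegral_traj _ hF

lemma ae_pathLaw_zero [MeasurableSingletonClass E] (z : E) :
    ∀ᵐ ω ∂(D.pathLaw z), ω 0 = ((0 : ℝ≥0∞), z) := by
  have hs : MeasurableSet {ω : Skeleton E | ω 0 = ((0 : ℝ≥0∞), z)} :=
    measurable_pi_apply 0 (measurableSet_singleton _)
  rw [ae_iff, ← Set.compl_ofPred, ← lintegral_indicator_one hs.compl,
    lintegral_pathLaw_congr_zero _ _ (measurable_one.indicator hs.compl)]
  simp [Function.updateFinset]

/-- Given the first `m + 1` entries of the skeleton, entry `m + 1` is drawn from the step kernel,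
started from the state after event `m`. -/
lemma lintegral_pathLaw_succ (z : E) (m : ℕ) {G : Skeleton E × (ℝ≥0∞ × E) → ℝ≥0∞}
    (hG : Measurable G) :
    ∫⁻ ω, G (upTo m ω, ω (m + 1)) ∂(D.pathLaw z) =
      ∫⁻ ω, ∫⁻ y, G (upTo m ω, y) ∂(D.step (ω m).2) ∂(D.pathLaw z) := by
  let T : (n : ℕ) → Kernel (Finset.Iic n → ℝ≥0∞ × E) (Skeleton E) :=
    Kernel.traj (X := fun _ => ℝ≥0∞ × E) D.stepFrom
  have key : ∀ F : Skeleton E → ℝ≥0∞, Measurable F → ∫⁻ ω, F ω ∂(D.pathLaw z) =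
      ∫⁻ ω, ∫⁻ ω', F ω' ∂(T m (Preorder.frestrictLe m ω)) ∂(D.pathLaw z) := by
    intro F hF
    rw [pathLaw, Kernel.comap_apply]
    have h := Kernel.traj_comp_partialTraj (X := fun _ => ℝ≥0∞ × E) (κ := D.stepFrom)
      (Nat.zero_le m)
    rw [← Kernel.traj_map_frestrictLe] at h
    conv_lhs => rw [← h]
    rw [Kernel.lintegral_comp _ _ _ hF, Kernel.lintegral_map _ (by fun_prop) _ hF.lintegral_kernel]
  rw [key _ (by fun_prop)]
  refine lintegral_congr fun ω => ?_
  have h1 : ∀ x : Skeleton E, upTo m (Function.updateFinset x (Finset.Iic m)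
      (Preorder.frestrictLe m ω)) = upTo m ω := by
    intro x
    ext1 k
    by_cases hk : k ≤ m <;> simp [upTo, Function.updateFinset, hk]
  rw [Kernel.lintegral_traj _ (by fun_prop)]
  have h2 : ∀ x : Skeleton E, Function.updateFinset x (Finset.Iic m)
      (Preorder.frestrictLe m ω) (m + 1) = x (m + 1) := by
    intro x
    simp [Function.updateFinset]
  simp_rw [h1, h2]
  have h3 := congrArg (fun κ => κ (Preorder.frestrictLe m ω))
    (Kernel.map_traj_succ_self (X := fun _ => ℝ≥0∞ × E) (κ := D.stepFrom) (a := m))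
  change ((Kernel.traj (X := fun _ => ℝ≥0∞ × E) D.stepFrom m).map (fun x : Skeleton E => x (m + 1)))
    (Preorder.frestrictLe m ω) = D.stepFrom m (Preorder.frestrictLe m ω) at h3
  rw [Kernel.map_apply _ (by fun_prop)] at h3
  have h4 : D.stepFrom m (Preorder.frestrictLe m ω) = D.step (ω m).2 := by
    rw [stepFrom, Kernel.comap_apply]
    rfl
  rw [← h4, ← h3, lintegral_map (by fun_prop) (by fun_prop)]

/-- The law of the skeleton is characterized by its initial entry and its one-step transitions. -/
lemma eq_pathLaw [MeasurableSingletonClass E] (z : E) (μ : Measure (Skeleton E))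
    [IsProbabilityMeasure μ] (h0 : ∀ᵐ ω ∂μ, ω 0 = ((0 : ℝ≥0∞), z))
    (h : ∀ (m : ℕ) (G : Skeleton E × (ℝ≥0∞ × E) → ℝ≥0∞), Measurable G →
      ∫⁻ ω, G (upTo m ω, ω (m + 1)) ∂μ = ∫⁻ ω, ∫⁻ y, G (upTo m ω, y) ∂(D.step (ω m).2) ∂μ) :
    μ = D.pathLaw z := by
  have key : ∀ (m : ℕ) (F : Skeleton E → ℝ≥0∞), Measurable F →
      ∫⁻ ω, F (upTo m ω) ∂μ = ∫⁻ ω, F (upTo m ω) ∂(D.pathLaw z) := by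
    intro m
    induction m with
    | zero =>
      intro F hF
      have hc : ∀ ω : Skeleton E, ω 0 = ((0 : ℝ≥0∞), z) →
          F (upTo 0 ω) = F fun _ => ((0 : ℝ≥0∞), z) := by
        intro ω hω
        congr 1
        ext1 k
        by_cases hk : k = 0 <;> simp [upTo, hk, hω]
      rw [lintegral_congr_ae (h0.mono hc), lintegral_congr_ae ((D.ae_pathLaw_zero z).mono hc)]
      simp
    | succ m ih =>
      intro F hF
      let c : Skeleton E × (ℝ≥0∞ × E) → Skeleton E := fun p k =>
        if k ≤ m then p.1 k else if k = m + 1 then p.2 else (0, p.2.2)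
      have hc : Measurable c := by
        refine measurable_pi_lambda _ fun k => ?_
        simp only [c]
        split_ifs <;> fun_prop
      have hcs : ∀ ω : Skeleton E, upTo (m + 1) ω = c (upTo m ω, ω (m + 1)) := by
        intro ω
        ext1 k
        rcases lt_trichotomy k (m + 1) with hk | hk | hk
        · simp [upTo, c, hk.le, Nat.lt_succ_iff.1 hk]
        · simp [upTo, c, hk]
        · simp [upTo, c, not_le.2 hk, hk.ne', show ¬ k ≤ m by omega]
      simp_rw [hcs]
      rw [h m (fun p => F (c p)) (by fun_prop),
        D.lintegral_pathLaw_succ z m (G := fun p => F (c p)) (by fun_prop)]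
      have hM : Measurable fun ω : Skeleton E => ∫⁻ y, F (c (ω, y)) ∂(D.step (ω m).2) :=
        Measurable.lintegral_kernel_prod_right' (κ := D.step.comap (fun ω : Skeleton E => (ω m).2)
          (by fun_prop)) (f := fun p => F (c p)) (by fun_prop)
      have := ih _ hM
      simpa [upTo] using this
  refine ext_of_generate_finite _ generateFrom_measurableCylinders.symm
    isPiSystem_measurableCylinders ?_ (by simp)
  intro s hs
  have hsm : MeasurableSet s := MeasurableSet.of_mem_measurableCylinders hs
  obtain ⟨N, S, mS, rfl⟩ : ∃ N S, MeasurableSet S ∧ s = cylinder (Finset.Iic N) S := by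
    simpa [measurableCylinders_nat] using hs
  rw [← lintegral_indicator_one hsm, ← lintegral_indicator_one hsm]
  have hst : ∀ ω : Skeleton E, (cylinder (Finset.Iic N) S).indicator (1 : Skeleton E → ℝ≥0∞) ω =
      (cylinder (Finset.Iic N) S).indicator (1 : Skeleton E → ℝ≥0∞) (upTo N ω) := by
    intro ω
    have : (Finset.Iic N).restrict (upTo N ω) = (Finset.Iic N).restrict ω := by
      ext1 k
      have := Finset.mem_Iic.1 k.2
      simp [upTo, this]
    have h2 : ω ∈ cylinder (Finset.Iic N) S ↔ upTo N ω ∈ cylinder (Finset.Iic N) S := by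
      rw [mem_cylinder, mem_cylinder, this]
    by_cases hω : ω ∈ cylinder (Finset.Iic N) S
    · rw [Set.indicator_of_mem hω, Set.indicator_of_mem (h2.1 hω)]; rfl
    · rw [Set.indicator_of_notMem hω, Set.indicator_of_notMem fun h3 => hω (h2.2 h3)]
  rw [lintegral_congr hst, lintegral_congr hst]
  exact key N _ (measurable_one.indicator hsm)

/-- The Markov property of the skeleton at event `n`: given the first `n + 1` entries, the
skeleton restarted at event `n` is that of the PDMP started from the state after event `n`. -/
lemma lintegral_pathLaw_tail [MeasurableSingletonClass E] (z : E) (n : ℕ)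
    {F : Skeleton E × Skeleton E → ℝ≥0∞} (hF : Measurable F) :
    ∫⁻ ω, F (upTo n ω, tail n ω) ∂(D.pathLaw z) =
      ∫⁻ ω, ∫⁻ ω', F (upTo n ω, ω') ∂(D.pathLaw (ω n).2) ∂(D.pathLaw z) := by
  let κ : Kernel (Skeleton E) (Skeleton E) :=
    D.pathLaw.comap (fun ω : Skeleton E => (ω n).2) (by fun_prop)
  have hκ : ∀ ω, κ ω = D.pathLaw (ω n).2 := fun ω => Kernel.comap_apply _ _ _
  have : IsMarkovKernel κ := by unfold κ; infer_instance
  -- the law of the skeleton redrawn after event `n`: it has the same initial entry and the same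
  -- one-step transitions as the law of the skeleton
  let μ : Measure (Skeleton E) := ((D.pathLaw z) ⊗ₘ κ).map fun p => concat n p.1 p.2
  have : IsProbabilityMeasure μ := Measure.isProbabilityMeasure_map (by fun_prop)
  have hμ : ∀ H : Skeleton E → ℝ≥0∞, Measurable H →
      ∫⁻ ω, H ω ∂μ = ∫⁻ ω, ∫⁻ ω', H (concat n ω ω') ∂(D.pathLaw (ω n).2) ∂(D.pathLaw z) := by
    intro H hH
    rw [lintegral_map hH (by fun_prop), Measure.lintegral_compProd (by fun_prop)]
    simp_rw [hκ]
  have h0 : ∀ᵐ ω ∂μ, ω 0 = ((0 : ℝ≥0∞), z) := by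
    have hs : MeasurableSet {ω : Skeleton E | ω 0 = ((0 : ℝ≥0∞), z)} :=
      measurable_pi_apply 0 (measurableSet_singleton _)
    rw [ae_map_iff (by fun_prop) hs]
    refine Measure.ae_compProd_of_ae_ae ((measurable_concat n) hs) ?_
    filter_upwards [D.ae_pathLaw_zero z] with ω hω
    exact ae_of_all _ fun ω' => by simpa [concat] using hω
  have hstep : ∀ (m : ℕ) (G : Skeleton E × (ℝ≥0∞ × E) → ℝ≥0∞), Measurable G →
      ∫⁻ ω, G (upTo m ω, ω (m + 1)) ∂μ =
        ∫⁻ ω, ∫⁻ y, G (upTo m ω, y) ∂(D.step (ω m).2) ∂μ := by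
    intro m G hG
    have hM : Measurable fun ω : Skeleton E => ∫⁻ y, G (upTo m ω, y) ∂(D.step (ω m).2) :=
      Measurable.lintegral_kernel_prod_right' (κ := D.step.comap (fun ω : Skeleton E => (ω m).2)
        (by fun_prop)) (f := fun p => G (upTo m p.1, p.2)) (by fun_prop)
    rw [hμ _ (by fun_prop), hμ _ hM]
    rcases lt_or_ge m n with hmn | hmn
    · have e1 : ∀ ω ω' : Skeleton E, upTo m (concat n ω ω') = upTo m ω := by
        intro ω ω'
        ext1 k
        by_cases hk : k ≤ m
        · simp [upTo, concat, hk, hk.trans hmn.le]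
        · simp [upTo, concat, hk, hmn.le]
      have e2 : ∀ ω ω' : Skeleton E, concat n ω ω' (m + 1) = ω (m + 1) := by
        intro ω ω'
        simp [concat, Nat.succ_le_of_lt hmn]
      have e3 : ∀ ω ω' : Skeleton E, concat n ω ω' m = ω m := by
        intro ω ω'
        simp [concat, hmn.le]
      simp_rw [e1, e2, e3]
      simpa using D.lintegral_pathLaw_succ z m hG
    · obtain ⟨j, rfl⟩ := Nat.exists_eq_add_of_le hmn
      refine lintegral_congr fun ω => ?_
      have e1 : ∀ ω' : Skeleton E, ω' 0 = ((0 : ℝ≥0∞), (ω n).2) →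
          upTo (n + j) (concat n ω ω') = concat n ω (upTo j ω') ∧
          (concat n ω ω' (n + j)).2 = (ω' j).2 := by
        intro ω' h
        have h2 : (concat n ω ω' (n + j)).2 = (ω' j).2 := by
          rcases Nat.eq_zero_or_pos j with rfl | hj
          · simp [concat, h]
          · simp [concat, show ¬ n + j ≤ n by omega]
        refine ⟨?_, h2⟩
        ext1 k
        simp only [upTo]
        rw [h2]
        rcases le_or_gt k n with hk | hk
        · simp [concat, hk, hk.trans (Nat.le_add_right n j)]
        · rcases le_or_gt k (n + j) with hk2 | hk2
          · simp [upTo, concat, hk.not_ge, hk2]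
            intro h3
            omega
          · simp [upTo, concat, hk.not_ge, hk2.not_ge, show ¬ k - n ≤ j by omega]
      have e2 : ∀ ω' : Skeleton E, concat n ω ω' (n + j + 1) = ω' (j + 1) := by
        intro ω'
        simp [concat, show ¬ n + j + 1 ≤ n by omega, show n + j + 1 - n = j + 1 by omega]
      have hc : Measurable fun ω' : Skeleton E => concat n ω ω' :=
        (measurable_concat n).comp measurable_prodMk_left
      have e3 := D.lintegral_pathLaw_succ (ω n).2 j (G := fun p => G (concat n ω p.1, p.2))
        (by fun_prop)
      calc _ = ∫⁻ ω', G (concat n ω (upTo j ω'), ω' (j + 1)) ∂(D.pathLaw (ω n).2) := by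
            refine lintegral_congr_ae ?_
            filter_upwards [D.ae_pathLaw_zero (ω n).2] with ω' h
            rw [(e1 ω' h).1, e2]
        _ = _ := e3
        _ = _ := by
            refine lintegral_congr_ae ?_
            filter_upwards [D.ae_pathLaw_zero (ω n).2] with ω' h
            simp only [(e1 ω' h).1, (e1 ω' h).2]
  have hμe : μ = D.pathLaw z := D.eq_pathLaw z μ h0 hstep
  conv_lhs => rw [← hμe]
  rw [hμ _ (by fun_prop)]
  refine lintegral_congr fun ω => lintegral_congr_ae ?_
  filter_upwards [D.ae_pathLaw_zero (ω n).2] with ω' h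
  congr 2
  · ext1 k
    by_cases hk : k ≤ n
    · simp [upTo, concat, hk]
    · simp [upTo, concat, hk]
  · ext1 k
    rcases Nat.eq_zero_or_pos k with rfl | hk
    · simp [tail, concat, h]
    · simp [tail, concat, hk.ne', show ¬ n + k ≤ n by omega]

end PDMP

/-! ### Lack of memory of the waiting times -/

lemma measurable_exponentialPDF (r : ℝ) : Measurable (exponentialPDF r) :=
  (measurable_exponentialPDFReal r).ennreal_ofReal

lemma expMeasure_eq_withDensity (r : ℝ) : expMeasure r = volume.withDensity (exponentialPDF r) :=
  rfl

lemma expMeasure_Iic_zero (r : ℝ) : expMeasure r (Set.Iic 0) = 0 := by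
  rw [expMeasure_eq_withDensity, withDensity_apply _ measurableSet_Iic,
    setLIntegral_congr (Iio_ae_eq_Iic (μ := volume)).symm]
  exact lintegral_exponentialPDF_of_nonpos le_rfl

lemma expMeasure_singleton (r x : ℝ) : expMeasure r {x} = 0 :=
  withDensity_absolutelyContinuous _ _ (measure_singleton x)

/-- The exponential law is memoryless. -/
lemma lintegral_expMeasure_shift {c : ℝ} (hc : 0 ≤ c) {g : ℝ → ℝ≥0∞} (hg : Measurable g) :
    ∫⁻ u, (Set.Ioi c).indicator (fun u => g (u - c)) u ∂(expMeasure 1) =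
      ENNReal.ofReal (Real.exp (-c)) * ∫⁻ u, g u ∂(expMeasure 1) := by
  have hp := measurable_exponentialPDF 1
  rw [expMeasure_eq_withDensity, lintegral_withDensity_eq_lintegral_mul _ hp
    (by measurability), lintegral_withDensity_eq_lintegral_mul _ hp hg,
    ← lintegral_const_mul _ (hp.mul hg), ← lintegral_add_right_eq_self _ c]
  have h0 : ∀ᵐ u : ℝ, u ≠ 0 := by simp [ae_iff]
  refine lintegral_congr_ae ?_
  filter_upwards [h0] with u hu
  rcases lt_or_gt_of_ne hu with hu | hu
  · rw [Pi.mul_apply, Pi.mul_apply, exponentialPDF_of_neg hu,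
      Set.indicator_of_notMem (by simpa using hu.le)]
    simp
  · rw [Pi.mul_apply, Pi.mul_apply, Set.indicator_of_mem (by simpa using hu),
      exponentialPDF_of_nonneg hu.le, exponentialPDF_of_nonneg (by linarith), ← mul_assoc,
      ← ENNReal.ofReal_mul (Real.exp_nonneg _), add_sub_cancel_right]
    congr 2
    rw [one_mul, one_mul, one_mul, one_mul, ← Real.exp_add]
    congr 1
    ring

namespace PDMP

variable {E : Type*} [MeasurableSpace E] (D : PDMP E)

lemma cumRate_lt_top (z : E) (t : ℝ≥0) : D.cumRate z t < ∞ := D.rate_integrable z t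

lemma cumRate_add (z : E) (r t : ℝ≥0) :
    D.cumRate z (r + t) = D.cumRate z r + D.cumRate (D.flow r z) t := by
  have hm : Measurable fun s : ℝ => (D.rate (D.flow s z) : ℝ≥0∞) :=
    (D.measurable_rate.comp (D.measurable_flow.comp measurable_prodMk_right)).coe_nnreal_ennreal
  have h1 : Set.Icc (0 : ℝ) ((r + t : ℝ≥0) : ℝ) = Set.Icc 0 (r : ℝ) ∪ Set.Ioc (r : ℝ) (r + t) := by
    rw [NNReal.coe_add]
    exact (Set.Icc_union_Ioc_eq_Icc r.2 (by simp)).symm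
  have h2 : Disjoint (Set.Icc 0 (r : ℝ)) (Set.Ioc (r : ℝ) (r + t)) := by
    rw [Set.disjoint_left]
    intro x hx hx'
    exact absurd hx.2 (not_le.2 hx'.1)
  rw [cumRate, h1, lintegral_union measurableSet_Ioc h2, cumRate, cumRate]
  congr 1
  rw [setLIntegral_congr (Ioc_ae_eq_Icc (μ := volume)), ← lintegral_indicator measurableSet_Icc,
    ← lintegral_indicator measurableSet_Icc, ← lintegral_add_right_eq_self _ (r : ℝ)]
  refine lintegral_congr fun s => ?_
  have : s + r ∈ Set.Icc (r : ℝ) (r + t) ↔ s ∈ Set.Icc (0 : ℝ) t := by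
    simp only [Set.mem_Icc]
    constructor <;> rintro ⟨h1, h2⟩ <;> constructor <;> linarith
  by_cases hs : s ∈ Set.Icc (0 : ℝ) t
  · rw [Set.indicator_of_mem hs, Set.indicator_of_mem (this.2 hs), D.flow_add]
  · rw [Set.indicator_of_notMem hs, Set.indicator_of_notMem fun h => hs (this.1 h)]

lemma continuous_cumRate (z : E) : Continuous (D.cumRate z) := by
  have hm : Measurable fun s : ℝ => (D.rate (D.flow s z) : ℝ≥0) :=
    D.measurable_rate.comp (D.measurable_flow.comp measurable_prodMk_right)
  have hint : ∀ T : ℝ≥0, IntegrableOn (fun s : ℝ => (D.rate (D.flow s z) : ℝ)) (Set.Icc 0 T) := by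
    intro T
    refine ⟨hm.coe_nnreal_real.aestronglyMeasurable, ?_⟩
    have := D.rate_integrable z T
    simpa [HasFiniteIntegral, enorm_eq_nnnorm] using this
  have heq : ∀ t : ℝ≥0, D.cumRate z t =
      ENNReal.ofReal (∫ s in Set.Icc 0 (t : ℝ), (D.rate (D.flow s z) : ℝ)) := by
    intro t
    rw [ofReal_integral_eq_lintegral_ofReal (hint t) (ae_of_all _ fun s => NNReal.coe_nonneg _)]
    simp [cumRate]
  rw [continuous_iff_continuousAt]
  intro t
  have h1 := intervalIntegral.continuousOn_primitive_Icc (hint (t + 1))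
  have h2 : ContinuousAt
      (fun t : ℝ≥0 => ∫ s in Set.Icc 0 (t : ℝ), (D.rate (D.flow s z) : ℝ)) t := by
    have h3 : ContinuousOn (fun t : ℝ≥0 => ∫ s in Set.Icc 0 (t : ℝ), (D.rate (D.flow s z) : ℝ))
        (Set.Iic (t + 1)) :=
      h1.comp NNReal.continuous_coe.continuousOn fun s hs => ⟨s.2, by exact_mod_cast hs⟩
    exact h3.continuousAt (Iic_mem_nhds (by simp))
  rw [show D.cumRate z = _ from funext heq]
  exact ENNReal.continuous_ofReal.continuousAt.comp h2

lemma cumRate_zero (z : E) : D.cumRate z 0 = 0 := by simp [cumRate]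

/-- As the integrated rate is continuous, the waiting time exceeds `r` exactly when the clock has
not rung by time `r`. -/
lemma lt_waiting_iff (z : E) (u : ℝ) (r : ℝ≥0) :
    (r : ℝ≥0∞) < D.waiting (z, u) ↔ D.cumRate z r < ENNReal.ofReal u := by
  constructor
  · intro h
    by_contra! h2
    exact absurd h (not_lt.2 (iInf₂_le r h2))
  · intro h
    obtain ⟨r', hr', h'⟩ : ∃ r', r < r' ∧ D.cumRate z r' < ENNReal.ofReal u := by
      have h1 : ∀ᶠ s in 𝓝[>] r, D.cumRate z s < ENNReal.ofReal u :=
        ((D.continuous_cumRate z).continuousAt.eventually (gt_mem_nhds h)).filter_mono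
          nhdsWithin_le_nhds
      obtain ⟨s, hs1, hs2⟩ := (h1.and self_mem_nhdsWithin).exists
      exact ⟨s, hs2, hs1⟩
    refine lt_of_lt_of_le (ENNReal.coe_lt_coe.2 hr') (le_iInf₂ fun t ht => ?_)
    by_contra! h2
    exact absurd (ht.trans (D.cumRate_mono z (ENNReal.coe_lt_coe.1 h2).le)) (not_le.2 h')

/-- The remaining waiting time, seen from time `r`, is the waiting time of the PDMP started at
`φ_r z` and driven by what remains of the exponential clock. -/
lemma waiting_sub (z : E) (u : ℝ) (r : ℝ≥0) :
    D.waiting (z, u) - r = D.waiting (D.flow r z, u - (D.cumRate z r).toReal) := by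
  have key : ∀ t : ℝ≥0, (t : ℝ≥0∞) < D.waiting (z, u) - r ↔
      (t : ℝ≥0∞) < D.waiting (D.flow r z, u - (D.cumRate z r).toReal) := by
    intro t
    rw [lt_tsub_iff_left, ← ENNReal.coe_add, lt_waiting_iff, lt_waiting_iff, cumRate_add,
      ENNReal.ofReal_sub _ ENNReal.toReal_nonneg, ENNReal.ofReal_toReal (D.cumRate_lt_top z r).ne,
      lt_tsub_iff_left]
  exact le_antisymm (ENNReal.le_of_forall_nnreal_lt fun t ht => ((key t).1 ht).le)
    (ENNReal.le_of_forall_nnreal_lt fun t ht => ((key t).2 ht).le)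

lemma lintegral_waitingKernel (z : E) {m : ℝ≥0∞ → ℝ≥0∞} (hm : Measurable m) :
    ∫⁻ w, m w ∂(D.waitingKernel z) = ∫⁻ u, m (D.waiting (z, u)) ∂(expMeasure 1) := by
  have := isProbabilityMeasure_expMeasure (r := 1) one_pos
  have hm' : Measurable fun p : E × ℝ => m (D.waiting p) := hm.comp D.measurable_waiting
  rw [waitingKernel, Kernel.lintegral_map _ D.measurable_waiting _ hm, Kernel.prod_apply,
    Kernel.id_apply, Kernel.const_apply, lintegral_prod _ hm'.aemeasurable,
    lintegral_dirac' _ hm'.lintegral_prod_right']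

/-- Waiting times have no atoms, except at infinity: the waiting time is `c` only if the clock `u`
is the integrated rate at time `c`. -/
lemma waitingKernel_singleton (z : E) {c : ℝ≥0∞} (hc : c ≠ ∞) : D.waitingKernel z {c} = 0 := by
  lift c to ℝ≥0 using hc with t
  have hm : Measurable (({(t : ℝ≥0∞)} : Set ℝ≥0∞).indicator (1 : ℝ≥0∞ → ℝ≥0∞)) :=
    measurable_one.indicator (measurableSet_singleton _)
  rw [← lintegral_indicator_one (measurableSet_singleton (t : ℝ≥0∞)),
    lintegral_waitingKernel _ _ hm]
  refine (lintegral_eq_zero_iff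
    (hm.comp (D.measurable_waiting.comp measurable_prodMk_left))).2 ?_
  have h0 : ∀ᵐ u ∂(expMeasure 1), u ∉ Set.Iic (0 : ℝ) ∪ {(D.cumRate z t).toReal} := by
    rw [ae_iff]
    simp only [not_not, Set.ofPred_mem_eq]
    exact measure_union_null (expMeasure_Iic_zero 1) (expMeasure_singleton 1 _)
  filter_upwards [h0] with u hu
  refine Set.indicator_of_notMem (fun h => hu ?_) _
  have h : D.waiting (z, u) = t := h
  have h1 : ENNReal.ofReal u ≤ D.cumRate z t := by
    have := mt (D.lt_waiting_iff z u t).2 (by rw [h]; exact lt_irrefl _)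
    exact not_lt.1 this
  have h2 : D.cumRate z t ≤ ENNReal.ofReal u := by
    rcases eq_or_ne t 0 with rfl | ht
    · rw [cumRate_zero]
      exact zero_le
    have hlt : ∀ᶠ s in 𝓝[<] t, D.cumRate z s ≤ ENNReal.ofReal u := by
      filter_upwards [self_mem_nhdsWithin] with s hs
      refine ((D.lt_waiting_iff z u s).1 ?_).le
      rw [h]
      exact_mod_cast hs
    have : (𝓝[<] t).NeBot := nhdsLT_neBot_of_exists_lt ⟨0, pos_iff_ne_zero.2 ht⟩
    exact le_of_tendsto ((D.continuous_cumRate z).continuousAt.mono_left nhdsWithin_le_nhds) hlt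
  rcases le_or_gt u 0 with hu0 | hu0
  · exact Or.inl hu0
  · right
    rw [Set.mem_singleton_iff, ← le_antisymm h1 h2, ENNReal.toReal_ofReal hu0.le]

/-- The waiting times are memoryless along the flow: given that it exceeds `r`, the waiting time
from `z` minus `r` has the law of the waiting time from `φ_r z`. -/
lemma lintegral_waitingKernel_shift (z : E) (r : ℝ≥0) {m : ℝ≥0∞ → ℝ≥0∞} (hm : Measurable m) :
    ∫⁻ w, (Set.Ioi (r : ℝ≥0∞)).indicator (fun w => m (w - r)) w ∂(D.waitingKernel z) =
      D.waitingKernel z (Set.Ioi (r : ℝ≥0∞)) * ∫⁻ w, m w ∂(D.waitingKernel (D.flow r z)) := by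
  have hc := (D.cumRate_lt_top z r).ne
  have key : ∀ m : ℝ≥0∞ → ℝ≥0∞, Measurable m →
      ∫⁻ w, (Set.Ioi (r : ℝ≥0∞)).indicator (fun w => m (w - r)) w ∂(D.waitingKernel z) =
      ENNReal.ofReal (Real.exp (-(D.cumRate z r).toReal)) *
        ∫⁻ w, m w ∂(D.waitingKernel (D.flow r z)) := by
    intro m hm
    have hm2 : Measurable fun w : ℝ≥0∞ => m (w - r) := hm.comp (measurable_id.sub_const _)
    rw [lintegral_waitingKernel _ _ (hm2.indicator measurableSet_Ioi),
      lintegral_waitingKernel _ _ hm,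
      ← lintegral_expMeasure_shift ENNReal.toReal_nonneg (g := fun u => m (D.waiting (_, u)))
        (hm.comp (D.measurable_waiting.comp measurable_prodMk_left))]
    refine lintegral_congr fun u => ?_
    have h1 : D.waiting (z, u) ∈ Set.Ioi (r : ℝ≥0∞) ↔ u ∈ Set.Ioi (D.cumRate z r).toReal := by
      rw [Set.mem_Ioi, Set.mem_Ioi, lt_waiting_iff, ← ENNReal.ofReal_toReal hc,
        ENNReal.ofReal_lt_ofReal_iff', ENNReal.ofReal_toReal hc, and_iff_left_iff_imp]
      exact fun h => ENNReal.toReal_nonneg.trans_lt h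
    by_cases hu : u ∈ Set.Ioi (D.cumRate z r).toReal
    · rw [Set.indicator_of_mem hu, Set.indicator_of_mem (h1.2 hu), D.waiting_sub z u r]
    · rw [Set.indicator_of_notMem hu, Set.indicator_of_notMem fun h => hu (h1.1 h)]
  have h1 := key (fun _ => 1) measurable_const
  rw [lintegral_const, measure_univ, mul_one, mul_one] at h1
  rw [key m hm, ← h1]
  congr 1
  rw [← lintegral_indicator_one measurableSet_Ioi]
  rfl

end PDMP

/-! ### Event times of a skeleton -/

namespace Skeleton

variable {E : Type*}

@[simp]
lemma time_zero (ω : Skeleton E) : ω.time 0 = (ω 0).1 := by simp [time]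

lemma time_succ (ω : Skeleton E) (n : ℕ) : ω.time (n + 1) = ω.time n + (ω (n + 1)).1 := by
  rw [time, Finset.sum_range_succ, time]

lemma time_mono (ω : Skeleton E) : Monotone ω.time :=
  monotone_nat_of_le_succ fun n => by rw [time_succ]; exact le_self_add

lemma lastLE_eq {ω : Skeleton E} {t : ℝ} {n : ℕ} (h1 : ω.time n ≤ ENNReal.ofReal t)
    (h2 : ENNReal.ofReal t < ω.time (n + 1)) : ω.lastLE t = n := by
  have h : {k | ω.time k ≤ ENNReal.ofReal t} = Set.Iic n := by
    ext k
    constructor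
    · intro hk
      by_contra! h3
      exact absurd (h2.trans_le (ω.time_mono (Nat.succ_le_of_lt (not_le.1 h3)))) (not_lt.2 hk)
    · intro hk
      exact (ω.time_mono hk).trans h1
  rw [lastLE, h, csSup_Iic]

lemma lastLT_eq {ω : Skeleton E} {t : ℝ} {n : ℕ} (h1 : ω.time n < ENNReal.ofReal t)
    (h2 : ENNReal.ofReal t ≤ ω.time (n + 1)) : ω.lastLT t = n := by
  have h : {k | ω.time k < ENNReal.ofReal t} = Set.Iic n := by
    ext k
    constructor
    · intro hk
      by_contra! h3
      exact absurd (h2.trans (ω.time_mono (Nat.succ_le_of_lt (not_le.1 h3)))) (not_le.2 hk)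
    · intro hk
      exact (ω.time_mono hk).trans_lt h1
  rw [lastLT, h, csSup_Iic]

lemma exists_time_le_lt {ω : Skeleton E} (h : Tendsto ω.time atTop (𝓝 ∞)) {t : ℝ}
    (h0 : (ω 0).1 = 0) :
    ∃ n, ω.time n ≤ ENNReal.ofReal t ∧ ENNReal.ofReal t < ω.time (n + 1) := by
  classical
  have hex : ∃ n, ENNReal.ofReal t < ω.time n :=
    (h.eventually (lt_mem_nhds ENNReal.ofReal_lt_top)).exists
  obtain ⟨m, hm⟩ : ∃ m, Nat.find hex = m + 1 := by
    refine Nat.exists_eq_succ_of_ne_zero fun h1 => ?_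
    have := Nat.find_spec hex
    rw [h1, time_zero, h0] at this
    exact not_lt_zero this
  refine ⟨m, not_lt.1 (Nat.find_min hex (by omega)), ?_⟩
  rw [← hm]
  exact Nat.find_spec hex

lemma exists_time_lt_le {ω : Skeleton E} (h : Tendsto ω.time atTop (𝓝 ∞)) {t : ℝ}
    (h0 : (ω 0).1 = 0) (ht : 0 < t) :
    ∃ n, ω.time n < ENNReal.ofReal t ∧ ENNReal.ofReal t ≤ ω.time (n + 1) := by
  classical
  have hex : ∃ n, ENNReal.ofReal t ≤ ω.time n :=
    (h.eventually (le_mem_nhds ENNReal.ofReal_lt_top)).exists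
  obtain ⟨m, hm⟩ : ∃ m, Nat.find hex = m + 1 := by
    refine Nat.exists_eq_succ_of_ne_zero fun h1 => ?_
    have := Nat.find_spec hex
    rw [h1, time_zero, h0] at this
    exact absurd this (by simpa using ht)
  refine ⟨m, not_le.1 (Nat.find_min hex (by omega)), ?_⟩
  rw [← hm]
  exact Nat.find_spec hex

lemma lastLE_eq_succ_iff (ω : Skeleton E) (t : ℝ) (n : ℕ) :
    ω.lastLE t = n + 1 ↔ ω.time (n + 1) ≤ ENNReal.ofReal t ∧ ENNReal.ofReal t < ω.time (n + 2) := by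
  refine ⟨fun h => ?_, fun h => lastLE_eq h.1 h.2⟩
  have hne : {k | ω.time k ≤ ENNReal.ofReal t}.Nonempty := by
    by_contra h1
    rw [Set.not_nonempty_iff_eq_empty] at h1
    rw [lastLE, h1] at h
    simp at h
  have hb : BddAbove {k | ω.time k ≤ ENNReal.ofReal t} := by
    by_contra h1
    rw [lastLE, Nat.sSup_of_not_bddAbove h1] at h
    simp at h
  have h1 := Nat.sSup_mem hne hb
  rw [← lastLE, h] at h1
  refine ⟨h1, not_le.1 fun h2 => ?_⟩
  have h3 := le_csSup hb h2
  rw [← lastLE, h] at h3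
  omega

lemma lastLT_eq_succ_iff (ω : Skeleton E) (t : ℝ) (n : ℕ) :
    ω.lastLT t = n + 1 ↔ ω.time (n + 1) < ENNReal.ofReal t ∧ ENNReal.ofReal t ≤ ω.time (n + 2) := by
  refine ⟨fun h => ?_, fun h => lastLT_eq h.1 h.2⟩
  have hne : {k | ω.time k < ENNReal.ofReal t}.Nonempty := by
    by_contra h1
    rw [Set.not_nonempty_iff_eq_empty] at h1
    rw [lastLT, h1] at h
    simp at h
  have hb : BddAbove {k | ω.time k < ENNReal.ofReal t} := by
    by_contra h1
    rw [lastLT, Nat.sSup_of_not_bddAbove h1] at h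
    simp at h
  have h1 := Nat.sSup_mem hne hb
  rw [← lastLT, h] at h1
  refine ⟨h1, not_lt.1 fun h2 => ?_⟩
  have h3 := le_csSup hb h2
  rw [← lastLT, h] at h3
  omega

/-- Replaces the entries after the last event by default values. Their states are never used, but
the Markov property at a fixed time does not preserve their law. -/
def clean (ω : Skeleton E) : Skeleton E :=
  fun n => if ω.time n = ∞ then (∞, (ω 0).2) else ω n

/-- A regular skeleton: it starts at time `0`, its events are separated by positive times, and
there are finitely many of them in bounded time. -/
structure IsRegular (ω : Skeleton E) : Prop where
  fst_zero : (ω 0).1 = 0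
  pos : ∀ n, 0 < n → 0 < (ω n).1
  tendsto : Tendsto ω.time atTop (𝓝 ∞)

variable [MeasurableSpace E]

@[fun_prop]
lemma measurable_time (n : ℕ) : Measurable fun ω : Skeleton E => ω.time n := by
  unfold time; fun_prop

/-- For an `ℕ`-valued function whose value `0` is only a default, such as `lastLE`, it is enough to
look at the positive values. -/
lemma measurable_nat_of_succ {α : Type*} [MeasurableSpace α] {f : α → ℕ}
    (h : ∀ n, MeasurableSet {a | f a = n + 1}) : Measurable f := by
  refine measurable_to_countable' fun n => ?_
  cases n with
  | zero =>
    have : f ⁻¹' {0} = (⋃ n, {a | f a = n + 1})ᶜ := by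
      ext a
      simp only [Set.mem_preimage, Set.mem_singleton_iff, Set.mem_compl_iff, Set.mem_iUnion,
        Set.mem_ofPred_eq, not_exists]
      refine ⟨fun h n => by omega, fun h => ?_⟩
      by_contra h1
      exact h (f a - 1) (by omega)
    rw [this]
    exact (MeasurableSet.iUnion h).compl
  | succ n => exact h n

@[fun_prop]
lemma measurable_lastLE : Measurable fun p : Skeleton E × ℝ => p.1.lastLE p.2 := by
  refine measurable_nat_of_succ fun n => ?_
  simp_rw [lastLE_eq_succ_iff]
  have h1 : ∀ k, Measurable fun p : Skeleton E × ℝ => p.1.time k :=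
    fun k => (measurable_time k).comp measurable_fst
  have h2 : Measurable fun p : Skeleton E × ℝ => ENNReal.ofReal p.2 := by fun_prop
  exact (measurableSet_le (h1 _) h2).inter (measurableSet_lt h2 (h1 _))

@[fun_prop]
lemma measurable_lastLT : Measurable fun p : Skeleton E × ℝ => p.1.lastLT p.2 := by
  refine measurable_nat_of_succ fun n => ?_
  simp_rw [lastLT_eq_succ_iff]
  have h1 : ∀ k, Measurable fun p : Skeleton E × ℝ => p.1.time k :=
    fun k => (measurable_time k).comp measurable_fst
  have h2 : Measurable fun p : Skeleton E × ℝ => ENNReal.ofReal p.2 := by fun_prop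
  exact (measurableSet_lt (h1 _) h2).inter (measurableSet_le h2 (h1 _))

@[fun_prop]
lemma measurable_clean : Measurable (clean : Skeleton E → Skeleton E) := by
  refine measurable_pi_lambda _ fun n => ?_
  exact Measurable.ite (measurable_time n (measurableSet_singleton ∞)) (by fun_prop) (by fun_prop)

/-- Measurability of a function whose index is chosen measurably. -/
lemma measurable_comp_nat {α β : Type*} [MeasurableSpace α] [MeasurableSpace β] {f : ℕ → α → β}
    (hf : ∀ n, Measurable (f n)) {N : α → ℕ} (hN : Measurable N) :
    Measurable fun a => f (N a) a :=
  (measurable_from_prod_countable_right (f := fun q : ℕ × α => f q.1 q.2) hf).comp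
    (hN.prodMk measurable_id)

end Skeleton

section FinPath

variable {E : Type*} [MeasurableSpace E]

lemma measurable_sigmaMk {ι : Type*} {β : ι → Type*} [∀ i, MeasurableSpace (β i)] (i : ι) :
    Measurable (Sigma.mk i : β i → Sigma β) :=
  fun _ hs => MeasurableSpace.measurableSet_iInf.1 hs i

lemma measurable_of_sigma {ι α : Type*} {β : ι → Type*} [∀ i, MeasurableSpace (β i)]
    [MeasurableSpace α] {f : Sigma β → α} (h : ∀ i, Measurable fun x : β i => f ⟨i, x⟩) :
    Measurable f :=
  fun _ hs => MeasurableSpace.measurableSet_iInf.2 fun i => h i hs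

/-- A function of a finite path is measurable if it is so on the paths with `k` events, for
every `k`. -/
lemma measurable_of_finPath {α : Type*} [MeasurableSpace α] {g : FinPath E → α}
    (h : ∀ k, Measurable fun q : E × (Fin k → ℝ × E) => g (q.1, ⟨k, q.2⟩)) : Measurable g := by
  classical
  rcases isEmpty_or_nonempty E with hE | ⟨⟨e⟩⟩
  · have : IsEmpty (FinPath E) := inferInstance
    exact measurable_of_empty g
  let proj : (k : ℕ) → (Σ k : ℕ, Fin k → ℝ × E) → (Fin k → ℝ × E) :=
    fun k s => if hk : s.1 = k then hk ▸ s.2 else fun _ => (0, e)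
  have hproj : ∀ k, Measurable (proj k) := by
    intro k
    refine measurable_of_sigma fun i => ?_
    by_cases hi : i = k
    · subst hi
      simp only [proj, dite_true]
      exact measurable_id
    · simp only [proj, hi, dite_false]
      exact measurable_const
  intro S hS
  have : g ⁻¹' S = ⋃ k, {w : FinPath E | w.2.1 = k} ∩ {w | g (w.1, ⟨k, proj k w.2⟩) ∈ S} := by
    ext ⟨z, k, x⟩
    simp only [Set.mem_preimage, Set.mem_iUnion, Set.mem_inter_iff, Set.mem_ofPred_eq]
    constructor
    · intro hx
      refine ⟨k, rfl, ?_⟩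
      simpa [proj] using hx
    · rintro ⟨_, rfl, hx⟩
      simpa [proj] using hx
  rw [this]
  refine MeasurableSet.iUnion fun k => MeasurableSet.inter ?_ ?_
  · have h1 : Measurable fun w : FinPath E => w.2.1 :=
      (measurable_of_sigma fun i => measurable_const).comp measurable_snd
    exact h1 (measurableSet_singleton k)
  · exact (h k).comp (measurable_fst.prodMk ((hproj k).comp measurable_snd)) hS

end FinPath

/-! ### The Markov property at a fixed time -/

namespace PDMP

variable {E : Type*} [MeasurableSpace E] (D : PDMP E)

open Skeleton

lemma lintegral_step (z : E) {G : ℝ≥0∞ × E → ℝ≥0∞} (hG : Measurable G) :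
    ∫⁻ y, G y ∂(D.step z) =
      ∫⁻ w, ∫⁻ z', G (w, z') ∂(D.jump (D.flow w.toReal z)) ∂(D.waitingKernel z) := by
  rw [step, Kernel.lintegral_compProd _ _ _ hG]
  simp_rw [afterJump, Kernel.comap_apply]

lemma step_fst_eq_zero (z : E) {s : Set ℝ≥0∞} (hs : MeasurableSet s)
    (h : D.waitingKernel z s = 0) : D.step z {y | y.1 ∈ s} = 0 := by
  have := D.markov_jump
  have hs' : MeasurableSet {y : ℝ≥0∞ × E | y.1 ∈ s} := measurable_fst hs
  rw [← lintegral_indicator_one hs', lintegral_step _ _ (measurable_one.indicator hs'), ← h,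
    ← lintegral_indicator_one hs]
  refine lintegral_congr fun w => ?_
  have : ∀ z', {y : ℝ≥0∞ × E | y.1 ∈ s}.indicator (1 : ℝ≥0∞ × E → ℝ≥0∞) (w, z') =
    s.indicator (1 : ℝ≥0∞ → ℝ≥0∞) w := fun z' => rfl
  simp_rw [this, lintegral_const, measure_univ, mul_one]

/-- A property of entry `m + 1` and of the past that fails with probability `0` given the past
fails with probability `0`. -/
lemma ae_pathLaw_succ (z : E) (m : ℕ) {S : Set (Skeleton E × (ℝ≥0∞ × E))} (hS : MeasurableSet S)
    (h : ∀ ω : Skeleton E, D.step (ω m).2 {y | (upTo m ω, y) ∈ S} = 0) :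
    ∀ᵐ ω ∂(D.pathLaw z), (upTo m ω, ω (m + 1)) ∉ S := by
  have hm : Measurable fun ω : Skeleton E => (upTo m ω, ω (m + 1)) := by fun_prop
  have hset : {ω : Skeleton E | ¬ (upTo m ω, ω (m + 1)) ∉ S} =
      (fun ω : Skeleton E => (upTo m ω, ω (m + 1))) ⁻¹' S := by
    ext; simp
  rw [ae_iff, hset, ← lintegral_indicator_one (hm hS)]
  have h1 := D.lintegral_pathLaw_succ z m (G := S.indicator 1) (measurable_one.indicator hS)
  refine h1.trans ?_
  have h2 : ∀ ω : Skeleton E, ∫⁻ y, S.indicator 1 (upTo m ω, y) ∂(D.step (ω m).2) = 0 := by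
    intro ω
    rw [← h ω, ← lintegral_indicator_one (s := {y | (upTo m ω, y) ∈ S})
      (measurable_prodMk_left hS)]
    rfl
  simp [h2]

lemma time_upTo {E : Type*} (ω : Skeleton E) {m n : ℕ} (h : m ≤ n) :
    (upTo n ω).time m = ω.time m := by
  refine Finset.sum_congr rfl fun i hi => ?_
  have : i ≤ n := by have := Finset.mem_range.1 hi; omega
  simp [upTo, this]

lemma ae_isRegular [MeasurableSingletonClass E] (hD : D.NonExplosive) (z : E) :
    ∀ᵐ ω ∂(D.pathLaw z), ω.IsRegular := by
  have hpos : ∀ᵐ ω ∂(D.pathLaw z), ∀ m : ℕ, (ω (m + 1)).1 ≠ 0 := by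
    rw [ae_all_iff]
    intro m
    have hS : MeasurableSet {q : Skeleton E × (ℝ≥0∞ × E) | q.2.1 ∈ ({0} : Set ℝ≥0∞)} :=
      (measurable_fst.comp measurable_snd) (measurableSet_singleton 0)
    refine (D.ae_pathLaw_succ z m hS fun ω => ?_).mono fun ω h => h
    exact D.step_fst_eq_zero _ (measurableSet_singleton 0)
      (D.waitingKernel_singleton _ ENNReal.zero_ne_top)
  filter_upwards [hpos, hD z, D.ae_pathLaw_zero z] with ω h1 h2 h3
  refine ⟨by rw [h3], fun n hn => ?_, h2⟩
  obtain ⟨m, rfl⟩ := Nat.exists_eq_succ_of_ne_zero hn.ne'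
  exact pos_iff_ne_zero.2 (h1 m)

/-- A given positive time is almost surely not the time of an event. -/
lemma ae_time_ne [MeasurableSingletonClass E] (z : E) {p : ℝ} (hp : 0 < p) :
    ∀ᵐ ω ∂(D.pathLaw z), ∀ m : ℕ, ω.time m ≠ ENNReal.ofReal p := by
  have h : ∀ᵐ ω ∂(D.pathLaw z), ∀ m : ℕ, ω.time (m + 1) ≠ ENNReal.ofReal p := by
    rw [ae_all_iff]
    intro m
    have hS : MeasurableSet {q : Skeleton E × (ℝ≥0∞ × E) |
        q.1.time m + q.2.1 = ENNReal.ofReal p} :=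
      (((measurable_time m).comp measurable_fst).add (measurable_fst.comp measurable_snd))
        (measurableSet_singleton _)
    refine (D.ae_pathLaw_succ z m hS fun ω => ?_).mono fun ω h => ?_
    · have h1 : {y : ℝ≥0∞ × E | (upTo m ω).time m + y.1 = ENNReal.ofReal p} ⊆
          {y | y.1 ∈ ({ENNReal.ofReal p - (upTo m ω).time m} : Set ℝ≥0∞)} := by
        rintro y hy
        have hy : (upTo m ω).time m + y.1 = ENNReal.ofReal p := hy
        have hne : (upTo m ω).time m ≠ ∞ := fun h => by
          rw [h, top_add] at hy
          exact ENNReal.ofReal_ne_top hy.symm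
        exact (ENNReal.sub_eq_of_eq_add_rev hne hy.symm).symm
      exact measure_mono_null h1 (D.step_fst_eq_zero _ (measurableSet_singleton _)
        (D.waitingKernel_singleton _ (by simp)))
    · intro h1
      apply h
      simp only [Set.mem_ofPred_eq]
      rw [time_upTo ω le_rfl, ← time_succ, h1]
  filter_upwards [h, D.ae_pathLaw_zero z] with ω h1 h2 m
  cases m with
  | zero =>
    rw [time_zero, h2]
    exact (ENNReal.ofReal_pos.2 hp).ne
  | succ m => exact h1 m

/-- The skeleton with initial state `z'`, first waiting time `w`, and then the course of `ω`. -/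
def graft (z' : E) (w : ℝ≥0∞) (ω : Skeleton E) : Skeleton E :=
  fun k => if k = 0 then (0, z') else if k = 1 then (w, (ω 0).2) else ω (k - 1)

/-- The skeleton seen from time `r`, if the first event has not occurred by then. -/
def advance (r : ℝ) (ω : Skeleton E) : Skeleton E :=
  fun k => if k = 0 then (0, D.flow r (ω 0).2)
    else if k = 1 then ((ω 1).1 - ENNReal.ofReal r, (ω 1).2) else ω k

/-- The skeleton seen from time `p`. -/
def after (p : ℝ) (ω : Skeleton E) : Skeleton E :=
  D.advance (p - (ω.time (ω.lastLE p)).toReal) (tail (ω.lastLE p) ω)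

@[fun_prop]
lemma measurable_graft : Measurable fun q : E × ℝ≥0∞ × Skeleton E => graft q.1 q.2.1 q.2.2 := by
  refine measurable_pi_lambda _ fun k => ?_
  unfold graft
  split_ifs <;> fun_prop

@[fun_prop]
lemma measurable_advance : Measurable fun q : ℝ × Skeleton E => D.advance q.1 q.2 := by
  refine measurable_pi_lambda _ fun k => ?_
  have h : Measurable fun q : ℝ × Skeleton E => D.flow q.1 (q.2 0).2 :=
    D.measurable_flow.comp (f := fun q : ℝ × Skeleton E => (q.1, (q.2 0).2)) (by fun_prop)
  unfold advance
  split_ifs <;> fun_prop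

@[fun_prop]
lemma measurable_after (p : ℝ) : Measurable (D.after p) := by
  refine measurable_comp_nat (f := fun n ω => D.advance (p - (ω.time n).toReal) (tail n ω))
    (fun n => ?_) (N := fun ω => ω.lastLE p) (measurable_lastLE.comp measurable_prodMk_right)
  exact D.measurable_advance.comp (f := fun ω => ((p - (ω.time n).toReal), tail n ω)) (by fun_prop)

/-- The first event separates the skeleton into its waiting time and an independent renewal from
the post-jump state. -/
lemma lintegral_pathLaw_renewal [MeasurableSingletonClass E] (z : E)
    {Φ : ℝ≥0∞ × Skeleton E → ℝ≥0∞} (hΦ : Measurable Φ) :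
    ∫⁻ ω, Φ ((ω 1).1, tail 1 ω) ∂(D.pathLaw z) =
      ∫⁻ w, ∫⁻ z', ∫⁻ ω, Φ (w, ω) ∂(D.pathLaw z') ∂(D.jump (D.flow w.toReal z))
        ∂(D.waitingKernel z) := by
  have hM : Measurable fun y : ℝ≥0∞ × E => ∫⁻ ω, Φ (y.1, ω) ∂(D.pathLaw y.2) :=
    Measurable.lintegral_kernel_prod_right' (κ := D.pathLaw.comap Prod.snd measurable_snd)
      (f := fun q : (ℝ≥0∞ × E) × Skeleton E => Φ (q.1.1, q.2)) (by fun_prop)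
  have h1 := D.lintegral_pathLaw_tail z 1 (F := fun q => Φ ((q.1 1).1, q.2)) (by fun_prop)
  have e : ∀ ω : Skeleton E, (upTo 1 ω) 1 = ω 1 := fun ω => by simp [upTo]
  simp only [e] at h1
  rw [h1, D.lintegral_pathLaw_succ z 0 (G := fun q => ∫⁻ ω', Φ (q.2.1, ω') ∂(D.pathLaw q.2.2))
    (hM.comp measurable_snd)]
  calc _ = ∫⁻ _ : Skeleton E, ∫⁻ y, ∫⁻ ω', Φ (y.1, ω') ∂(D.pathLaw y.2) ∂(D.step z)
        ∂(D.pathLaw z) := by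
        refine lintegral_congr_ae ?_
        filter_upwards [D.ae_pathLaw_zero z] with ω hω
        rw [hω]
    _ = _ := by rw [lintegral_const, measure_univ, mul_one, lintegral_step _ _ hM]

/-- The PDMP is memoryless before its first event: on the event that nothing happens before time
`r`, the skeleton seen from `r` is that of the PDMP started from `φ_r z`, up to the entries that
follow the last event. -/
lemma lintegral_pathLaw_advance [MeasurableSingletonClass E] (z : E) {r : ℝ} (hr : 0 ≤ r)
    {h : Skeleton E → ℝ≥0∞} (hh : Measurable h) :
    ∫⁻ ω, {ω : Skeleton E | ENNReal.ofReal r < (ω 1).1}.indicator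
        (fun ω => h (clean (D.advance r ω))) ω ∂(D.pathLaw z) =
      D.waitingKernel z (Set.Ioi (ENNReal.ofReal r)) *
        ∫⁻ ω, h (clean ω) ∂(D.pathLaw (D.flow r z)) := by
  have := D.markov_jump
  lift r to ℝ≥0 using hr
  rw [ENNReal.ofReal_coe_nnreal]
  set z' := D.flow r z with hz'
  -- the graft of an infinite waiting time has no further event, whatever the grafted path
  have htop : ∀ ω ω' : Skeleton E, clean (graft z' ∞ ω) = clean (graft z' ∞ ω') := by
    have ht : ∀ (ω : Skeleton E) n, (graft z' ∞ ω).time (n + 1) = ∞ := by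
      intro ω n
      refine top_unique (le_trans ?_ ((graft z' ∞ ω).time_mono (Nat.succ_le_succ (Nat.zero_le n))))
      rw [time_succ]
      simp [graft]
    intro ω ω'
    ext1 n
    cases n with
    | zero => simp [clean, graft]
    | succ n => simp only [clean, ht, if_true]; simp [graft]
  let Φ : ℝ≥0∞ × Skeleton E → ℝ≥0∞ := fun q => h (clean (graft z' q.1 q.2))
  have hΦ : Measurable Φ := by
    refine hh.comp (measurable_clean.comp ?_)
    exact measurable_graft.comp (f := fun q : ℝ≥0∞ × Skeleton E => (z', q.1, q.2)) (by fun_prop)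
  let m : ℝ≥0∞ → ℝ≥0∞ := fun w =>
    ∫⁻ z₁, ∫⁻ ω, Φ (w, ω) ∂(D.pathLaw z₁) ∂(D.jump (D.flow w.toReal z'))
  have hm : Measurable m := by
    have h1 : Measurable fun y : ℝ≥0∞ × E => ∫⁻ ω, Φ (y.1, ω) ∂(D.pathLaw y.2) :=
      Measurable.lintegral_kernel_prod_right' (κ := D.pathLaw.comap Prod.snd measurable_snd)
        (f := fun q : (ℝ≥0∞ × E) × Skeleton E => Φ (q.1.1, q.2)) (by fun_prop)
    exact Measurable.lintegral_kernel_prod_right' (κ := D.jump.comap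
      (fun w : ℝ≥0∞ => D.flow w.toReal z') (D.measurable_flow.comp
        (f := fun w : ℝ≥0∞ => (w.toReal, z')) (by fun_prop))) h1
  have hR : ∫⁻ ω, h (clean ω) ∂(D.pathLaw z') = ∫⁻ w, m w ∂(D.waitingKernel z') := by
    rw [← D.lintegral_pathLaw_renewal z' hΦ]
    refine lintegral_congr_ae ?_
    filter_upwards [D.ae_pathLaw_zero z'] with ω hω
    have : ω = graft z' (ω 1).1 (tail 1 ω) := by
      ext1 k
      rcases k with _ | _ | k
      · simp [graft, hω]
      · simp [graft, tail]
      · simp [graft, tail, add_comm]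
    simp only [Φ, ← this]
  have hS : MeasurableSet {q : ℝ≥0∞ × Skeleton E | (r : ℝ≥0∞) < q.1} :=
    measurableSet_lt measurable_const measurable_fst
  have hL := D.lintegral_pathLaw_renewal z (Φ := {q | (r : ℝ≥0∞) < q.1}.indicator
    fun q => Φ (q.1 - r, q.2)) (Measurable.indicator (hΦ.comp (by fun_prop)) hS)
  rw [hR, ← D.lintegral_waitingKernel_shift z r hm]
  calc _ = ∫⁻ ω, ({q | (r : ℝ≥0∞) < q.1}.indicator fun q => Φ (q.1 - r, q.2)) ((ω 1).1, tail 1 ω)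
        ∂(D.pathLaw z) := by
        refine lintegral_congr_ae ?_
        filter_upwards [D.ae_pathLaw_zero z] with ω hω
        have : D.advance r ω = graft z' ((ω 1).1 - r) (tail 1 ω) := by
          ext1 k
          rcases k with _ | _ | k
          · simp [graft, advance, hω, hz']
          · simp [graft, advance, tail]
          · simp [graft, advance, tail, add_comm]
        simp only [Φ, Set.indicator, Set.mem_ofPred_eq, this]
    _ = _ := hL
    _ = _ := by
        refine lintegral_congr fun w => ?_
        by_cases hw : (r : ℝ≥0∞) < w
        · rw [Set.indicator_of_mem (show w ∈ Set.Ioi (r : ℝ≥0∞) from hw)]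
          simp only [Set.indicator, Set.mem_ofPred_eq, hw, if_true, m]
          rcases eq_or_ne w ∞ with rfl | hwt
          · have hc : ∀ ω, Φ (∞, ω) = Φ (∞, fun _ => (0, z)) := by
              intro ω
              simp only [Φ]
              rw [htop]
            rw [ENNReal.top_sub_coe]
            simp only [hc, lintegral_const, measure_univ, mul_one]
          · rw [ENNReal.toReal_sub_of_le hw.le hwt, hz', ← D.flow_add]
            simp
        · rw [Set.indicator_of_notMem (show w ∉ Set.Ioi (r : ℝ≥0∞) from hw)]
          simp only [Set.indicator, Set.mem_ofPred_eq, hw, if_false, lintegral_const, zero_mul]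

/-- The path made of the initial state and the first `n` events of a skeleton. -/
def prefixPath (n : ℕ) (ω : Skeleton E) : FinPath E :=
  ((ω 0).2, ⟨n, fun i => ((ω.time (i + 1)).toReal, (ω (i + 1)).2)⟩)

@[fun_prop]
lemma measurable_prefixPath (n : ℕ) : Measurable (prefixPath n : Skeleton E → FinPath E) := by
  unfold prefixPath
  refine Measurable.prodMk (by fun_prop) ((measurable_sigmaMk n).comp ?_)
  fun_prop

@[fun_prop]
lemma measurable_restrictTo (p : ℝ) : Measurable (restrictTo p : Skeleton E → FinPath E) :=
  measurable_comp_nat (f := fun n ω => prefixPath n ω) (fun n => measurable_prefixPath n)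
    (N := fun ω : Skeleton E => ω.lastLE p) (measurable_lastLE.comp measurable_prodMk_right)

omit [MeasurableSpace E] in
lemma restrictTo_eq_prefixPath {p : ℝ} {ω : Skeleton E} {n : ℕ} (h : ω.lastLE p = n) :
    restrictTo p ω = prefixPath n ω := by
  subst h
  rfl

omit [MeasurableSpace E] in
lemma prefixPath_upTo (n : ℕ) (ω : Skeleton E) : prefixPath n (upTo n ω) = prefixPath n ω := by
  unfold prefixPath
  congr 3
  ext1 i
  have : (i : ℕ) + 1 ≤ n := i.2
  rw [time_upTo ω this]
  simp [upTo, this]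

@[fun_prop]
lemma measurable_stateAt : Measurable fun q : Skeleton E × ℝ => D.stateAt q.1 q.2 := by
  refine measurable_comp_nat (f := fun n (q : Skeleton E × ℝ) =>
    D.flow (q.2 - (q.1.time n).toReal) (q.1 n).2) (fun n => ?_)
    (N := fun q : Skeleton E × ℝ => q.1.lastLE q.2) measurable_lastLE
  have h1 : Measurable fun p : Skeleton E × ℝ => p.1.time n :=
    (measurable_time n).comp measurable_fst
  exact D.measurable_flow.comp (f := fun q : Skeleton E × ℝ =>
    ((q.2 - (q.1.time n).toReal), (q.1 n).2)) (by fun_prop)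

/-- The Markov property of the PDMP at a fixed time `p`: given the path on `[0, p]`, the future is
that of the PDMP started from the state at time `p`. -/
lemma lintegral_pathLaw_after [MeasurableSingletonClass E] (hD : D.NonExplosive) (z : E) {p : ℝ}
    (hp : 0 ≤ p) {F : FinPath E × Skeleton E → ℝ≥0∞} (hF : Measurable F) :
    ∫⁻ ω, F (restrictTo p ω, clean (D.after p ω)) ∂(D.pathLaw z) =
      ∫⁻ ω, ∫⁻ ω', F (restrictTo p ω, clean ω') ∂(D.pathLaw (D.stateAt ω p)) ∂(D.pathLaw z) := by
  -- `A n` is the event that the last event before time `p` is event `n`; on it, the Markov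
  -- property at event `n` is followed by the lack of memory during the remaining time `r`
  let A : ℕ → Set (Skeleton E) := fun n =>
    {ω | ω.time n ≤ ENNReal.ofReal p ∧ ENNReal.ofReal p < ω.time (n + 1)}
  have hA : ∀ n, MeasurableSet (A n) := fun n =>
    (measurableSet_le (measurable_time n) measurable_const).inter
      (measurableSet_lt measurable_const (measurable_time (n + 1)))
  have hsum : ∀ f : Skeleton E → ℝ≥0∞, Measurable f →
      ∫⁻ ω, f ω ∂(D.pathLaw z) = ∑' n, ∫⁻ ω, (A n).indicator f ω ∂(D.pathLaw z) := by
    intro f hf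
    rw [← lintegral_tsum fun n => (hf.indicator (hA n)).aemeasurable]
    refine lintegral_congr_ae ?_
    filter_upwards [D.ae_isRegular hD z] with ω hω
    obtain ⟨n, hn⟩ := exists_time_le_lt hω.tendsto (t := p) hω.fst_zero
    rw [tsum_eq_single n, Set.indicator_of_mem (show ω ∈ A n from hn)]
    intro m hm
    refine Set.indicator_of_notMem (fun h => hm ?_) _
    rw [← lastLE_eq h.1 h.2, lastLE_eq hn.1 hn.2]
  have hB : Measurable fun q : FinPath E × E => ∫⁻ ω', F (q.1, clean ω') ∂(D.pathLaw q.2) :=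
    Measurable.lintegral_kernel_prod_right' (κ := D.pathLaw.comap Prod.snd measurable_snd)
      (f := fun q : (FinPath E × E) × Skeleton E => F (q.1.1, clean q.2)) (by fun_prop)
  have hB2 : Measurable fun ω =>
      ∫⁻ ω', F (restrictTo p ω, clean ω') ∂(D.pathLaw (D.stateAt ω p)) :=
    hB.comp (f := fun ω => (restrictTo p ω, D.stateAt ω p))
      ((measurable_restrictTo p).prodMk (D.measurable_stateAt.comp measurable_prodMk_right))
  rw [hsum _ (by fun_prop), hsum _ hB2]
  refine tsum_congr fun n => ?_
  let r : Skeleton E → ℝ := fun ω => p - (ω.time n).toReal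
  have hr : Measurable r := by fun_prop
  have hrs : ∀ ω, r (upTo n ω) = r ω := fun ω => by simp only [r, time_upTo ω le_rfl]
  let B : Set (Skeleton E) := {ω | ω.time n ≤ ENNReal.ofReal p}
  have hBm : MeasurableSet B := measurableSet_le (measurable_time n) measurable_const
  have hBs : ∀ ω, upTo n ω ∈ B ↔ ω ∈ B := fun ω => by
    simp only [B, Set.mem_ofPred_eq, time_upTo ω le_rfl]
  -- the two conditions defining `A n`, in terms of the past and of the future of event `n`
  have hAB : ∀ ω, ω ∈ A n ↔ ω ∈ B ∧ ENNReal.ofReal (r ω) < (tail n ω 1).1 := by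
    intro ω
    refine and_congr_right fun h => ?_
    have h1 : ω.time n ≠ ∞ := ne_top_of_le_ne_top ENNReal.ofReal_ne_top h
    simp only [r]
    rw [ENNReal.ofReal_sub _ ENNReal.toReal_nonneg, ENNReal.ofReal_toReal h1, time_succ]
    have h2 : tail n ω 1 = ω (n + 1) := by simp [tail]
    rw [h2, ENNReal.sub_lt_iff_lt_right h1 h, add_comm]
  let S : Set (Skeleton E × Skeleton E) := {q | q.1 ∈ B ∧ ENNReal.ofReal (r q.1) < (q.2 1).1}
  have hS : MeasurableSet S :=
    (measurable_fst hBm).inter (measurableSet_lt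
      (f := fun q : Skeleton E × Skeleton E => ENNReal.ofReal (r q.1))
      (g := fun q : Skeleton E × Skeleton E => (q.2 1).1) (by fun_prop) (by fun_prop))
  have e1 : ∀ G : Skeleton E × Skeleton E → ℝ≥0∞, Measurable G → (A n).indicator (fun ω =>
      G (upTo n ω, tail n ω)) = fun ω => (S.indicator G) (upTo n ω, tail n ω) := by
    intro G hG
    ext1 ω
    have : (upTo n ω, tail n ω) ∈ S ↔ ω ∈ A n := by
      rw [hAB]
      simp only [S, Set.mem_ofPred_eq, hBs, hrs]
    simp only [Set.indicator, this]
  let G₁ : Skeleton E × Skeleton E → ℝ≥0∞ := fun q =>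
    F (prefixPath n q.1, clean (D.advance (r q.1) q.2))
  have hG₁ : Measurable G₁ := by
    refine hF.comp (Measurable.prodMk (by fun_prop) (measurable_clean.comp ?_))
    exact D.measurable_advance.comp (f := fun q : Skeleton E × Skeleton E => (r q.1, q.2))
      (by fun_prop)
  let G₂ : Skeleton E × Skeleton E → ℝ≥0∞ := fun q =>
    ∫⁻ ω', F (prefixPath n q.1, clean ω') ∂(D.pathLaw (D.flow (r q.1) (q.1 n).2))
  have hG₂ : Measurable G₂ := by
    refine hB.comp (f := fun q : Skeleton E × Skeleton E =>
      (prefixPath n q.1, D.flow (r q.1) (q.1 n).2)) (Measurable.prodMk (by fun_prop) ?_)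
    exact D.measurable_flow.comp (f := fun q : Skeleton E × Skeleton E => (r q.1, (q.1 n).2))
      (by fun_prop)
  have i1 : (A n).indicator (fun ω => F (restrictTo p ω, clean (D.after p ω))) =
      (A n).indicator fun ω => G₁ (upTo n ω, tail n ω) := by
    ext1 ω
    by_cases h : ω ∈ A n
    · rw [Set.indicator_of_mem h, Set.indicator_of_mem h]
      have hl := lastLE_eq h.1 h.2
      simp only [G₁, prefixPath_upTo, hrs]
      simp only [after, hl, r]
      rw [restrictTo_eq_prefixPath hl]
    · rw [Set.indicator_of_notMem h, Set.indicator_of_notMem h]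
  have i2 : (A n).indicator (fun ω =>
        ∫⁻ ω', F (restrictTo p ω, clean ω') ∂(D.pathLaw (D.stateAt ω p))) =
      (A n).indicator fun ω => G₂ (upTo n ω, tail n ω) := by
    ext1 ω
    by_cases h : ω ∈ A n
    · rw [Set.indicator_of_mem h, Set.indicator_of_mem h]
      have hl := lastLE_eq h.1 h.2
      have hst : (upTo n ω) n = ω n := by simp [upTo]
      simp only [G₂, prefixPath_upTo, hrs, hst]
      simp only [stateAt, hl, r]
      rw [restrictTo_eq_prefixPath hl]
    · rw [Set.indicator_of_notMem h, Set.indicator_of_notMem h]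
  rw [i1, i2, e1 _ hG₁, e1 _ hG₂, D.lintegral_pathLaw_tail z n (hG₁.indicator hS),
    D.lintegral_pathLaw_tail z n (hG₂.indicator hS)]
  refine lintegral_congr fun ω => ?_
  by_cases h : ω ∈ B
  · have hS' : ∀ G : Skeleton E × Skeleton E → ℝ≥0∞, ∀ ω',
        S.indicator G (upTo n ω, ω') = {ω' : Skeleton E | ENNReal.ofReal (r ω) < (ω' 1).1}.indicator
          (fun ω' => G (upTo n ω, ω')) ω' := by
      intro G ω'
      have : (upTo n ω, ω') ∈ S ↔ ω' ∈ {ω' : Skeleton E | ENNReal.ofReal (r ω) < (ω' 1).1} := by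
        simp only [S, Set.mem_ofPred_eq, hBs, hrs, h, true_and]
      simp only [Set.indicator, this]
    simp only [hS']
    have hst : (upTo n ω) n = ω n := by simp [upTo]
    have hr0 : 0 ≤ r ω := by
      have := ENNReal.toReal_mono ENNReal.ofReal_ne_top h
      rw [ENNReal.toReal_ofReal hp] at this
      exact sub_nonneg.2 this
    -- `h1` replaces the probability of waiting longer than `r ω` by that of the set of paths
    have h1 := D.lintegral_pathLaw_advance (ω n).2 hr0 (h := fun _ => 1) measurable_const
    rw [lintegral_const, measure_univ, mul_one, mul_one] at h1
    have hm1 : MeasurableSet {ω' : Skeleton E | ENNReal.ofReal (r ω) < (ω' 1).1} :=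
      measurableSet_lt measurable_const (by fun_prop)
    have := D.lintegral_pathLaw_advance (ω n).2 hr0 (h := fun ω' => F (prefixPath n ω, ω'))
      (by fun_prop)
    simp only [G₁, G₂, hrs, prefixPath_upTo, hst]
    rw [this, lintegral_indicator_const hm1, ← h1, mul_comm]
    congr 1
    exact lintegral_indicator_one hm1
  · have hS' : ∀ G : Skeleton E × Skeleton E → ℝ≥0∞, ∀ ω', S.indicator G (upTo n ω, ω') = 0 := by
      intro G ω'
      refine Set.indicator_of_notMem (fun h1 => h ?_) _
      exact (hBs ω).1 h1.1
    simp only [hS']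

end PDMP

/-! ### Reversal of finite paths -/

namespace PDMP

open Skeleton

section Nodes

variable {E : Type*}

/-- The nodes of a finite path, indexed by the natural numbers (with a default value beyond the
last event). -/
def node (w : FinPath E) (n : ℕ) : ℝ × E :=
  if h : n < w.2.1 + 1 then nodes w ⟨n, h⟩ else (0, w.1)

lemma node_zero (w : FinPath E) : node w 0 = (0, w.1) := by
  rw [node, dif_pos (Nat.succ_pos _)]
  rfl

lemma node_succ (w : FinPath E) {n : ℕ} (h : n < w.2.1) : node w (n + 1) = w.2.2 ⟨n, h⟩ := by
  rw [node, dif_pos (Nat.succ_lt_succ h)]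
  rfl

lemma nodes_eq_node (w : FinPath E) (i : Fin (w.2.1 + 1)) : nodes w i = node w i := by
  rw [node, dif_pos i.2]

/-- Finite paths are determined by their nodes; this avoids equalities between functions on
different types `Fin k`. -/
lemma finPath_ext {w w' : FinPath E} (hk : w.2.1 = w'.2.1)
    (h : ∀ n ≤ w.2.1, node w n = node w' n) : w = w' := by
  obtain ⟨z, k, x⟩ := w
  obtain ⟨z', k', x'⟩ := w'
  obtain rfl : k = k' := hk
  have h0 := h 0 (Nat.zero_le _)
  rw [node_zero, node_zero] at h0
  obtain rfl : z = z' := congrArg Prod.snd h0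
  congr 2
  ext1 i
  have h1 := h (i + 1) i.2
  rwa [node_succ _ i.2, node_succ _ i.2] at h1

end Nodes

variable {E : Type*} [MeasurableSpace E] (D : PDMP E)

lemma node_reversal_zero (T : ℝ) (w : FinPath E) :
    node (D.reversal T w) 0 = (0, D.flow (T - (node w w.2.1).1) (node w w.2.1).2) := by
  rw [node_zero, reversal, nodes_eq_node]
  rfl

lemma node_reversal_succ (T : ℝ) (w : FinPath E) {n : ℕ} (h : n < w.2.1) :
    node (D.reversal T w) (n + 1) = (T - (node w (w.2.1 - n)).1,
      D.flow ((node w (w.2.1 - n)).1 - (node w (w.2.1 - (n + 1))).1)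
        (node w (w.2.1 - (n + 1))).2) := by
  rw [node_succ (D.reversal T w) (n := n) h]
  simp only [reversal, nodes_eq_node]
  have h1 : ((Fin.rev (⟨n, h⟩ : Fin w.2.1)).succ : ℕ) = w.2.1 - n := by
    simp [Fin.val_rev]
    omega
  have h2 : ((Fin.rev (⟨n, h⟩ : Fin w.2.1)).castSucc : ℕ) = w.2.1 - (n + 1) := by
    simp [Fin.val_rev]
  rw [h1, h2]

lemma flow_neg_flow (t : ℝ) (z : E) : D.flow (-t) (D.flow t z) = z := by
  rw [← D.flow_add, neg_add_cancel, D.flow_zero]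

/-- Reversing a path twice, the second time with the reverse flow, gives it back. -/
lemma reversal_reversal {Dr : PDMP E} (hflow : ∀ t z, Dr.flow t z = D.flow (-t) z) (T : ℝ)
    (w : FinPath E) : Dr.reversal T (D.reversal T w) = w := by
  refine finPath_ext rfl fun n hn => ?_
  have hk : (D.reversal T w).2.1 = w.2.1 := rfl
  have hn : n ≤ w.2.1 := hn
  have key : ∀ a b c d z, b - a = d - c → D.flow (-(a - b)) (D.flow (c - d) z) = z := by
    intro a b c d z h
    rw [show -(a - b) = -(c - d) by linarith, flow_neg_flow]
  cases n with
  | zero =>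
    rw [node_reversal_zero, hk, hflow, node_zero]
    refine Prod.ext rfl ?_
    rcases Nat.eq_zero_or_pos w.2.1 with h0 | h0
    · rw [h0, node_reversal_zero, h0, node_zero]
      exact key _ _ _ _ _ (by ring)
    · obtain ⟨k, hk'⟩ := Nat.exists_eq_succ_of_ne_zero h0.ne'
      rw [hk', Nat.succ_eq_add_one, node_reversal_succ _ _ _ (by omega), hk']
      simp only [Nat.succ_eq_add_one, Nat.sub_self, node_zero, Nat.add_sub_cancel_left]
      exact key _ _ _ _ _ (by ring)
  | succ n =>
    rw [node_reversal_succ _ _ _ (by rw [hk]; omega), hk, hflow]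
    obtain ⟨m, hm⟩ : ∃ m, w.2.1 = n + 1 + m := Nat.exists_eq_add_of_le hn
    have e1 : w.2.1 - n = m + 1 := by omega
    have e2 : w.2.1 - (n + 1) = m := by omega
    rw [e1, e2, node_reversal_succ _ _ _ (by omega)]
    have e3 : w.2.1 - m = n + 1 := by omega
    rw [e3]
    refine Prod.ext (by simp) ?_
    cases m with
    | zero =>
      rw [node_reversal_zero, show w.2.1 = n + 1 by omega]
      exact key _ _ _ _ _ (by simp)
    | succ m =>
      rw [node_reversal_succ _ _ _ (by omega), show w.2.1 - m = n + 2 by omega,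
        show w.2.1 - (m + 1) = n + 1 by omega]
      exact key _ _ _ _ _ (by simp)

lemma measurable_nodes_apply (k : ℕ) (i : Fin (k + 1)) :
    Measurable fun q : E × (Fin k → ℝ × E) => nodes (q.1, ⟨k, q.2⟩) i := by
  refine Fin.cases ?_ (fun j => ?_) i
  · simp only [nodes, Fin.cons_zero]
    fun_prop
  · simp only [nodes, Fin.cons_succ]
    fun_prop

@[fun_prop]
lemma measurable_reversal (T : ℝ) : Measurable (D.reversal T) := by
  refine measurable_of_finPath fun k => ?_
  have hn := measurable_nodes_apply (E := E) k
  refine Measurable.prodMk ?_ ((measurable_sigmaMk k).comp (measurable_pi_lambda _ fun i => ?_))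
  · have h := hn (Fin.last k)
    exact D.measurable_flow.comp (f := fun q : E × (Fin k → ℝ × E) =>
      (T - (nodes (q.1, ⟨k, q.2⟩) (Fin.last k)).1, (nodes (q.1, ⟨k, q.2⟩) (Fin.last k)).2))
      (by fun_prop)
  · have h1 := hn i.rev.succ
    have h2 := hn i.rev.castSucc
    refine Measurable.prodMk (measurable_const.sub h1.fst) ?_
    exact D.measurable_flow.comp (f := fun q : E × (Fin k → ℝ × E) =>
      ((nodes (q.1, ⟨k, q.2⟩) i.rev.succ).1 - (nodes (q.1, ⟨k, q.2⟩) i.rev.castSucc).1,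
        (nodes (q.1, ⟨k, q.2⟩) i.rev.castSucc).2)) (by fun_prop)

/-- Time reversal is a symmetric relation. -/
lemma IsTimeReversal.symm {D Dr : PDMP E} {π : Measure E} (h : D.IsTimeReversal Dr π) :
    Dr.IsTimeReversal D π := by
  refine ⟨fun t z => by rw [h.1, neg_neg], fun T hT => ?_⟩
  have h1 := congrArg (fun μ => μ.map (Dr.reversal T)) (h.2 T hT)
  beta_reduce at h1
  have hm : Measurable fun ω => D.reversal T (restrictTo T ω) := by fun_prop
  rw [Measure.map_map (by fun_prop) (by fun_prop), Measure.map_map (by fun_prop) hm] at h1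
  have h2 : (Dr.reversal T ∘ fun ω => D.reversal T (restrictTo T ω)) = restrictTo T := by
    ext1 ω
    exact D.reversal_reversal h.1 T _
  rw [h2] at h1
  exact h1.symm

omit [MeasurableSpace E] in
lemma node_restrictTo {p : ℝ} {ω : Skeleton E} (h0 : (ω 0).1 = 0) {n : ℕ}
    (hn : n ≤ ω.lastLE p) : node (restrictTo p ω) n = ((ω.time n).toReal, (ω n).2) := by
  cases n with
  | zero => rw [node_zero, time_zero, h0]; rfl
  | succ n => rw [node_succ (restrictTo p ω) (n := n) hn]; rfl

lemma reversal_restrictTo_fst {p : ℝ} {ω : Skeleton E} (h0 : (ω 0).1 = 0) :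
    (D.reversal p (restrictTo p ω)).1 = D.stateAt ω p := by
  have h := D.node_reversal_zero p (restrictTo p ω)
  rw [node_zero, show (restrictTo p ω).2.1 = ω.lastLE p from rfl,
    node_restrictTo h0 (le_refl (ω.lastLE p))] at h
  exact congrArg Prod.snd h

/-- The past up to time `-p` and the future of the stationary full path are distributed as the
reversed past and the future, seen from time `p`, of the PDMP started from equilibrium. -/
lemma lintegral_fullPath_eq [MeasurableSingletonClass E] {Dr : PDMP E} {π : Measure E}
    (hD : D.NonExplosive) (hrev : D.IsTimeReversal Dr π) {p : ℝ} (hp : 0 < p)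
    {F : FinPath E × Skeleton E → ℝ≥0∞} (hF : Measurable F) :
    ∫⁻ ω, F (restrictTo p ω.2, clean ω.1) ∂(π.bind (NUTS.fullPathLaw D Dr)) =
      ∫⁻ ω, F (D.reversal p (restrictTo p ω), clean (D.after p ω)) ∂(π.bind D.pathLaw) := by
  -- both sides are the mean of `G` at the past, which the time-reversal identifies; on the right,
  -- this is the Markov property at time `p`, as the reversed past starts from the state at time
  -- `p`
  let G : FinPath E → ℝ≥0∞ := fun w => ∫⁻ ω, F (w, clean ω) ∂(D.pathLaw w.1)
  have hG : Measurable G :=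
    Measurable.lintegral_kernel_prod_right' (κ := D.pathLaw.comap Prod.fst measurable_fst)
      (f := fun q : FinPath E × Skeleton E => F (q.1, clean q.2)) (by fun_prop)
  have hGr : Measurable fun ω => G (restrictTo p ω) := by fun_prop
  have hGd : Measurable fun ω => G (D.reversal p (restrictTo p ω)) := by fun_prop
  have h1 : ∫⁻ ω, F (restrictTo p ω.2, clean ω.1) ∂(π.bind (NUTS.fullPathLaw D Dr)) =
      ∫⁻ ω, G (restrictTo p ω) ∂(π.bind Dr.pathLaw) := by
    have hm : Measurable fun ω : FullPath E => F (restrictTo p ω.2, clean ω.1) := by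
      refine hF.comp (Measurable.prodMk ?_ ?_)
      · exact (measurable_restrictTo p).comp measurable_snd
      · exact measurable_clean.comp measurable_fst
    rw [Measure.lintegral_bind (Kernel.aemeasurable _) hm.aemeasurable,
      Measure.lintegral_bind (Kernel.aemeasurable _) hGr.aemeasurable]
    refine lintegral_congr fun z => ?_
    rw [NUTS.fullPathLaw, Kernel.prod_apply, lintegral_prod_symm _ hm.aemeasurable]
    refine lintegral_congr_ae ?_
    filter_upwards [Dr.ae_pathLaw_zero z] with ω hω
    simp only [G]
    have : (restrictTo p ω).1 = z := by rw [restrictTo, hω]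
    rw [this]
  have h2 : ∫⁻ ω, G (restrictTo p ω) ∂(π.bind Dr.pathLaw) =
      ∫⁻ ω, G (D.reversal p (restrictTo p ω)) ∂(π.bind D.pathLaw) := by
    rw [← lintegral_map hG (by fun_prop), hrev.2 p hp, lintegral_map hG (by fun_prop)]
  have hm3 : Measurable fun ω => F (D.reversal p (restrictTo p ω), clean (D.after p ω)) := by
    fun_prop
  rw [h1, h2, Measure.lintegral_bind (Kernel.aemeasurable _) hGd.aemeasurable,
    Measure.lintegral_bind (Kernel.aemeasurable _) hm3.aemeasurable]
  refine lintegral_congr fun z => ?_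
  rw [D.lintegral_pathLaw_after hD z hp.le (F := fun q => F (D.reversal p q.1, q.2))
    (by fun_prop)]
  refine lintegral_congr_ae ?_
  filter_upwards [D.ae_pathLaw_zero z] with ω hω
  simp only [G]
  rw [D.reversal_restrictTo_fst (by rw [hω])]

end PDMP

/-! ### Regular skeletons and agreement of full paths -/

namespace Skeleton

variable {E : Type*}

lemma time_clean (ω : Skeleton E) (n : ℕ) : (clean ω).time n = ω.time n := by
  induction n with
  | zero =>
    rw [time_zero, time_zero, clean, time_zero]
    split_ifs with h
    · exact h.symm
    · rfl
  | succ n ih =>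
    rw [time_succ, ih]
    simp only [clean]
    split_ifs with h
    · rw [h]; simp
    · rw [time_succ]

lemma time_clean' (ω : Skeleton E) : (clean ω).time = ω.time := funext ω.time_clean

lemma lastLE_clean (ω : Skeleton E) (t : ℝ) : (clean ω).lastLE t = ω.lastLE t := by
  simp only [lastLE, time_clean']

lemma lastLT_clean (ω : Skeleton E) (t : ℝ) : (clean ω).lastLT t = ω.lastLT t := by
  simp only [lastLT, time_clean']

lemma clean_apply {ω : Skeleton E} {n : ℕ} (h : ω.time n ≠ ∞) : clean ω n = ω n := if_neg h

lemma time_lastLE_ne_top {ω : Skeleton E} (h0 : (ω 0).1 = 0) (t : ℝ) :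
    ω.time (ω.lastLE t) ≠ ∞ := by
  rcases h : ω.lastLE t with _ | n
  · simp [h0]
  · exact ne_top_of_le_ne_top ENNReal.ofReal_ne_top ((ω.lastLE_eq_succ_iff t n).1 h).1

lemma time_lastLT_ne_top {ω : Skeleton E} (h0 : (ω 0).1 = 0) (t : ℝ) :
    ω.time (ω.lastLT t) ≠ ∞ := by
  rcases h : ω.lastLT t with _ | n
  · simp [h0]
  · exact (((ω.lastLT_eq_succ_iff t n).1 h).1.trans ENNReal.ofReal_lt_top).ne

lemma IsRegular.clean {ω : Skeleton E} (h : ω.IsRegular) : ω.clean.IsRegular := by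
  refine ⟨?_, fun n hn => ?_, ?_⟩
  · rw [clean_apply (by simp [h.fst_zero]), h.fst_zero]
  · simp only [Skeleton.clean]
    split_ifs
    · simp
    · exact h.pos n hn
  · rw [time_clean']; exact h.tendsto

lemma IsRegular.time_pos {ω : Skeleton E} (h : ω.IsRegular) {n : ℕ} (hn : 0 < n) :
    0 < ω.time n := by
  obtain ⟨m, rfl⟩ := Nat.exists_eq_succ_of_ne_zero hn.ne'
  rw [Nat.succ_eq_add_one, time_succ]
  exact lt_of_lt_of_le (h.pos _ (Nat.succ_pos m)) le_add_self

lemma IsRegular.time_lt {ω : Skeleton E} (h : ω.IsRegular) {n : ℕ} (hn : ω.time n ≠ ∞) :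
    ω.time n < ω.time (n + 1) := by
  rw [time_succ]
  exact ENNReal.lt_add_right hn (h.pos _ (Nat.succ_pos n)).ne'

/-- The skeleton without any event. -/
def still (z : E) : Skeleton E := fun n => if n = 0 then (0, z) else (∞, z)

lemma time_still_succ (z : E) (n : ℕ) : (still z).time (n + 1) = ∞ := by
  rw [time_succ]; simp [still]

lemma tendsto_top_of_eventually_eq {f : ℕ → ℝ≥0∞} {N : ℕ} (h : ∀ n, N < n → f n = ∞) :
    Tendsto f atTop (𝓝 ∞) :=
  tendsto_const_nhds.congr' ((eventually_gt_atTop N).mono fun n hn => (h n hn).symm)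

lemma isRegular_still (z : E) : (still z).IsRegular := by
  refine ⟨by simp [still], fun n hn => by simp [still, hn.ne'], ?_⟩
  refine tendsto_top_of_eventually_eq (N := 0) fun n hn => ?_
  obtain ⟨m, rfl⟩ := Nat.exists_eq_succ_of_ne_zero hn.ne'
  exact time_still_succ z m

open PDMP

/-- The skeleton of a finite path, without further events. Its waiting times are the differences of
the event times. -/
def pad (w : FinPath E) : Skeleton E := fun n =>
  if n = 0 then (0, w.1)
  else if n ≤ w.2.1 then
    (ENNReal.ofReal ((node w n).1 - (node w (n - 1)).1), (node w n).2)
  else (∞, w.1)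

lemma pad_snd {w : FinPath E} {n : ℕ} (hn : n ≤ w.2.1) : (pad w n).2 = (node w n).2 := by
  rcases Nat.eq_zero_or_pos n with rfl | h
  · rw [node_zero]; rfl
  · simp [pad, h.ne', hn]

lemma time_pad_of_lt {w : FinPath E} {n : ℕ} (hn : w.2.1 < n) : (pad w).time n = ∞ := by
  obtain ⟨m, rfl⟩ := Nat.exists_eq_succ_of_ne_zero (Nat.ne_zero_of_lt hn)
  rw [Nat.succ_eq_add_one, time_succ]
  have : ¬ m + 1 ≤ w.2.1 := by omega
  simp [pad, this]

lemma time_pad {w : FinPath E} (hw : ∀ n < w.2.1, (node w n).1 < (node w (n + 1)).1) {n : ℕ}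
    (hn : n ≤ w.2.1) : (pad w).time n = ENNReal.ofReal (node w n).1 := by
  suffices h : 0 ≤ (node w n).1 ∧ (pad w).time n = ENNReal.ofReal (node w n).1 from h.2
  induction n with
  | zero => simp [node_zero, pad]
  | succ n ih =>
    obtain ⟨h1, h2⟩ := ih (by omega)
    have h3 := hw n hn
    refine ⟨h1.trans h3.le, ?_⟩
    rw [time_succ, h2]
    simp only [pad, Nat.succ_ne_zero, if_false, hn, if_true, Nat.add_sub_cancel]
    rw [← ENNReal.ofReal_add h1 (sub_nonneg.2 h3.le), add_sub_cancel]

lemma isRegular_pad {w : FinPath E} (hw : ∀ n < w.2.1, (node w n).1 < (node w (n + 1)).1) :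
    (pad w).IsRegular := by
  refine ⟨by simp [pad], fun n hn => ?_, tendsto_top_of_eventually_eq fun n => time_pad_of_lt⟩
  obtain ⟨m, rfl⟩ := Nat.exists_eq_succ_of_ne_zero hn.ne'
  by_cases h : m + 1 ≤ w.2.1
  · simpa [pad, h] using hw m h
  · simp [pad, h]

variable [MeasurableSpace E]

@[fun_prop]
lemma measurable_still : Measurable (still : E → Skeleton E) := by
  refine measurable_pi_lambda _ fun n => ?_
  unfold still
  split_ifs <;> fun_prop

@[fun_prop]
lemma measurable_pad : Measurable (pad : FinPath E → Skeleton E) := by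
  refine measurable_of_finPath fun k => measurable_pi_lambda _ fun n => ?_
  have hn : ∀ n, Measurable fun q : E × (Fin k → ℝ × E) => node (q.1, ⟨k, q.2⟩) n := by
    intro n
    simp only [node]
    split_ifs with h
    · exact measurable_nodes_apply k ⟨n, h⟩
    · fun_prop
  have h1 := hn n
  have h2 := hn (n - 1)
  simp only [pad]
  split_ifs <;> fun_prop

end Skeleton

namespace FullPath

open Skeleton

variable {E : Type*}

lemma isProper_iff {ω : FullPath E} :
    ω.IsProper ↔ ω.1 0 = ω.2 0 ∧ ω.1.IsRegular ∧ ω.2.IsRegular := by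
  constructor
  · rintro ⟨h1, h2, h3, h4, h5⟩
    exact ⟨h1, ⟨h2, fun n hn => (h3 n hn).1, h4⟩, ⟨h1 ▸ h2, fun n hn => (h3 n hn).2, h5⟩⟩
  · rintro ⟨h1, h2, h3⟩
    exact ⟨h1, h2.fst_zero, fun n hn => ⟨h2.pos n hn, h3.pos n hn⟩, h2.tendsto, h3.tendsto⟩

lemma mem_events_of_pos {ω : FullPath E} {t : ℝ} (ht : 0 < t) :
    t ∈ ω.events ↔ ∃ n, 0 < n ∧ ω.1.time n = ENNReal.ofReal t := by
  simp [events, ht, ht.not_gt]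

lemma mem_events_of_neg {ω : FullPath E} {t : ℝ} (ht : t < 0) :
    t ∈ ω.events ↔ ∃ n, 0 < n ∧ ω.2.time n = ENNReal.ofReal (-t) := by
  simp [events, ht, ht.not_gt]

lemma zero_notMem_events (ω : FullPath E) : (0 : ℝ) ∉ ω.events := by
  simp [events]

lemma events_clean (ω : FullPath E) : events (ω.1.clean, ω.2) = ω.events := by
  simp only [events, time_clean]

variable [MeasurableSpace E]

lemma state_clean (D : PDMP E) {ω : FullPath E} (h : ω.IsProper) (t : ℝ) :
    state D (ω.1.clean, ω.2) t = state D ω t := by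
  have h1 := time_lastLE_ne_top (isProper_iff.1 h).2.1.fst_zero t
  simp only [state, PDMP.stateAt, lastLE_clean, time_clean, clean_apply h1]

lemma stateLeft_clean (D : PDMP E) {ω : FullPath E} (h : ω.IsProper) (t : ℝ) :
    stateLeft D (ω.1.clean, ω.2) t = stateLeft D ω t := by
  have h1 := time_lastLT_ne_top (isProper_iff.1 h).2.1.fst_zero t
  simp only [stateLeft, PDMP.stateBefore, lastLT_clean, time_clean, clean_apply h1]

omit [MeasurableSpace E] in
lemma IsProper.clean {ω : FullPath E} (h : ω.IsProper) :
    IsProper ((ω.1.clean, ω.2) : FullPath E) := by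
  obtain ⟨h1, h2, h3⟩ := isProper_iff.1 h
  refine isProper_iff.2 ⟨?_, h2.clean, h3⟩
  rw [← h1]
  exact clean_apply (by simp [h2.fst_zero])

/-- From time `-p` on, the path `ω` coincides with the path `ω'` shifted by `c`, and `-p` is not an
event. -/
structure AgreeAfter (D : PDMP E) (p c : ℝ) (ω ω' : FullPath E) : Prop where
  events_iff : ∀ t, -p < t → (t ∈ ω.events ↔ t + c ∈ ω'.events)
  state_eq : ∀ t, -p < t → state D ω t = state D ω' (t + c)
  stateLeft_eq : ∀ t, -p < t → stateLeft D ω t = stateLeft D ω' (t + c)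
  left_notMem : -p ∉ ω.events
  left_notMem' : -p + c ∉ ω'.events

/-- An event-based criterion does not distinguish paths that agree. -/
lemma AgreeAfter.criterion_iff {D : PDMP E} {p c : ℝ} {ω ω' : FullPath E}
    (h : AgreeAfter D p c ω ω') (hω : ω.IsProper) (hω' : ω'.IsProper) {C : Criterion E}
    (hC : C.DependsOnlyOnEvents D) {a b : ℝ} (ha : -p ≤ a) (hab : a ≤ b) :
    C ω a b ↔ C ω' (a + c) (b + c) := by
  have key : ∀ t, -p ≤ t → (t ∈ ω.events ↔ t + c ∈ ω'.events) := by
    intro t ht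
    rcases ht.eq_or_lt with rfl | ht
    · simp [h.left_notMem, h.left_notMem']
    · exact h.events_iff t ht
  refine hC ω ω' hω hω' a b (a + c) (b + c) hab (by linarith) ⟨c, fun t => ?_, ?_,
    key a ha, key b (ha.trans hab)⟩
  · constructor
    · rintro ⟨h1, h2, h3⟩
      exact ⟨(key t (ha.trans h2)).1 h1, by linarith, by linarith⟩
    · rintro ⟨h1, h2, h3⟩
      have h2 : a ≤ t := by linarith
      exact ⟨(key t (ha.trans h2)).2 h1, h2, by linarith⟩
  · rintro t ⟨h1, h2, h3⟩
    have ht : -p < t := lt_of_le_of_ne (ha.trans h2) fun h4 => h.left_notMem (h4 ▸ h1)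
    exact ⟨h.stateLeft_eq t ht, h.state_eq t ht⟩

end FullPath

/-! ### Full paths seen from another time -/

namespace FullPath

open Skeleton PDMP

variable {E : Type*} [MeasurableSpace E] (D : PDMP E)

section Truncation

variable {ω : Skeleton E} {p : ℝ}

omit [MeasurableSpace E] in
lemma time_pad_restrictTo (h : ω.IsRegular) {n : ℕ} (hn : n ≤ ω.lastLE p) :
    (pad (restrictTo p ω)).time n = ω.time n := by
  have hfin : ∀ m ≤ ω.lastLE p, ω.time m ≠ ∞ := fun m hm =>
    ne_top_of_le_ne_top (time_lastLE_ne_top h.fst_zero p) (ω.time_mono hm)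
  rw [time_pad (w := restrictTo p ω) (fun m hm => ?_) hn, node_restrictTo h.fst_zero hn,
    ENNReal.ofReal_toReal (hfin n hn)]
  have hm : m < ω.lastLE p := hm
  rw [node_restrictTo h.fst_zero hm.le, node_restrictTo h.fst_zero (Nat.succ_le_of_lt hm)]
  exact (ENNReal.toReal_lt_toReal (hfin m hm.le) (hfin (m + 1) hm)).2 (h.time_lt (hfin m hm.le))

omit [MeasurableSpace E] in
lemma isRegular_pad_restrictTo (h : ω.IsRegular) : (pad (restrictTo p ω)).IsRegular := by
  have hfin : ∀ m ≤ ω.lastLE p, ω.time m ≠ ∞ := fun m hm =>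
    ne_top_of_le_ne_top (time_lastLE_ne_top h.fst_zero p) (ω.time_mono hm)
  refine isRegular_pad fun m hm => ?_
  have hm : m < ω.lastLE p := hm
  rw [node_restrictTo h.fst_zero hm.le, node_restrictTo h.fst_zero (Nat.succ_le_of_lt hm)]
  exact (ENNReal.toReal_lt_toReal (hfin m hm.le) (hfin (m + 1) hm)).2 (h.time_lt (hfin m hm.le))

omit [MeasurableSpace E] in
lemma time_pad_restrictTo_of_lt {n : ℕ} (hn : ω.lastLE p < n) :
    (pad (restrictTo p ω)).time n = ∞ :=
  time_pad_of_lt (w := restrictTo p ω) hn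

omit [MeasurableSpace E] in
lemma pad_restrictTo_snd (h : ω.IsRegular) {n : ℕ} (hn : n ≤ ω.lastLE p) :
    (pad (restrictTo p ω) n).2 = (ω n).2 := by
  rw [pad_snd (w := restrictTo p ω) hn, node_restrictTo h.fst_zero hn]

end Truncation

/-- The backward events before time `-p` do not matter for the path after time `-p`. -/
lemma agreeAfter_truncate {ω : FullPath E} (h : ω.IsProper) {p : ℝ} (hp : 0 < p)
    (hpn : ∀ n, ω.2.time n ≠ ENNReal.ofReal p) :
    AgreeAfter D p 0 ω (ω.1, pad (restrictTo p ω.2)) := by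
  obtain ⟨-, -, hr⟩ := isProper_iff.1 h
  obtain ⟨N, hN1, hN2⟩ := exists_time_le_lt hr.tendsto (t := p) hr.fst_zero
  have hl := lastLE_eq hN1 hN2
  have hN1 := lt_of_le_of_ne hN1 (hpn N)
  have ht : ∀ n ≤ N, (pad (restrictTo p ω.2)).time n = ω.2.time n := fun n hn =>
    time_pad_restrictTo hr (hl.symm ▸ hn)
  have ht' : ∀ n, N < n → (pad (restrictTo p ω.2)).time n = ∞ := fun n hn =>
    time_pad_restrictTo_of_lt (hl.symm ▸ hn)
  have hs : ∀ n ≤ N, (pad (restrictTo p ω.2) n).2 = (ω.2 n).2 := fun n hn =>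
    pad_restrictTo_snd hr (hl.symm ▸ hn)
  have hlt : ∀ t : ℝ, -p < t → ENNReal.ofReal (-t) < ENNReal.ofReal p := fun t ht =>
    (ENNReal.ofReal_lt_ofReal_iff hp).2 (by linarith)
  have hleN : ∀ t : ℝ, -p < t → ∀ n, ω.2.time n ≤ ENNReal.ofReal (-t) → n ≤ N := by
    intro t h1 n h2
    by_contra! h3
    exact absurd (((ω.2.time_mono (Nat.succ_le_of_lt h3)).trans h2).trans (hlt t h1).le)
      (not_le.2 hN2)
  refine ⟨fun t htp => ?_, fun t htp => ?_, fun t htp => ?_, ?_, ?_⟩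
  · rw [add_zero]
    rcases lt_trichotomy t 0 with h0 | rfl | h0
    · rw [mem_events_of_neg h0, mem_events_of_neg h0]
      refine exists_congr fun n => and_congr_right fun _ => ?_
      rcases le_or_gt n N with hn | hn
      · simp only [ht n hn]
      · simp only [ht' n hn]
        refine iff_of_false (fun h1 => ?_) (fun h1 => ENNReal.ofReal_ne_top h1.symm)
        exact absurd (hleN t htp n h1.le) (not_le.2 hn)
    · simp [zero_notMem_events]
    · rw [mem_events_of_pos h0, mem_events_of_pos h0]
  · rw [add_zero]
    rcases le_or_gt 0 t with h0 | h0
    · simp [state, h0]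
    · obtain ⟨n, hn1, hn2⟩ := exists_time_lt_le hr.tendsto hr.fst_zero (neg_pos.2 h0)
      have hnN := hleN t htp n hn1.le
      have hn2' : ENNReal.ofReal (-t) ≤ (pad (restrictTo p ω.2)).time (n + 1) := by
        rcases hnN.lt_or_eq with h1 | rfl
        · rwa [ht _ h1]
        · rw [ht' _ (Nat.lt_succ_self n)]; exact le_top
      simp only [state, h0.not_ge, if_false]
      rw [lastLT_eq hn1 hn2, lastLT_eq (by rwa [ht n hnN]) hn2', ht n hnN, hs n hnN]
  · rw [add_zero]
    rcases lt_or_ge 0 t with h0 | h0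
    · simp [stateLeft, h0]
    · obtain ⟨n, hn1, hn2⟩ := exists_time_le_lt hr.tendsto hr.fst_zero (t := -t)
      have hnN := hleN t htp n hn1
      have hn2' : ENNReal.ofReal (-t) < (pad (restrictTo p ω.2)).time (n + 1) := by
        rcases hnN.lt_or_eq with h1 | rfl
        · rwa [ht _ h1]
        · rw [ht' _ (Nat.lt_succ_self n)]; exact ENNReal.ofReal_lt_top
      simp only [stateLeft, h0.not_gt, if_false]
      rw [lastLE_eq hn1 hn2, lastLE_eq (by rwa [ht n hnN]) hn2', ht n hnN, hs n hnN]
  · rw [mem_events_of_neg (by linarith), neg_neg]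
    rintro ⟨n, -, hn⟩
    exact hpn n hn
  · rw [add_zero, mem_events_of_neg (by linarith), neg_neg]
    rintro ⟨n, -, hn⟩
    rcases le_or_gt n N with h1 | h1
    · exact hpn n ((ht n h1).symm.trans hn)
    · rw [ht' n h1] at hn
      exact ENNReal.ofReal_ne_top hn.symm

omit [MeasurableSpace E] in
lemma isProper_truncate {ω : FullPath E} (h : ω.IsProper) (p : ℝ) :
    IsProper ((ω.1, pad (restrictTo p ω.2)) : FullPath E) := by
  obtain ⟨h1, h2, h3⟩ := isProper_iff.1 h
  refine isProper_iff.2 ⟨?_, h2, isRegular_pad_restrictTo h3⟩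
  refine Prod.ext ?_ ?_
  · rw [h2.fst_zero]; simp [pad]
  · rw [h1]; simp [pad, restrictTo]

end FullPath

namespace PDMP

open Skeleton

variable {E : Type*} [MeasurableSpace E] (D : PDMP E)

variable {ω : Skeleton E} {p : ℝ}

/-- The events of the skeleton seen from time `p` are those of `ω` after `p`, shifted by `p`. -/
lemma time_after (h : ω.IsRegular) (k : ℕ) (hk : 0 < k) :
    (D.after p ω).time k = ω.time (ω.lastLE p + k) - ENNReal.ofReal p := by
  obtain ⟨N, hN1, hN2⟩ := exists_time_le_lt h.tendsto (t := p) h.fst_zero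
  have hl := lastLE_eq hN1 hN2
  have hfin : ω.time N ≠ ∞ := ne_top_of_le_ne_top ENNReal.ofReal_ne_top hN1
  have hr : ENNReal.ofReal (p - (ω.time N).toReal) = ENNReal.ofReal p - ω.time N := by
    rw [ENNReal.ofReal_sub _ ENNReal.toReal_nonneg, ENNReal.ofReal_toReal hfin]
  rw [hl]
  induction k with
  | zero => exact absurd hk (lt_irrefl 0)
  | succ k ih =>
    rw [time_succ]
    rcases Nat.eq_zero_or_pos k with rfl | hk
    · simp only [time_zero, after, advance, hl, tail, zero_add, if_true, one_ne_zero, if_false, hr]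
      rw [time_succ]
      have : ENNReal.ofReal p = ω.time N + (ENNReal.ofReal p - ω.time N) :=
        (add_tsub_cancel_of_le hN1).symm
      conv_rhs => rw [this]
      rw [ENNReal.add_sub_add_eq_sub_left hfin]
    · rw [ih hk]
      have h1 : (D.after p ω (k + 1)).1 = (ω (N + k + 1)).1 := by
        simp [after, advance, hl, tail, hk.ne', add_assoc]
      have h2 : ENNReal.ofReal p ≤ ω.time (N + k) :=
        hN2.le.trans (ω.time_mono (by omega))
      rw [h1, ← add_assoc, time_succ, ENNReal.sub_add_eq_add_sub h2 ENNReal.ofReal_ne_top]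

lemma after_snd {k : ℕ} (hk : 0 < k) : (D.after p ω k).2 = (ω (ω.lastLE p + k)).2 := by
  rcases k with _ | _ | k
  · exact absurd hk (lt_irrefl 0)
  · simp [after, advance, tail]
  · simp [after, advance, tail]

lemma after_zero : D.after p ω 0 = (0, D.stateAt ω p) := by
  simp [after, advance, tail, stateAt]

lemma isRegular_after (h : ω.IsRegular) : (D.after p ω).IsRegular := by
  obtain ⟨N, hN1, hN2⟩ := exists_time_le_lt h.tendsto (t := p) h.fst_zero
  have hl := lastLE_eq hN1 hN2
  refine ⟨by rw [after_zero], fun n hn => ?_, ?_⟩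
  · rcases eq_or_ne n 1 with rfl | h1
    · have := D.time_after (p := p) h 1 one_pos
      rw [time_succ, time_zero, after_zero, zero_add, hl] at this
      rw [this]
      exact tsub_pos_of_lt hN2
    · simp only [after, advance, tail, hn.ne', h1, if_false]
      exact h.pos _ (by omega)
  · have h1 : Tendsto (fun k => ω.time (ω.lastLE p + k) - ENNReal.ofReal p) atTop (𝓝 ∞) := by
      have h2 : Tendsto (fun k => ω.time (ω.lastLE p + k)) atTop (𝓝 ∞) := by
        simp_rw [add_comm (ω.lastLE p)]
        exact h.tendsto.comp (tendsto_add_atTop_nat _)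
      have := ENNReal.Tendsto.sub h2 (tendsto_const_nhds (x := ENNReal.ofReal p))
        (Or.inr ENNReal.ofReal_ne_top)
      simpa using this
    refine h1.congr' ?_
    filter_upwards [eventually_gt_atTop 0] with k hk
    rw [D.time_after h k hk]

lemma node_backward_zero (h : ω.IsRegular) :
    node (D.reversal p (restrictTo p ω)) 0 = (0, D.stateAt ω p) := by
  rw [node_zero, reversal_restrictTo_fst _ h.fst_zero]

lemma node_backward_succ (h : ω.IsRegular) {n m : ℕ} (hnm : n + m + 1 = ω.lastLE p) :
    node (D.reversal p (restrictTo p ω)) (n + 1) = (p - (ω.time (m + 1)).toReal,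
      D.flow ((ω.time (m + 1)).toReal - (ω.time m).toReal) (ω m).2) := by
  have hk : (restrictTo p ω).2.1 = ω.lastLE p := rfl
  rw [D.node_reversal_succ p _ (n := n) (by omega), hk,
    show ω.lastLE p - n = m + 1 by omega, show ω.lastLE p - (n + 1) = m by omega,
    node_restrictTo h.fst_zero (by omega), node_restrictTo h.fst_zero (by omega)]

end PDMP

namespace FullPath

open Skeleton PDMP

variable {E : Type*} [MeasurableSpace E] (D : PDMP E) {ω : Skeleton E} {p : ℝ}

/-- The full path that `ω` forms around time `p`: its future after `p`, and the reversal of its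
past before `p`. -/
def splitAt (p : ℝ) (ω : Skeleton E) : FullPath E :=
  (D.after p ω, pad (D.reversal p (restrictTo p ω)))

lemma splitAt_fst : (splitAt D p ω).1 = D.after p ω := rfl

lemma splitAt_snd : (splitAt D p ω).2 = pad (D.reversal p (restrictTo p ω)) := rfl

/-- The events of the reversed past are strictly ordered; the first one is after time `0` because
`p` is not an event time. -/
lemma node_backward_lt (h : ω.IsRegular) (hpn : ∀ n, ω.time n ≠ ENNReal.ofReal p) {n : ℕ}
    (hn : n < ω.lastLE p) : (node (D.reversal p (restrictTo p ω)) n).1 <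
      (node (D.reversal p (restrictTo p ω)) (n + 1)).1 := by
  obtain ⟨N, hN1, hN2⟩ := exists_time_le_lt h.tendsto (t := p) h.fst_zero
  have hl := lastLE_eq hN1 hN2
  have hfin : ∀ m ≤ N, ω.time m ≠ ∞ := fun m hm =>
    ne_top_of_le_ne_top ENNReal.ofReal_ne_top ((ω.time_mono hm).trans hN1)
  rw [hl] at hn
  obtain ⟨m, rfl⟩ : ∃ m, N = n + m + 1 := ⟨N - n - 1, by omega⟩
  rw [D.node_backward_succ h (n := n) (m := m) hl.symm]
  cases n with
  | zero =>
    rw [D.node_backward_zero h]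
    have h1 : ω.time (m + 1) < ENNReal.ofReal p :=
      lt_of_le_of_ne ((ω.time_mono (by omega)).trans hN1) (hpn _)
    exact sub_pos.2 (ENNReal.lt_ofReal_iff_toReal_lt (hfin _ (by omega)) |>.1 h1)
  | succ n =>
    rw [D.node_backward_succ h (n := n) (m := m + 1) (by omega)]
    have := (ENNReal.toReal_lt_toReal (hfin (m + 1) (by omega)) (hfin (m + 1 + 1) (by omega))).2
      (h.time_lt (hfin (m + 1) (by omega)))
    simp only
    linarith

lemma isProper_splitAt (h : ω.IsRegular) (hpn : ∀ n, ω.time n ≠ ENNReal.ofReal p) :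
    IsProper (splitAt D p ω) := by
  refine isProper_iff.2 ⟨?_, D.isRegular_after h, isRegular_pad fun n hn =>
    node_backward_lt D h hpn hn⟩
  rw [splitAt_fst, splitAt_snd, D.after_zero]
  simp [pad, D.reversal_restrictTo_fst h.fst_zero]

omit [MeasurableSpace E] in
lemma isProper_still (h : ω.IsRegular) : IsProper ((ω, still (ω 0).2) : FullPath E) := by
  refine isProper_iff.2 ⟨Prod.ext ?_ ?_, h, isRegular_still _⟩
  · simp [still, h.fst_zero]
  · simp [still]

/-- Seen from time `p`, the path `ω` is the path `ω` shifted by `p`. -/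
lemma agreeAfter_splitAt (h : ω.IsRegular) (hp : 0 < p)
    (hpn : ∀ n, ω.time n ≠ ENNReal.ofReal p) :
    AgreeAfter D p p (splitAt D p ω) (ω, still (ω 0).2) := by
  obtain ⟨N, hN1, hN2⟩ := exists_time_le_lt h.tendsto (t := p) h.fst_zero
  have hl := lastLE_eq hN1 hN2
  have hfin : ∀ m ≤ N, ω.time m ≠ ∞ := fun m hm =>
    ne_top_of_le_ne_top ENNReal.ofReal_ne_top ((ω.time_mono hm).trans hN1)
  have hN1' := lt_of_le_of_ne hN1 (hpn N)
  have hk : (D.reversal p (restrictTo p ω)).2.1 = N := hl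
  -- description of the two skeletons of `splitAt D p ω`
  have ta : ∀ k, 0 < k → (splitAt D p ω).1.time k = ω.time (N + k) - ENNReal.ofReal p :=
    fun k hk => by rw [← hl]; exact D.time_after h k hk
  have ta0 : (splitAt D p ω).1.time 0 = 0 := by
    rw [splitAt_fst, time_zero, D.after_zero]
  have sa : ∀ k, 0 < k → ((splitAt D p ω).1 k).2 = (ω (N + k)).2 :=
    fun k hk => by rw [← hl]; exact D.after_snd hk
  have hst : D.stateAt ω p = D.flow (p - (ω.time N).toReal) (ω N).2 := by rw [stateAt, hl]
  have sa0 : ((splitAt D p ω).1 0).2 = D.flow (p - (ω.time N).toReal) (ω N).2 := by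
    rw [splitAt_fst, D.after_zero, ← hst]
  have tb : ∀ n m, n + m + 1 = N →
      (splitAt D p ω).2.time (n + 1) = ENNReal.ofReal (p - (ω.time (m + 1)).toReal) := by
    intro n m hnm
    rw [splitAt_snd, time_pad (fun n hn => node_backward_lt D h hpn hn) (by rw [hk]; omega),
      D.node_backward_succ h (hnm.trans hl.symm)]
  have tb0 : (splitAt D p ω).2.time 0 = 0 := by
    rw [splitAt_snd, time_zero]; simp [pad]
  have tb' : ∀ n, N < n → (splitAt D p ω).2.time n = ∞ := fun n hn => time_pad_of_lt (hk ▸ hn)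
  have sb : ∀ n m, n + m + 1 = N → ((splitAt D p ω).2 (n + 1)).2 =
      D.flow ((ω.time (m + 1)).toReal - (ω.time m).toReal) (ω m).2 := by
    intro n m hnm
    rw [splitAt_snd, pad_snd (by rw [hk]; omega), D.node_backward_succ h (hnm.trans hl.symm)]
  have sb0 : ((splitAt D p ω).2 0).2 = D.flow (p - (ω.time N).toReal) (ω N).2 := by
    rw [splitAt_snd, pad_snd (Nat.zero_le _), D.node_backward_zero h, hst]
  have hpN : ∀ k, 0 < k → ENNReal.ofReal p ≤ ω.time (N + k) := fun k hk =>
    hN2.le.trans (ω.time_mono (by omega))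
  have hofs : ∀ t : ℝ, 0 ≤ t → ENNReal.ofReal (t + p) = ENNReal.ofReal t + ENNReal.ofReal p :=
    fun t ht => ENNReal.ofReal_add ht hp.le
  have hτ : ∀ m ≤ N, ω.time m = ENNReal.ofReal (ω.time m).toReal := fun m hm =>
    (ENNReal.ofReal_toReal (hfin m hm)).symm
  have hτp : ∀ m ≤ N, (ω.time m).toReal < p := fun m hm =>
    (ENNReal.lt_ofReal_iff_toReal_lt (hfin m hm)).1 ((ω.time_mono hm).trans_lt hN1')
  have hmN : ∀ t : ℝ, t ≤ p → ∀ m, ω.time m ≤ ENNReal.ofReal t → m ≤ N := by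
    intro t ht m hm
    by_contra! h1
    exact absurd ((ω.time_mono (Nat.succ_le_of_lt h1)).trans
      (hm.trans (ENNReal.ofReal_le_ofReal ht))) (not_le.2 hN2)
  have hNm : ∀ t : ℝ, p ≤ t → ∀ m, ENNReal.ofReal t ≤ ω.time (m + 1) → N ≤ m := by
    intro t ht m hm
    by_contra! h1
    exact absurd ((ENNReal.ofReal_le_ofReal ht).trans (hm.trans
      (ω.time_mono (Nat.succ_le_of_lt h1)))) (not_le.2 hN1')
  refine ⟨fun t htp => ?_, fun t htp => ?_, fun t htp => ?_, ?_, ?_⟩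
  · rw [mem_events_of_pos (ω := (ω, still (ω 0).2)) (t := t + p) (by linarith)]
    rcases lt_trichotomy t 0 with h0 | rfl | h0
    · rw [mem_events_of_neg h0]
      constructor
      · rintro ⟨n, hn0, hn⟩
        obtain ⟨n, rfl⟩ := Nat.exists_eq_succ_of_ne_zero hn0.ne'
        rcases lt_or_ge N (n + 1) with h1 | h1
        · rw [tb' _ h1] at hn
          exact absurd hn.symm ENNReal.ofReal_ne_top
        · obtain ⟨m, hm⟩ : ∃ m, n + m + 1 = N := ⟨N - n - 1, by omega⟩
          rw [Nat.succ_eq_add_one, tb n m hm, ENNReal.ofReal_eq_ofReal_iff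
            (sub_pos.2 (hτp _ (by omega))).le (by linarith)] at hn
          refine ⟨m + 1, Nat.succ_pos m, ?_⟩
          rw [hτ (m + 1) (by omega)]
          congr 1
          linarith
      · rintro ⟨m, hm0, hm⟩
        have hm' := hmN (t + p) (by linarith) m hm.le
        obtain ⟨m, rfl⟩ := Nat.exists_eq_succ_of_ne_zero hm0.ne'
        have hm2 : (ω.time (m + 1)).toReal = t + p := by
          have := congrArg ENNReal.toReal hm
          rwa [ENNReal.toReal_ofReal (by linarith)] at this
        refine ⟨N - m - 1 + 1, Nat.succ_pos _, ?_⟩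
        rw [tb (N - m - 1) m (by omega), hm2]
        congr 1
        linarith
    · simp only [zero_notMem_events, zero_add, false_iff, not_exists, not_and]
      exact fun n _ => hpn n
    · rw [mem_events_of_pos h0]
      constructor
      · rintro ⟨n, hn0, hn⟩
        refine ⟨N + n, by omega, ?_⟩
        have h1 := tsub_add_cancel_of_le (hpN n hn0)
        rw [← ta n hn0, hn, ← hofs t h0.le] at h1
        exact h1.symm
      · rintro ⟨m, hm0, hm⟩
        have h1 : N < m := by
          by_contra! h2
          have h3 := hτp m h2
          rw [hm, ENNReal.toReal_ofReal (by linarith)] at h3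
          linarith
        obtain ⟨n, rfl⟩ := Nat.exists_eq_add_of_lt h1
        refine ⟨n + 1, Nat.succ_pos n, ?_⟩
        have hm' : ω.time (N + (n + 1)) = ENNReal.ofReal (t + p) := hm
        rw [ta _ (Nat.succ_pos n), hm', hofs t h0.le,
          ENNReal.add_sub_cancel_right ENNReal.ofReal_ne_top]
  · simp only [state, show (0 : ℝ) ≤ t + p by linarith, if_true]
    rcases le_or_gt 0 t with h0 | h0
    · obtain ⟨m, hm1, hm2⟩ := exists_time_le_lt h.tendsto (t := t + p) h.fst_zero
      obtain ⟨k, rfl⟩ := Nat.exists_eq_add_of_le (hNm (t + p) (by linarith) m hm2.le)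
      rw [hofs t h0] at hm2
      have h1 : (splitAt D p ω).1.time k ≤ ENNReal.ofReal t := by
        rcases Nat.eq_zero_or_pos k with rfl | hk0
        · rw [ta0]; exact zero_le
        · rw [ta k hk0, tsub_le_iff_right, ← hofs t h0]
          exact hm1
      have h2 : ENNReal.ofReal t < (splitAt D p ω).1.time (k + 1) := by
        rw [ta _ (Nat.succ_pos k), lt_tsub_iff_right]
        exact hm2
      simp only [h0, if_true, stateAt]
      rw [lastLE_eq h1 h2, lastLE_eq hm1 (by rwa [hofs t h0])]
      rcases Nat.eq_zero_or_pos k with rfl | hk0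
      · rw [ta0, sa0, ← D.flow_add]
        congr 1
        simp only [ENNReal.toReal_zero, add_zero]
        ring
      · have hfin' : ω.time (N + k) ≠ ∞ := ne_top_of_le_ne_top ENNReal.ofReal_ne_top hm1
        rw [ta k hk0, sa k hk0, ENNReal.toReal_sub_of_le (hpN k hk0) hfin',
          ENNReal.toReal_ofReal hp.le]
        congr 1
        ring
    · obtain ⟨m, hm1, hm2⟩ := exists_time_le_lt h.tendsto (t := t + p) h.fst_zero
      have hm := hmN (t + p) (by linarith) m hm1
      obtain ⟨n, hn⟩ := Nat.exists_eq_add_of_le hm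
      have hm1' : (ω.time m).toReal ≤ t + p := by
        rw [hτ m hm] at hm1
        exact (ENNReal.ofReal_le_ofReal_iff (by linarith)).1 hm1
      have h1 : (splitAt D p ω).2.time n < ENNReal.ofReal (-t) := by
        cases n with
        | zero => rw [tb0]; exact ENNReal.ofReal_pos.2 (by linarith)
        | succ n =>
          rw [tb n m (by omega), ENNReal.ofReal_lt_ofReal_iff (by linarith)]
          rw [hτ (m + 1) (by omega), ENNReal.ofReal_lt_ofReal_iff_of_nonneg (by linarith)] at hm2
          linarith
      have h2 : ENNReal.ofReal (-t) ≤ (splitAt D p ω).2.time (n + 1) := by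
        cases m with
        | zero => rw [tb' _ (by omega)]; exact le_top
        | succ m =>
          rw [tb n m (by omega)]
          exact ENNReal.ofReal_le_ofReal (by linarith)
      simp only [h0.not_ge, if_false, stateAt]
      rw [lastLT_eq h1 h2, lastLE_eq hm1 hm2]
      cases n with
      | zero =>
        obtain rfl : N = m := by omega
        rw [tb0, sb0, ← D.flow_add]
        congr 1
        simp only [ENNReal.toReal_zero]
        ring
      | succ n =>
        rw [tb n m (by omega), sb n m (by omega), ← D.flow_add,
          ENNReal.toReal_ofReal (sub_pos.2 (hτp _ (by omega))).le]
        congr 1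
        ring
  · simp only [stateLeft, show (0 : ℝ) < t + p by linarith, if_true]
    rcases lt_or_ge 0 t with h0 | h0
    · obtain ⟨m, hm1, hm2⟩ := exists_time_lt_le h.tendsto h.fst_zero
        (show 0 < t + p by linarith)
      obtain ⟨k, rfl⟩ := Nat.exists_eq_add_of_le (hNm (t + p) (by linarith) m hm2)
      rw [hofs t h0.le] at hm2
      have h1 : (splitAt D p ω).1.time k < ENNReal.ofReal t := by
        rcases Nat.eq_zero_or_pos k with rfl | hk0
        · rw [ta0]; exact ENNReal.ofReal_pos.2 h0
        · rw [ta k hk0, ENNReal.sub_lt_iff_lt_right ENNReal.ofReal_ne_top (hpN k hk0),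
            ← hofs t h0.le]
          exact hm1
      have h2 : ENNReal.ofReal t ≤ (splitAt D p ω).1.time (k + 1) := by
        rw [ta _ (Nat.succ_pos k)]
        exact ENNReal.le_sub_of_add_le_right ENNReal.ofReal_ne_top hm2
      simp only [h0, if_true, stateBefore]
      rw [lastLT_eq h1 h2, lastLT_eq hm1 (by rwa [hofs t h0.le])]
      rcases Nat.eq_zero_or_pos k with rfl | hk0
      · rw [ta0, sa0, ← D.flow_add]
        congr 1
        simp only [ENNReal.toReal_zero, add_zero]
        ring
      · have hfin' : ω.time (N + k) ≠ ∞ := (hm1.trans ENNReal.ofReal_lt_top).ne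
        rw [ta k hk0, sa k hk0, ENNReal.toReal_sub_of_le (hpN k hk0) hfin',
          ENNReal.toReal_ofReal hp.le]
        congr 1
        ring
    · obtain ⟨m, hm1, hm2⟩ := exists_time_lt_le h.tendsto h.fst_zero
        (show 0 < t + p by linarith)
      have hm := hmN (t + p) (by linarith) m hm1.le
      obtain ⟨n, hn⟩ := Nat.exists_eq_add_of_le hm
      have hm1' : (ω.time m).toReal < t + p := by
        rw [hτ m hm] at hm1
        exact (ENNReal.ofReal_lt_ofReal_iff (by linarith)).1 hm1
      have h1 : (splitAt D p ω).2.time n ≤ ENNReal.ofReal (-t) := by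
        cases n with
        | zero => rw [tb0]; exact zero_le
        | succ n =>
          rw [tb n m (by omega)]
          rw [hτ (m + 1) (by omega), ENNReal.ofReal_le_ofReal_iff ENNReal.toReal_nonneg] at hm2
          exact ENNReal.ofReal_le_ofReal (by linarith)
      have h2 : ENNReal.ofReal (-t) < (splitAt D p ω).2.time (n + 1) := by
        cases m with
        | zero => rw [tb' _ (by omega)]; exact ENNReal.ofReal_lt_top
        | succ m =>
          rw [tb n m (by omega)]
          exact (ENNReal.ofReal_lt_ofReal_iff_of_nonneg (by linarith)).2 (by linarith)
      simp only [h0.not_gt, if_false, stateBefore]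
      rw [lastLE_eq h1 h2, lastLT_eq hm1 hm2]
      cases n with
      | zero =>
        obtain rfl : N = m := by omega
        rw [tb0, sb0, ← D.flow_add]
        congr 1
        simp only [ENNReal.toReal_zero]
        ring
      | succ n =>
        rw [tb n m (by omega), sb n m (by omega), ← D.flow_add,
          ENNReal.toReal_ofReal (sub_pos.2 (hτp _ (by omega))).le]
        congr 1
        ring
  · rw [mem_events_of_neg (by linarith), neg_neg]
    rintro ⟨n, hn0, hn⟩
    obtain ⟨n, rfl⟩ := Nat.exists_eq_succ_of_ne_zero hn0.ne'
    rcases lt_or_ge N (n + 1) with h1 | h1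
    · rw [tb' _ h1] at hn
      exact absurd hn.symm ENNReal.ofReal_ne_top
    · obtain ⟨m, hm⟩ : ∃ m, n + m + 1 = N := ⟨N - n - 1, by omega⟩
      rw [Nat.succ_eq_add_one, tb n m hm, ENNReal.ofReal_eq_ofReal_iff
        (sub_pos.2 (hτp _ (by omega))).le hp.le] at hn
      have h2 : 0 < (ω.time (m + 1)).toReal :=
        ENNReal.toReal_pos (h.time_pos (Nat.succ_pos m)).ne' (hfin _ (by omega))
      linarith
  · simp [zero_notMem_events]

end FullPath

/-! ### Longest valid pieces of the stationary path -/

/-- The supremum of the non-negative times that satisfy `S`, taken over the rational ones so as to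
be measurable; for a property inherited by smaller times it is the supremum over all times. -/
def ratSup (S : ℝ → Prop) : ℝ≥0∞ := ⨆ q : ℚ, ⨆ (_ : (0 : ℝ) ≤ q ∧ S q), ENNReal.ofReal q

lemma ratSup_congr {S S' : ℝ → Prop} (h : ∀ t, 0 ≤ t → (S t ↔ S' t)) : ratSup S = ratSup S' := by
  unfold ratSup
  refine iSup_congr fun q => ?_
  have : ((0 : ℝ) ≤ q ∧ S q) ↔ ((0 : ℝ) ≤ q ∧ S' q) := and_congr_right fun hq => h q hq
  simp only [this]

section

variable {S : ℝ → Prop} (hS : ∀ s t, 0 ≤ s → s ≤ t → S t → S s)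

include hS

lemma of_lt_ratSup {t : ℝ} (ht : 0 ≤ t) (h : ENNReal.ofReal t < ratSup S) : S t := by
  simp only [ratSup, lt_iSup_iff] at h
  obtain ⟨q, ⟨hq, hSq⟩, htq⟩ := h
  exact hS t q ht ((ENNReal.ofReal_lt_ofReal_iff_of_nonneg ht).1 htq).le hSq

lemma le_ratSup {t : ℝ} (h : S t) : ENNReal.ofReal t ≤ ratSup S := by
  refine le_of_forall_lt fun c hc => ?_
  obtain ⟨q, hq0, hcq, hqt⟩ := ENNReal.lt_iff_exists_rat_btwn.1 hc
  have hq0' : (0 : ℝ) ≤ q := by exact_mod_cast hq0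
  have hqt' : (q : ℝ) ≤ t := (ENNReal.ofReal_lt_ofReal_iff_of_nonneg hq0').1 hqt |>.le
  exact hcq.trans_le (le_iSup₂_of_le q ⟨hq0', hS q t hq0' hqt' h⟩ le_rfl)

lemma ratSup_eq_iSup : ratSup S = ⨆ (t : ℝ≥0) (_ : S t), (t : ℝ≥0∞) := by
  refine le_antisymm (iSup₂_le fun q hq => ?_) (iSup₂_le fun t ht => ?_)
  · exact le_iSup₂_of_le (Real.toNNReal q) (by rw [Real.coe_toNNReal _ hq.1]; exact hq.2) le_rfl
  · rw [← ENNReal.ofReal_coe_nnreal]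
    exact le_ratSup hS ht

end

lemma measurable_ratSup {α : Type*} [MeasurableSpace α] {S : α → ℝ → Prop}
    (hS : ∀ t, MeasurableSet {a | S a t}) : Measurable fun a => ratSup (S a) := by
  classical
  refine Measurable.iSup fun q => ?_
  have : (fun a => ⨆ (_ : (0 : ℝ) ≤ q ∧ S a q), ENNReal.ofReal q) =
      fun a => if (0 : ℝ) ≤ q ∧ S a q then ENNReal.ofReal q else 0 := by
    ext1 a
    split_ifs with h
    · rw [iSup_pos h]
    · rw [iSup_neg h]; rfl
  rw [this]
  refine Measurable.ite ?_ measurable_const measurable_const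
  exact (MeasurableSet.const _).inter (hS q)

namespace NUTS

open Skeleton PDMP FullPath

variable {E : Type*}

/-- The length of the longest valid piece that starts at time `-p`. -/
def validLength (C : Criterion E) (ω : FullPath E) (p : ℝ) : ℝ≥0∞ :=
  ratSup fun t => C ω (-p) (t - p)

variable [MeasurableSpace E]

lemma measurable_validLength {C : Criterion E} (hC : C.IsMeasurable) :
    Measurable fun q : FullPath E × ℝ => validLength C q.1 q.2 :=
  measurable_ratSup fun t => by
    have hm : Measurable fun q : FullPath E × ℝ => (q.1, -q.2, t - q.2) := by fun_prop
    exact hm hC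

lemma _root_.FullPath.AgreeAfter.validLength_eq {D : PDMP E} {p c : ℝ} {ω ω' : FullPath E}
    (h : AgreeAfter D p c ω ω') (hω : ω.IsProper) (hω' : ω'.IsProper) {C : Criterion E}
    (hC : C.DependsOnlyOnEvents D) : validLength C ω p = validLength C ω' (p - c) := by
  refine ratSup_congr fun t ht => ?_
  rw [h.criterion_iff hω hω' hC le_rfl (by linarith), show -p + c = -(p - c) by ring,
    show t - p + c = t - (p - c) by ring]

lemma _root_.FullPath.agreeAfter_clean (D : PDMP E) {ω : FullPath E} (h : ω.IsProper) {p : ℝ}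
    (hp : -p ∉ ω.events) : AgreeAfter D p 0 (ω.1.clean, ω.2) ω := by
  refine ⟨fun t _ => ?_, fun t _ => ?_, fun t _ => ?_, ?_, by simpa using hp⟩
  · rw [events_clean, add_zero]
  · rw [state_clean D h, add_zero]
  · rw [stateLeft_clean D h, add_zero]
  · rwa [events_clean]

@[fun_prop]
lemma measurable_state (D : PDMP E) :
    Measurable fun q : FullPath E × ℝ => FullPath.state D q.1 q.2 := by
  refine Measurable.ite (measurableSet_le measurable_const measurable_snd) ?_ ?_
  · exact D.measurable_stateAt.comp (f := fun q : FullPath E × ℝ => (q.1.1, q.2)) (by fun_prop)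
  · refine measurable_comp_nat (f := fun n (q : FullPath E × ℝ) =>
      D.flow (q.2 + (q.1.2.time n).toReal) (q.1.2 n).2) (fun n => ?_)
      (N := fun q : FullPath E × ℝ => q.1.2.lastLT (-q.2))
      (measurable_lastLT.comp (f := fun q : FullPath E × ℝ => (q.1.2, -q.2)) (by fun_prop))
    have h1 : Measurable fun p : FullPath E × ℝ => p.1.2.time n :=
      (measurable_time n).comp (measurable_snd.comp measurable_fst)
    exact D.measurable_flow.comp (f := fun q : FullPath E × ℝ =>
      ((q.2 + (q.1.2.time n).toReal), (q.1.2 n).2)) (by fun_prop)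

section Stationarity

variable [MeasurableSingletonClass E] {D Dr : PDMP E}

/-- Almost surely the full path is proper, starts from `z`, and has no event at the fixed time
`-p`. -/
lemma ae_fullPathLaw (hD : D.NonExplosive) (hDr : Dr.NonExplosive) (z : E) {p : ℝ} (hp : 0 < p) :
    ∀ᵐ ω ∂(fullPathLaw D Dr z), ω.IsProper ∧ (ω.1 0).2 = z ∧
      ∀ n, ω.2.time n ≠ ENNReal.ofReal p := by
  rw [fullPathLaw, Kernel.prod_apply]
  have h1 := Measure.quasiMeasurePreserving_fst (μ := D.pathLaw z) (ν := Dr.pathLaw z) |>.ae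
    ((D.ae_isRegular hD z).and (D.ae_pathLaw_zero z))
  have h2 := Measure.quasiMeasurePreserving_snd (μ := D.pathLaw z) (ν := Dr.pathLaw z) |>.ae
    (((Dr.ae_isRegular hDr z).and (Dr.ae_pathLaw_zero z)).and (Dr.ae_time_ne z hp))
  filter_upwards [h1, h2] with ω h1 h2
  exact ⟨isProper_iff.2 ⟨h1.2.trans h2.1.2.symm, h1.1, h2.1.1⟩, by rw [h1.2], h2.2⟩

lemma lintegral_fullPath_congr (hD : D.NonExplosive) (hDr : Dr.NonExplosive) (π : Measure E)
    {p : ℝ} (hp : 0 < p) {F G : FullPath E → ℝ≥0∞} (hF : Measurable F) (hG : Measurable G)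
    (h : ∀ ω : FullPath E, ω.IsProper → (∀ n, ω.2.time n ≠ ENNReal.ofReal p) → F ω = G ω) :
    ∫⁻ ω, F ω ∂(π.bind (fullPathLaw D Dr)) = ∫⁻ ω, G ω ∂(π.bind (fullPathLaw D Dr)) := by
  rw [Measure.lintegral_bind (Kernel.aemeasurable _) hF.aemeasurable,
    Measure.lintegral_bind (Kernel.aemeasurable _) hG.aemeasurable]
  refine lintegral_congr fun z => lintegral_congr_ae ?_
  filter_upwards [ae_fullPathLaw hD hDr z hp] with ω hω
  exact h ω hω.1 hω.2.2

/-- Stationarity of the full path: seen from time `-p`, the length of the longest valid piece and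
the state at a later time have the same joint law as for the PDMP started from equilibrium. -/
lemma lintegral_validLength {π : Measure E} (hD : D.NonExplosive) (hDr : Dr.NonExplosive)
    (hrev : D.IsTimeReversal Dr π) {C : Criterion E} (hCmeas : C.IsMeasurable)
    (hCev : C.DependsOnlyOnEvents D) {p q : ℝ} (hp : 0 < p) (hq : 0 < q)
    {h : ℝ≥0∞ × E → ℝ≥0∞} (hh : Measurable h) :
    ∫⁻ ω, h (validLength C ω p, FullPath.state D ω (q - p)) ∂(π.bind (fullPathLaw D Dr)) =
      ∫⁻ ω, h (validLength C (ω, still (ω 0).2) 0, D.stateAt ω q) ∂(π.bind D.pathLaw) := by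
  -- `H` only depends on the path after time `-p`, so the two halves of the full path may be
  -- truncated and cleaned; the resulting functional `F` of the past and of the future is then
  -- transported to the PDMP started from equilibrium, split at time `p`
  let H : FullPath E → ℝ≥0∞ := fun ω => h (validLength C ω p, FullPath.state D ω (q - p))
  have hvl := measurable_validLength hCmeas
  have hH : Measurable H := by
    refine hh.comp (Measurable.prodMk ?_ ?_)
    · exact hvl.comp measurable_prodMk_right
    · exact (measurable_state D).comp measurable_prodMk_right
  let F : FinPath E × Skeleton E → ℝ≥0∞ := fun x => H (x.2, pad x.1)
  have hF : Measurable F := hH.comp (by fun_prop)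
  have h1 : ∫⁻ ω, H ω ∂(π.bind (fullPathLaw D Dr)) =
      ∫⁻ ω, F (restrictTo p ω.2, clean ω.1) ∂(π.bind (fullPathLaw D Dr)) := by
    refine lintegral_fullPath_congr hD hDr π hp hH (hF.comp (Measurable.prodMk ?_ ?_)) ?_
    · exact (measurable_restrictTo p).comp measurable_snd
    · exact measurable_clean.comp measurable_fst
    intro ω hω hpn
    have hω1 := isProper_truncate hω p
    have a1 := agreeAfter_truncate D hω hp hpn
    have a2 := agreeAfter_clean D hω1 (by simpa using a1.left_notMem')
    have e1 := a1.validLength_eq hω hω1 hCev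
    have e2 := a2.validLength_eq hω1.clean hω1 hCev
    rw [sub_zero] at e1 e2
    have e3 := a1.state_eq (q - p) (by linarith)
    rw [add_zero] at e3
    simp only [H, F]
    rw [e1, e3, ← e2, ← state_clean D hω1]
  have h2 : ∫⁻ ω, F (D.reversal p (restrictTo p ω), clean (D.after p ω)) ∂(π.bind D.pathLaw) =
      ∫⁻ ω, h (validLength C (ω, still (ω 0).2) 0, D.stateAt ω q) ∂(π.bind D.pathLaw) := by
    have hm1 : Measurable fun ω =>
      F (D.reversal p (restrictTo p ω), clean (D.after p ω)) := by fun_prop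
    have hm2 : Measurable fun ω : Skeleton E =>
        h (validLength C (ω, still (ω 0).2) 0, D.stateAt ω q) := by
      refine hh.comp (Measurable.prodMk ?_ (D.measurable_stateAt.comp measurable_prodMk_right))
      exact hvl.comp (f := fun ω : Skeleton E => (((ω, still (ω 0).2) : FullPath E), (0 : ℝ)))
        (by fun_prop)
    rw [Measure.lintegral_bind (Kernel.aemeasurable _) hm1.aemeasurable,
      Measure.lintegral_bind (Kernel.aemeasurable _) hm2.aemeasurable]
    refine lintegral_congr fun z => lintegral_congr_ae ?_
    filter_upwards [D.ae_isRegular hD z, D.ae_time_ne z hp] with ω hω hpn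
    have hω1 := isProper_splitAt D hω hpn
    have hω2 := isProper_still hω
    have a1 := agreeAfter_splitAt D hω hp hpn
    have a2 := agreeAfter_clean D hω1 a1.left_notMem
    have e1 := a1.validLength_eq hω1 hω2 hCev
    have e2 := a2.validLength_eq hω1.clean hω1 hCev
    rw [sub_zero] at e2
    rw [sub_self] at e1
    have e3 := a1.state_eq (q - p) (by linarith)
    have e4 := state_clean D hω1 (q - p)
    simp only [H, F]
    rw [splitAt_fst, splitAt_snd] at e2 e4
    rw [e2, e4]
    change h (validLength C (splitAt D p ω) p, FullPath.state D (splitAt D p ω) (q - p)) = _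
    rw [e1, e3, sub_add_cancel]
    simp [FullPath.state, hq.le]
  exact h1.trans ((D.lintegral_fullPath_eq hD hrev hp hF).trans h2)

end Stationarity

end NUTS

/-! ### Rays and longest valid pieces of a fixed path -/

lemma ratSup_eq_ofReal {S : ℝ → Prop} (hS : ∀ s t, 0 ≤ s → s ≤ t → S t → S s) {l : ℝ}
    (h1 : ∀ t, 0 ≤ t → t < l → S t) (h2 : ∀ t, l < t → ¬ S t) :
    ratSup S = ENNReal.ofReal l := by
  refine le_antisymm (le_of_forall_lt fun c hc => ?_) (le_of_forall_lt fun c hc => ?_)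
  · lift c to ℝ≥0 using (hc.trans_le le_top).ne
    have h3 : S c := of_lt_ratSup hS c.coe_nonneg (by rwa [ENNReal.ofReal_coe_nnreal])
    by_contra! h4
    have h4' : l ≤ c :=
      (ENNReal.ofReal_le_ofReal_iff c.coe_nonneg).1 (by rwa [ENNReal.ofReal_coe_nnreal])
    obtain ⟨d, hd1, hd2⟩ := ENNReal.lt_iff_exists_nnreal_btwn.1 hc
    have h5 : S d := of_lt_ratSup hS d.coe_nonneg (by rwa [ENNReal.ofReal_coe_nnreal])
    have h6 : (c : ℝ) < d := by exact_mod_cast hd1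
    exact h2 d (h4'.trans_lt h6) h5
  · obtain ⟨d, hd1, hd2⟩ := ENNReal.lt_iff_exists_nnreal_btwn.1 hc
    have hdl : (d : ℝ) < l :=
      (ENNReal.ofReal_lt_ofReal_iff_of_nonneg d.coe_nonneg).1 (by rwa [ENNReal.ofReal_coe_nnreal])
    have := le_ratSup hS (h1 d d.coe_nonneg hdl)
    rw [ENNReal.ofReal_coe_nnreal] at this
    exact hd1.trans_le this

lemma not_of_ratSup_lt {S : ℝ → Prop} (hS : ∀ s t, 0 ≤ s → s ≤ t → S t → S s) {l t : ℝ}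
    (hl : 0 ≤ l) (h : ratSup S = ENNReal.ofReal l) (ht : l < t) : ¬ S t := fun h1 => by
  have := le_ratSup hS h1
  rw [h, ENNReal.ofReal_le_ofReal_iff hl] at this
  linarith

/-- The abstract structure of the valid intervals of one path with event set `Ev`: validity is
inherited by sub-intervals, it only depends on the events contained in the interval (and on whether
the ends are events), and the events are isolated. -/
structure IsLocalValidity (V : ℝ → ℝ → Prop) (Ev : Set ℝ) : Prop where
  mono : ∀ a b c d, a ≤ c → c ≤ d → d ≤ b → V a b → V c d
  congr : ∀ a b a' b', a ≤ b → a' ≤ b' →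
    (∀ t, t ∈ Ev ∩ Set.Icc a b ↔ t ∈ Ev ∩ Set.Icc a' b') →
    (a ∈ Ev ↔ a' ∈ Ev) → (b ∈ Ev ↔ b' ∈ Ev) → (V a b ↔ V a' b')
  gap : ∀ x, ∃ ε, 0 < ε ∧ ∀ y, |y - x| < ε → y ≠ x → y ∉ Ev
  countable : Ev.Countable

namespace IsLocalValidity

variable {V : ℝ → ℝ → Prop} {Ev : Set ℝ} (h : IsLocalValidity V Ev)

include h

/-- Validity is monotone along the ray `t ↦ [-αt, (1 - α)t]`. -/
lemma anti_ray {α : ℝ} (hα : α ∈ Set.Icc (0 : ℝ) 1) (s t : ℝ) (hs : 0 ≤ s) (hst : s ≤ t)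
    (hV : V (-(α * t)) ((1 - α) * t)) : V (-(α * s)) ((1 - α) * s) := by
  refine h.mono _ _ _ _ ?_ ?_ ?_ hV
  · nlinarith [hα.1]
  · nlinarith [hα.1, hα.2]
  · nlinarith [hα.2]

lemma anti_right (p s t : ℝ) (hs : 0 ≤ s) (hst : s ≤ t) (hV : V (-p) (t - p)) :
    V (-p) (s - p) :=
  h.mono _ _ _ _ le_rfl (by linarith) (by linarith) hV

/-- Moving the left end without crossing an event does not change validity. -/
lemma congr_left {a a' b ε : ℝ} (hgap : ∀ y, |y - a| < ε → y ≠ a → y ∉ Ev)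
    (ha : a ∉ Ev) (ha' : |a' - a| < ε) (hab : a ≤ b) (hab' : a' ≤ b) : V a b ↔ V a' b := by
  have hg : ∀ y, |y - a| < ε → y ∉ Ev := fun y hy => by
    rcases eq_or_ne y a with rfl | h1
    · exact ha
    · exact hgap y hy h1
  refine h.congr a b a' b hab hab' (fun t => ?_) (by simp [ha, hg a' ha']) Iff.rfl
  refine and_congr_right fun ht => ?_
  have h1 : ε ≤ |t - a| := not_lt.1 fun h2 => hg t h2 ht
  have h2 := abs_lt.1 ha'
  rcases le_abs.1 h1 with h3 | h3
  · exact ⟨fun h4 => ⟨by linarith, h4.2⟩, fun h4 => ⟨by linarith [abs_nonneg (a' - a)], h4.2⟩⟩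
  · exact ⟨fun h4 => by linarith [h4.1, abs_nonneg (a' - a)], fun h4 => by linarith [h4.1]⟩

section Right

variable {p l : ℝ} (hL : ratSup (fun t => V (-p) (t - p)) = ENNReal.ofReal l)

include hL

lemma valid_right {b : ℝ} (hb0 : -p ≤ b) (hb : b < l - p) : V (-p) b := by
  have := of_lt_ratSup (h.anti_right p) (t := b + p) (by linarith)
    (by rw [hL]; exact (ENNReal.ofReal_lt_ofReal_iff_of_nonneg (by linarith)).2 (by linarith))
  simpa using this

variable (hl : 0 ≤ l)

include hl

lemma not_valid_right {b : ℝ} (hb : l - p < b) : ¬ V (-p) b := by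
  have := not_of_ratSup_lt (h.anti_right p) hl hL (t := b + p) (by linarith)
  simpa using this

/-- The right end of a longest valid piece is an event. -/
lemma right_mem_events (hl0 : 0 < l) : l - p ∈ Ev := by
  by_contra hb
  obtain ⟨ε, hε, hgap⟩ := h.gap (l - p)
  obtain ⟨δ, hδ0, hδε, hδl⟩ : ∃ δ, 0 < δ ∧ δ < ε ∧ δ < l :=
    ⟨min ε l / 2, by positivity, by linarith [min_le_left ε l, lt_min hε hl0],
      by linarith [min_le_right ε l, lt_min hε hl0]⟩
  have hg : ∀ y, |y - (l - p)| < ε → y ∉ Ev := fun y hy => by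
    rcases eq_or_ne y (l - p) with rfl | h1
    · exact hb
    · exact hgap y hy h1
  have h1 := h.valid_right hL (b := l - p - δ) (by linarith) (by linarith)
  have h2 := h.not_valid_right hL hl (b := l - p + δ) (by linarith)
  refine h2 ((h.congr (-p) (l - p - δ) (-p) (l - p + δ) (by linarith) (by linarith)
    (fun t => and_congr_right fun ht => ?_) Iff.rfl ?_).1 h1)
  · refine and_congr_right fun _ => ⟨fun h3 => by linarith, fun h3 => ?_⟩
    by_contra! h4
    exact hg t (abs_lt.2 ⟨by linarith, by linarith⟩) ht
  · refine iff_of_false (hg _ ?_) (hg _ ?_)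
    · rw [abs_lt]; constructor <;> linarith
    · rw [abs_lt]; constructor <;> linarith

/-- A ray issued from time `0` towards a longest valid piece stops exactly at that piece. -/
lemma ray_eq (hp : 0 < p) (hpl : p < l) :
    ratSup (fun t => V (-(p / l * t)) ((1 - p / l) * t)) = ENNReal.ofReal l := by
  have hl0 : 0 < l := hp.trans hpl
  have hα : p / l ∈ Set.Icc (0 : ℝ) 1 := ⟨by positivity, (div_le_one hl0).2 hpl.le⟩
  have hpl' : p / l * l = p := div_mul_cancel₀ p hl0.ne'
  have hα0 : 0 < p / l := by positivity
  have hα1 : p / l < 1 := (div_lt_one hl0).2 hpl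
  refine ratSup_eq_ofReal (h.anti_ray hα) (fun t ht0 ht => ?_) (fun t ht hV => ?_)
  · have h1 : p / l * t < p := by
      calc p / l * t < p / l * l := mul_lt_mul_of_pos_left ht hα0
        _ = p := hpl'
    have h2 : (1 - p / l) * t < l - p := by
      calc (1 - p / l) * t < (1 - p / l) * l := mul_lt_mul_of_pos_left ht (by linarith)
        _ = l - p := by rw [sub_mul, hpl', one_mul]
    have h3 : 0 ≤ (1 - p / l) * t := mul_nonneg (by linarith) ht0
    have h4 : 0 ≤ p / l * t := by positivity
    exact h.mono _ _ _ _ (by linarith) (by linarith) le_rfl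
      (h.valid_right hL (b := (1 - p / l) * t) (by linarith) h2)
  · have h1 : p < p / l * t := by
      calc p = p / l * l := hpl'.symm
        _ < p / l * t := mul_lt_mul_of_pos_left ht hα0
    have h2 : l - p < (1 - p / l) * t := by
      calc l - p = (1 - p / l) * l := by rw [sub_mul, hpl', one_mul]
        _ < (1 - p / l) * t := mul_lt_mul_of_pos_left ht (by linarith)
    exact h.not_valid_right hL hl h2 (h.mono _ _ _ _ (by linarith) (by linarith) le_rfl hV)

/-- As long as the left end does not cross an event, the right end of the longest valid piece does
not move. -/
lemma eventually_eq_right (hl0 : 0 < l) (hpe : -p ∉ Ev) :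
    ∀ᶠ p' in 𝓝 p, ratSup (fun t => V (-p') (t - p')) = ENNReal.ofReal (l - p + p') := by
  obtain ⟨ε, hε, hgap⟩ := h.gap (-p)
  obtain ⟨δ, hδ0, hδε, hδl⟩ : ∃ δ, 0 < δ ∧ δ < ε ∧ δ < l :=
    ⟨min ε l / 2, by positivity, by linarith [min_le_left ε l, lt_min hε hl0],
      by linarith [min_le_right ε l, lt_min hε hl0]⟩
  filter_upwards [Metric.ball_mem_nhds p hδ0] with p' hp'
  rw [Metric.mem_ball, Real.dist_eq] at hp'
  have hp1 := abs_lt.1 hp'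
  have hp2 : |-p' - -p| < ε := by
    rw [abs_lt]; constructor <;> linarith
  refine ratSup_eq_ofReal (h.anti_right p') (fun t ht0 ht => ?_) (fun t ht hV => ?_)
  · obtain ⟨b, hb1, hb2⟩ : ∃ b, max (t - p') (-p + δ) ≤ b ∧ b < l - p :=
      ⟨_, le_rfl, max_lt (by linarith) (by linarith)⟩
    have hb3 := (le_max_left _ _).trans hb1
    have hb4 := (le_max_right _ _).trans hb1
    have h1 := h.valid_right hL (b := b) (by linarith) hb2
    have h2 := (h.congr_left hgap hpe hp2 (by linarith) (by linarith)).1 h1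
    exact h.mono _ _ _ _ le_rfl (by linarith) hb3 h2
  · refine h.not_valid_right hL hl (b := t - p') (by linarith) ?_
    exact (h.congr_left hgap hpe hp2 (by linarith) (by linarith)).2 hV

end Right

/-- If a ray stops at a piece whose left end is not an event, this piece is a longest valid
piece. -/
lemma right_eq_of_ray {α l : ℝ} (hα : α ∈ Set.Ioo (0 : ℝ) 1) (hl0 : 0 < l)
    (hT : ratSup (fun t => V (-(α * t)) ((1 - α) * t)) = ENNReal.ofReal l)
    (he : -(α * l) ∉ Ev) :
    ratSup (fun t => V (-(α * l)) (t - α * l)) = ENNReal.ofReal l := by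
  have hα' : α ∈ Set.Icc (0 : ℝ) 1 := ⟨hα.1.le, hα.2.le⟩
  have hα0 := hα.1
  have hα1 : 0 < 1 - α := by linarith [hα.2]
  obtain ⟨ε, hε, hgap⟩ := h.gap (-(α * l))
  refine ratSup_eq_ofReal (h.anti_right (α * l)) (fun t ht0 ht => ?_) (fun t ht hV => ?_)
  · -- a point of the ray just before its end, whose left end is not separated from the limit
    obtain ⟨s, hs1, hs2⟩ : ∃ s, max (max (l - ε) 0) ((t - α * l) / (1 - α)) < s ∧ s < l := by
      refine exists_between (max_lt (max_lt (by linarith) hl0) ?_)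
      rw [div_lt_iff₀ hα1]
      linarith
    have hs3 := (le_max_left _ _).trans_lt ((le_max_left _ _).trans_lt hs1)
    have hs4 := (le_max_right _ _).trans_lt ((le_max_left _ _).trans_lt hs1)
    have hs5 : t - α * l < (1 - α) * s := by
      have := (div_lt_iff₀ hα1).1 ((le_max_right _ _).trans_lt hs1)
      linarith
    have h1 := of_lt_ratSup (h.anti_ray hα') hs4.le
      (by rw [hT]; exact (ENNReal.ofReal_lt_ofReal_iff hl0).2 hs2)
    have h2 : |-(α * s) - -(α * l)| < ε := by
      rw [abs_lt]; constructor <;> nlinarith [hα.1, hα.2]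
    have h3 : 0 < α * s := by positivity
    have h4 : 0 < α * l := by positivity
    have h5 : 0 < (1 - α) * s := by positivity
    have h6 := (h.congr_left hgap he h2 (by linarith) (by linarith)).2 h1
    exact h.mono _ _ _ _ le_rfl (by linarith) hs5.le h6
  · obtain ⟨s, hs1, hs2⟩ : ∃ s, l < s ∧ s < min (l + ε) ((t - α * l) / (1 - α)) := by
      refine exists_between (lt_min (by linarith) ?_)
      rw [lt_div_iff₀ hα1]
      linarith
    have hs3 := hs2.trans_le (min_le_left _ _)
    have hs5 : (1 - α) * s < t - α * l := by
      have := (lt_div_iff₀ hα1).1 (hs2.trans_le (min_le_right _ _))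
      linarith
    have h1 := not_of_ratSup_lt (h.anti_ray hα') hl0.le hT hs1
    have h2 : |-(α * s) - -(α * l)| < ε := by
      rw [abs_lt]; constructor <;> nlinarith [hα.1, hα.2]
    have hs0 : 0 < s := hl0.trans hs1
    have h3 : 0 < α * s := by positivity
    have h4 : 0 < α * l := by positivity
    have h5 : 0 < (1 - α) * s := by positivity
    refine h1 ((h.congr_left hgap he h2 (by linarith) (by linarith)).1 ?_)
    exact h.mono _ _ _ _ le_rfl (by linarith) hs5.le hV

/-- When a ray stops, one of its two ends is an event. -/
lemma mem_events_or {α l : ℝ} (hα : α ∈ Set.Ioo (0 : ℝ) 1) (hl0 : 0 < l)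
    (hT : ratSup (fun t => V (-(α * t)) ((1 - α) * t)) = ENNReal.ofReal l) :
    (1 - α) * l ∈ Ev ∨ -(α * l) ∈ Ev := by
  by_contra! h1
  have h2 := h.right_mem_events (h.right_eq_of_ray hα hl0 hT h1.2) hl0.le hl0
  exact h1.1 (by rwa [sub_mul, one_mul])

/-- Only countably many rays upTo with both ends at events. -/
lemma countable_both :
    {α : ℝ | α ∈ Set.Ioo (0 : ℝ) 1 ∧ ∃ l, 0 < l ∧ (1 - α) * l ∈ Ev ∧ -(α * l) ∈ Ev}.Countable := by
  refine ((h.countable.prod h.countable).image fun q : ℝ × ℝ => -q.2 / (q.1 - q.2)).mono ?_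
  rintro α ⟨-, l, hl, h1, h2⟩
  refine ⟨((1 - α) * l, -(α * l)), ⟨h1, h2⟩, ?_⟩
  have : (1 - α) * l - -(α * l) = l := by ring
  simp only [this]
  field_simp

/-- Change of variables from the slope `α` of the ray to the position `p` of the origin in the
piece at which the ray stops, for the pieces that are hit at their right end. -/
lemma lintegral_ray (hmeas : Measurable fun p : ℝ => ratSup fun t => V (-p) (t - p))
    (Ψ : ℝ → ℝ → ℝ≥0∞) :
    ∫⁻ α in {α | α ∈ Set.Ioo (0 : ℝ) 1 ∧ ∃ l, 0 < l ∧
        ratSup (fun t => V (-(α * t)) ((1 - α) * t)) = ENNReal.ofReal l ∧ (1 - α) * l ∈ Ev},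
      Ψ (α * (ratSup fun t => V (-(α * t)) ((1 - α) * t)).toReal)
        (ratSup fun t => V (-(α * t)) ((1 - α) * t)).toReal =
    ∫⁻ p in {p | 0 < p ∧ ENNReal.ofReal p < ratSup (fun t => V (-p) (t - p)) ∧
        ratSup (fun t => V (-p) (t - p)) < ∞},
      ENNReal.ofReal (((ratSup fun t => V (-p) (t - p)).toReal - p) /
        (ratSup fun t => V (-p) (t - p)).toReal ^ 2) *
        Ψ p (ratSup fun t => V (-p) (t - p)).toReal := by
  set T : ℝ → ℝ≥0∞ := fun α => ratSup fun t => V (-(α * t)) ((1 - α) * t) with hT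
  set L : ℝ → ℝ≥0∞ := fun p => ratSup fun t => V (-p) (t - p) with hL
  set A : Set ℝ := {α | α ∈ Set.Ioo (0 : ℝ) 1 ∧ ∃ l, 0 < l ∧ T α = ENNReal.ofReal l ∧
    (1 - α) * l ∈ Ev}
  set B : Set ℝ := {p | 0 < p ∧ ENNReal.ofReal p < L p ∧ L p < ∞}
  -- on `s`, that is on `B` up to a countable set, the slope `φ p` of the ray that stops at the
  -- piece starting at `-p` is injective, with an explicit derivative, and its image is almost all
  -- of `A`
  let s : Set ℝ := {p | p ∈ B ∧ -p ∉ Ev}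
  let φ : ℝ → ℝ := fun p => p / (L p).toReal
  have hs : ∀ p ∈ s, L p = ENNReal.ofReal (L p).toReal ∧ 0 < p ∧ p < (L p).toReal ∧ -p ∉ Ev := by
    rintro p ⟨⟨h0, h1, h2⟩, h3⟩
    exact ⟨(ENNReal.ofReal_toReal h2.ne).symm, h0,
      (ENNReal.ofReal_lt_iff_lt_toReal h0.le h2.ne).1 h1, h3⟩
  have hTφ : ∀ p ∈ s, T (φ p) = L p := by
    intro p hp
    obtain ⟨h1, h2, h3, h4⟩ := hs p hp
    rw [h1]
    exact h.ray_eq h1 ENNReal.toReal_nonneg h2 h3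
  have hφT : ∀ p ∈ s, φ p * (L p).toReal = p := by
    intro p hp
    obtain ⟨h1, h2, h3, h4⟩ := hs p hp
    exact div_mul_cancel₀ p (h2.trans h3).ne'
  have hinj : Set.InjOn φ s := by
    intro p hp p' hp' hpp
    have h1 := hTφ p hp
    rw [hpp, hTφ p' hp'] at h1
    rw [← hφT p hp, ← hφT p' hp', hpp, h1]
  have hBm : MeasurableSet B := by
    refine measurableSet_Ioi.inter (MeasurableSet.inter ?_ ?_)
    · exact measurableSet_lt (by fun_prop) hmeas
    · exact measurableSet_lt hmeas measurable_const
  have hneg : MeasurableSet {p : ℝ | -p ∉ Ev} := (measurable_neg h.countable.measurableSet).compl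
  have hsm : MeasurableSet s := hBm.inter hneg
  have hderiv : ∀ p ∈ s,
      HasDerivWithinAt φ (((L p).toReal - p) / (L p).toReal ^ 2) s p := by
    intro p hp
    obtain ⟨h1, h2, h3, h4⟩ := hs p hp
    have hl0 : 0 < (L p).toReal := h2.trans h3
    have hev := h.eventually_eq_right h1 ENNReal.toReal_nonneg hl0 h4
    have hd : HasDerivAt (fun p' => p' / ((L p).toReal - p + p'))
        (((L p).toReal - p) / (L p).toReal ^ 2) p := by
      have := (hasDerivAt_id p).div ((hasDerivAt_id p).const_add ((L p).toReal - p))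
        (by simpa using hl0.ne')
      refine this.congr_deriv ?_
      simp only [id_eq, one_mul, mul_one, sub_add_cancel]
    refine (hd.congr_of_eventuallyEq ?_).hasDerivWithinAt
    filter_upwards [hev, eventually_gt_nhds (show p - (L p).toReal < p by linarith)] with p' h5 h6
    change p' / (L p').toReal = _
    rw [show L p' = _ from h5, ENNReal.toReal_ofReal (by linarith)]
  have hφA : φ '' s =ᵐ[volume] A := by
    refine Filter.EventuallyLE.antisymm (LE.le.eventuallyLE ?_) ?_
    · rintro _ ⟨p, hp, rfl⟩
      obtain ⟨h1, h2, h3, h4⟩ := hs p hp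
      have hl0 : 0 < (L p).toReal := h2.trans h3
      refine ⟨⟨by positivity, (div_lt_one hl0).2 h3⟩, (L p).toReal, hl0, ?_, ?_⟩
      · rw [← h1]; exact hTφ p hp
      · have := h.right_mem_events h1 ENNReal.toReal_nonneg hl0
        rwa [sub_mul, hφT p hp, one_mul]
    · rw [ae_le_set]
      refine (h.countable_both.mono ?_).measure_zero volume
      rintro α ⟨⟨hα, l, hl0, hTl, he⟩, hn⟩
      refine ⟨hα, l, hl0, he, ?_⟩
      by_contra h1
      have h2 : L (α * l) = ENNReal.ofReal l := h.right_eq_of_ray hα hl0 hTl h1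
      refine hn ⟨α * l, ⟨⟨mul_pos hα.1 hl0, ?_, ?_⟩, h1⟩, ?_⟩
      · rw [h2, ENNReal.ofReal_lt_ofReal_iff hl0]
        nlinarith [hα.2]
      · rw [h2]; exact ENNReal.ofReal_lt_top
      · simp only [φ, h2, ENNReal.toReal_ofReal hl0.le]
        field_simp
  have hsB : s =ᵐ[volume] B := by
    refine Filter.EventuallyLE.antisymm (LE.le.eventuallyLE fun p hp => hp.1) ?_
    rw [ae_le_set]
    refine ((h.countable.image fun x => -x).mono ?_).measure_zero volume
    rintro p ⟨hp, hn⟩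
    by_contra h1
    exact hn ⟨hp, fun h2 => h1 ⟨-p, h2, neg_neg p⟩⟩
  rw [← setLIntegral_congr hφA, ← setLIntegral_congr hsB,
    lintegral_image_eq_lintegral_abs_deriv_mul hsm hderiv hinj]
  refine setLIntegral_congr_fun hsm fun p hp => ?_
  obtain ⟨h1, h2, h3, h4⟩ := hs p hp
  change ENNReal.ofReal |((L p).toReal - p) / (L p).toReal ^ 2| *
    Ψ (φ p * (T (φ p)).toReal) (T (φ p)).toReal = _
  rw [hTφ p hp, hφT p hp, abs_of_nonneg (by
    have : 0 ≤ (L p).toReal - p := by linarith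
    positivity)]

end IsLocalValidity

/-! ### Averaging over the slope of the ray -/

/-- `IsLocalValidity.lintegral_ray` with the integral over all `p > 0`: the density vanishes
outside of the longest valid piece, and also (junk values of `toReal` and of the division) when
this piece has length `0` or `∞`. -/
lemma IsLocalValidity.lintegral_ray_Ioi {V : ℝ → ℝ → Prop} {Ev : Set ℝ} (h : IsLocalValidity V Ev)
    (hmeas : Measurable fun p : ℝ => ratSup fun t => V (-p) (t - p)) (Ψ : ℝ → ℝ → ℝ≥0∞) :
    ∫⁻ α in {α | α ∈ Set.Ioo (0 : ℝ) 1 ∧ ∃ l, 0 < l ∧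
        ratSup (fun t => V (-(α * t)) ((1 - α) * t)) = ENNReal.ofReal l ∧ (1 - α) * l ∈ Ev},
      Ψ (α * (ratSup fun t => V (-(α * t)) ((1 - α) * t)).toReal)
        (ratSup fun t => V (-(α * t)) ((1 - α) * t)).toReal =
    ∫⁻ p in Set.Ioi 0,
      ENNReal.ofReal (((ratSup fun t => V (-p) (t - p)).toReal - p) /
        (ratSup fun t => V (-p) (t - p)).toReal ^ 2) *
        Ψ p (ratSup fun t => V (-p) (t - p)).toReal := by
  rw [h.lintegral_ray hmeas, ← lintegral_indicator measurableSet_Ioi, ← lintegral_indicator]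
  · refine lintegral_congr fun p => ?_
    by_cases hp : 0 < p
    swap
    · rw [Set.indicator_of_notMem, Set.indicator_of_notMem (by simpa using hp)]
      exact fun h1 => hp h1.1
    rw [Set.indicator_of_mem (Set.mem_Ioi.2 hp)]
    by_cases hB : p ∈ {p | 0 < p ∧ ENNReal.ofReal p < ratSup (fun t => V (-p) (t - p)) ∧
        ratSup (fun t => V (-p) (t - p)) < ∞}
    · rw [Set.indicator_of_mem hB]
    · rw [Set.indicator_of_notMem hB, ENNReal.ofReal_of_nonpos, zero_mul]
      refine div_nonpos_of_nonpos_of_nonneg ?_ (sq_nonneg _)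
      by_contra! h1
      refine hB ⟨hp, ?_, ?_⟩
      · exact ENNReal.ofReal_lt_iff_lt_toReal hp.le
          (fun h2 => by rw [h2] at h1; simp at h1; linarith)
          |>.2 (by linarith)
      · rw [lt_top_iff_ne_top]
        intro h2
        rw [h2] at h1
        simp at h1
        linarith
  · exact measurableSet_Ioi.inter (MeasurableSet.inter
      (measurableSet_lt (by fun_prop) hmeas) (measurableSet_lt hmeas measurable_const))

lemma FullPath.countable_events {E : Type*} (ω : FullPath E) :
    ω.events.Countable := by
  refine ((Set.countable_range fun n => (ω.1.time n).toReal).union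
    (Set.countable_range fun n => -(ω.2.time n).toReal)).mono ?_
  rintro t ⟨n, -, ⟨h0, h1⟩ | ⟨h0, h1⟩⟩
  · exact Or.inl ⟨n, by simp only [h1, ENNReal.toReal_ofReal h0.le]⟩
  · exact Or.inr ⟨n, by simp only [h1, ENNReal.toReal_ofReal (neg_pos.2 h0).le, neg_neg]⟩

lemma FullPath.IsProper.finite_events {E : Type*} {ω : FullPath E} (hω : ω.IsProper) (M : ℝ) :
    (ω.events ∩ Set.Icc (-M) M).Finite := by
  have h1 := hω.2.2.2.1.eventually (lt_mem_nhds (ENNReal.ofReal_lt_top (r := M)))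
  have h2 := hω.2.2.2.2.eventually (lt_mem_nhds (ENNReal.ofReal_lt_top (r := M)))
  obtain ⟨N, hN⟩ := eventually_atTop.1 (h1.and h2)
  refine ((((Set.finite_Iio N).image fun n => (ω.1.time n).toReal)).union
    ((Set.finite_Iio N).image fun n => -(ω.2.time n).toReal)).subset ?_
  rintro t ⟨⟨n, -, ⟨h0, h1⟩ | ⟨h0, h1⟩⟩, ht⟩
  · refine Or.inl ⟨n, ?_, by simp only [h1, ENNReal.toReal_ofReal h0.le]⟩
    by_contra h2
    have := (hN n (by simpa using h2)).1
    rw [h1, ENNReal.ofReal_lt_ofReal_iff h0] at this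
    linarith [ht.2]
  · refine Or.inr ⟨n, ?_, by simp only [h1, ENNReal.toReal_ofReal (neg_pos.2 h0).le, neg_neg]⟩
    by_contra h2
    have := (hN n (by simpa using h2)).2
    rw [h1, ENNReal.ofReal_lt_ofReal_iff (neg_pos.2 h0)] at this
    linarith [ht.1]

/-- The valid pieces of a proper path, for a consistent and event-based criterion. -/
lemma Criterion.isLocalValidity {E : Type*} [MeasurableSpace E] {D : PDMP E} {C : Criterion E}
    (hCcons : C.IsConsistent) (hCev : C.DependsOnlyOnEvents D) {ω : FullPath E}
    (hω : ω.IsProper) : IsLocalValidity (C ω) ω.events where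
  mono a b c d h1 h2 h3 h4 := hCcons ω hω a b c d h1 h2 h3 h4
  congr a b a' b' hab hab' h1 h2 h3 := hCev ω ω hω hω a b a' b' hab hab'
    ⟨0, fun t => by rw [add_zero]; exact h1 t,
      fun t _ => by rw [add_zero]; exact ⟨rfl, rfl⟩, h2, h3⟩
  gap x := by
    have hF : ((ω.events ∩ Set.Icc (-(|x| + 1)) (|x| + 1)) \ {x}).Finite :=
      (hω.finite_events _).subset Set.sdiff_subset
    obtain ⟨ε, hε, hball⟩ := Metric.mem_nhds_iff.1
      (hF.isClosed.isOpen_compl.mem_nhds (x := x) (fun h => h.2 rfl))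
    refine ⟨min ε 1, by positivity, fun y hy hyx hye => ?_⟩
    have h1 := lt_of_lt_of_le hy (min_le_left _ _)
    have h2 := abs_lt.1 (lt_of_lt_of_le hy (min_le_right _ _))
    refine hball (a := y) (by rwa [Metric.mem_ball, Real.dist_eq]) ⟨⟨hye, ?_, ?_⟩, hyx⟩
    · linarith [neg_abs_le x]
    · linarith [le_abs_self x]
  countable := ω.countable_events

namespace NUTS

open Skeleton PDMP FullPath

/-- A measurable version of the stopping length: the supremum is over rational lengths. It is the
stopping length on proper paths, for `α ∈ (0, 1)`. -/
def rayLength {E : Type*} (C : Criterion E) (ω : FullPath E) (α : ℝ) : ℝ≥0∞ :=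
  ratSup fun t => C ω (-(α * t)) ((1 - α) * t)

/-- The set of the slopes `α` for which the criterion is hit going forward. -/
def forwardSet {E : Type*} (C : Criterion E) (ω : FullPath E) : Set ℝ :=
  {α | α ∈ Set.Ioo (0 : ℝ) 1 ∧ ∃ l, 0 < l ∧ rayLength C ω α = ENNReal.ofReal l ∧
    (1 - α) * l ∈ ω.events}

/-- The joint density of the positions `p` of the origin and `q` of the output, in a longest valid
piece of length `l` hit at its forward end. It is symmetric: this is the reversibility behind the
sampler. -/
def turnDensity (l p q : ℝ) : ℝ≥0∞ :=
  ENNReal.ofReal ((l - p) / l ^ 2) * ENNReal.ofReal (2 * (l - q) / l ^ 2)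

lemma turnDensity_symm (l p q : ℝ) : turnDensity l p q = turnDensity l q p := by
  simp only [turnDensity, mul_div_assoc, ENNReal.ofReal_mul zero_le_two]
  ring

@[fun_prop]
lemma measurable_turnDensity : Measurable fun x : ℝ × ℝ × ℝ => turnDensity x.1 x.2.1 x.2.2 := by
  unfold turnDensity
  fun_prop

lemma lintegral_triangle {l : ℝ} (hl : 0 < l) :
    ∫⁻ q in Set.Icc 0 l, ENNReal.ofReal (2 * (l - q) / l ^ 2) = 1 := by
  rw [← ofReal_integral_eq_lintegral_ofReal]
  · rw [integral_Icc_eq_integral_Ioc, ← intervalIntegral.integral_of_le hl.le,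
      intervalIntegral.integral_div, intervalIntegral.integral_const_mul,
      intervalIntegral.integral_sub (by simp) (by simp)]
    simp only [intervalIntegral.integral_const, integral_id, smul_eq_mul]
    rw [← ENNReal.ofReal_one]
    congr 1
    field_simp
    ring
  · exact (Continuous.integrableOn_Icc (by fun_prop))
  · refine (ae_restrict_iff' measurableSet_Icc).2 (ae_of_all _ fun q hq => ?_)
    have : 0 ≤ l - q := by linarith [hq.2]
    change 0 ≤ 2 * (l - q) / l ^ 2
    positivity

/-- The density of `lawForward l` vanishes (as an extended non-negative number) beyond `l`. -/
lemma setLIntegral_triangle (l : ℝ) (g : ℝ → ℝ≥0∞) :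
    ∫⁻ q in Set.Ioi 0, ENNReal.ofReal (2 * (l - q) / l ^ 2) * g q =
      ∫⁻ q in Set.Icc 0 l, ENNReal.ofReal (2 * (l - q) / l ^ 2) * g q := by
  rw [← setLIntegral_congr Ioi_ae_eq_Ici.symm, ← lintegral_indicator measurableSet_Ici,
    ← lintegral_indicator measurableSet_Icc]
  refine lintegral_congr fun q => ?_
  by_cases h0 : 0 ≤ q
  · rw [Set.indicator_of_mem (Set.mem_Ici.2 h0)]
    by_cases h1 : q ≤ l
    · rw [Set.indicator_of_mem (Set.mem_Icc.2 ⟨h0, h1⟩)]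
    · rw [Set.indicator_of_notMem (fun h => h1 h.2), ENNReal.ofReal_of_nonpos, zero_mul]
      exact div_nonpos_of_nonpos_of_nonneg (by linarith) (sq_nonneg _)
  · rw [Set.indicator_of_notMem (s := Set.Ici 0) (fun h => h0 h),
      Set.indicator_of_notMem (fun h => h0 h.1)]

lemma lintegral_lawForward (l : ℝ) {g : ℝ → ℝ≥0∞} (hg : Measurable g) :
    ∫⁻ q, g q ∂(lawForward l) =
      ∫⁻ q in Set.Ioi 0, ENNReal.ofReal (2 * (l - q) / l ^ 2) * g q := by
  rw [setLIntegral_triangle l, lawForward,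
    lintegral_withDensity_eq_lintegral_mul _ (by fun_prop) hg]
  rfl

lemma isProbabilityMeasure_lawForward {l : ℝ} (hl : 0 < l) :
    IsProbabilityMeasure (lawForward l) := by
  constructor
  rw [lawForward, withDensity_apply _ MeasurableSet.univ, Measure.restrict_univ,
    lintegral_triangle hl]

section

variable {E : Type*} [MeasurableSpace E]

lemma measurable_rayLength {C : Criterion E} (hC : C.IsMeasurable) :
    Measurable fun q : FullPath E × ℝ => rayLength C q.1 q.2 :=
  measurable_ratSup fun t => by
    have hm : Measurable fun q : FullPath E × ℝ => (q.1, -(q.2 * t), (1 - q.2) * t) := by fun_prop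
    exact hm hC

/-- The mean of `f` at the time `τ (p, q) - p`, when `p` and `q` are distributed according to
`turnDensity` in the longest valid pieces. -/
def turnMean (D : PDMP E) (C : Criterion E) (f : E → ℝ≥0∞) (τ : ℝ × ℝ → ℝ) (ω : FullPath E) :
    ℝ≥0∞ :=
  ∫⁻ p in Set.Ioi 0, ∫⁻ q in Set.Ioi 0,
    turnDensity (validLength C ω p).toReal p q * f (FullPath.state D ω (τ (p, q) - p))

variable {D : PDMP E} {C : Criterion E} {f : E → ℝ≥0∞}

lemma measurable_turnMean_aux (hCmeas : C.IsMeasurable) (hf : Measurable f) {τ : ℝ × ℝ → ℝ}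
    (hτ : Measurable τ) : Measurable fun x : FullPath E × ℝ × ℝ =>
      turnDensity (validLength C x.1 x.2.1).toReal x.2.1 x.2.2 *
        f (FullPath.state D x.1 (τ x.2 - x.2.1)) := by
  have h1 : Measurable fun x : FullPath E × ℝ × ℝ => validLength C x.1 x.2.1 :=
    (measurable_validLength hCmeas).comp (f := fun x : FullPath E × ℝ × ℝ => (x.1, x.2.1))
      (by fun_prop)
  have h2 : Measurable fun x : FullPath E × ℝ × ℝ => FullPath.state D x.1 (τ x.2 - x.2.1) :=
    (measurable_state D).comp (f := fun x : FullPath E × ℝ × ℝ => (x.1, τ x.2 - x.2.1))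
      (by fun_prop)
  refine Measurable.mul ?_ (hf.comp h2)
  exact measurable_turnDensity.comp
    (f := fun x : FullPath E × ℝ × ℝ => ((validLength C x.1 x.2.1).toReal, x.2.1, x.2.2))
    (by fun_prop)

lemma measurable_turnMean (hCmeas : C.IsMeasurable) (hf : Measurable f) {τ : ℝ × ℝ → ℝ}
    (hτ : Measurable τ) : Measurable (turnMean D C f τ) := by
  have h1 := (measurable_turnMean_aux (D := D) hCmeas hf hτ).comp
    (f := fun x : (FullPath E × ℝ) × ℝ => (x.1.1, x.1.2, x.2)) (by fun_prop)
  exact (h1.lintegral_prod_right' (ν := volume.restrict (Set.Ioi 0))).lintegral_prod_right'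
    (ν := volume.restrict (Set.Ioi 0))

/-- By the stationarity of the full path, the position of the origin in its longest valid piece can
be moved to any time of this piece. -/
lemma lintegral_turnMean [MeasurableSingletonClass E] {Dr : PDMP E} {π : Measure E} [SFinite π]
    (hD : D.NonExplosive) (hDr : Dr.NonExplosive) (hrev : D.IsTimeReversal Dr π)
    (hCmeas : C.IsMeasurable) (hCev : C.DependsOnlyOnEvents D) (hf : Measurable f)
    {τ : ℝ × ℝ → ℝ} (hτ : Measurable τ) (hτ0 : ∀ p q, 0 < p → 0 < q → 0 < τ (p, q)) :
    ∫⁻ ω, turnMean D C f τ ω ∂(π.bind (fullPathLaw D Dr)) =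
      ∫⁻ p in Set.Ioi 0, ∫⁻ q in Set.Ioi 0, ∫⁻ ω,
        turnDensity (validLength C (ω, still (ω 0).2) 0).toReal p q *
          f (D.stateAt ω (τ (p, q))) ∂(π.bind D.pathLaw) := by
  have h1 := measurable_turnMean_aux (D := D) hCmeas hf hτ
  have : SFinite (π.bind (fullPathLaw D Dr)) := by
    unfold fullPathLaw
    infer_instance
  unfold turnMean
  have h2 := h1.comp
    (f := fun x : (FullPath E × ℝ) × ℝ => (x.1.1, x.1.2, x.2)) (by fun_prop)
  rw [lintegral_lintegral_swap]
  swap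
  · exact (h2.lintegral_prod_right' (ν := volume.restrict (Set.Ioi 0))).aemeasurable
  refine setLIntegral_congr_fun measurableSet_Ioi fun p hp => ?_
  rw [lintegral_lintegral_swap]
  swap
  · exact (h1.comp (f := fun x : FullPath E × ℝ => (x.1, p, x.2)) (by fun_prop)).aemeasurable
  refine setLIntegral_congr_fun measurableSet_Ioi fun q hq => ?_
  exact lintegral_validLength hD hDr hrev hCmeas hCev hp (hτ0 p q hp hq)
    (h := fun x : ℝ≥0∞ × E => turnDensity x.1.toReal p q * f x.2)
    (Measurable.mul (measurable_turnDensity.comp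
      (f := fun x : ℝ≥0∞ × E => (x.1.toReal, p, q)) (by fun_prop)) (hf.comp measurable_snd))

/-- The reversibility of the sampler: the input and the output may be exchanged. -/
lemma lintegral_turnMean_symm [MeasurableSingletonClass E] {Dr : PDMP E} {π : Measure E}
    [SFinite π]
    (hD : D.NonExplosive) (hDr : Dr.NonExplosive) (hrev : D.IsTimeReversal Dr π)
    (hCmeas : C.IsMeasurable) (hCev : C.DependsOnlyOnEvents D) (hf : Measurable f) :
    ∫⁻ ω, turnMean D C f Prod.snd ω ∂(π.bind (fullPathLaw D Dr)) =
      ∫⁻ ω, turnMean D C f Prod.fst ω ∂(π.bind (fullPathLaw D Dr)) := by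
  rw [lintegral_turnMean hD hDr hrev hCmeas hCev hf measurable_snd fun p q _ hq => hq,
    lintegral_turnMean hD hDr hrev hCmeas hCev hf measurable_fst fun p q hp _ => hp,
    lintegral_lintegral_swap]
  · simp only [turnDensity_symm]
  have h1 : Measurable fun x : (ℝ × ℝ) × Skeleton E =>
      turnDensity (validLength C (x.2, still (x.2 0).2) 0).toReal x.1.1 x.1.2 *
        f (D.stateAt x.2 x.1.2) := by
    have h2 : Measurable fun x : (ℝ × ℝ) × Skeleton E =>
        validLength C (x.2, still (x.2 0).2) 0 :=
      (measurable_validLength hCmeas).comp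
        (f := fun x : (ℝ × ℝ) × Skeleton E => (((x.2, still (x.2 0).2) : FullPath E), (0 : ℝ)))
        (by fun_prop)
    refine Measurable.mul ?_ (hf.comp (D.measurable_stateAt.comp
      (f := fun x : (ℝ × ℝ) × Skeleton E => (x.2, x.1.2)) (by fun_prop)))
    exact measurable_turnDensity.comp (f := fun x : (ℝ × ℝ) × Skeleton E =>
      ((validLength C (x.2, still (x.2 0).2) 0).toReal, x.1.1, x.1.2)) (by fun_prop)
  exact (h1.lintegral_prod_right' (ν := π.bind D.pathLaw)).aemeasurable

/-- The mean of `f` at the output, over the slopes for which the criterion is hit going forward. -/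
lemma lintegral_forwardSet (hCmeas : C.IsMeasurable) (hCcons : C.IsConsistent)
    (hCev : C.DependsOnlyOnEvents D) {ω : FullPath E} (hω : ω.IsProper) (hf : Measurable f) :
    ∫⁻ α in forwardSet C ω, ∫⁻ l, f (FullPath.state D ω (l - α * (rayLength C ω α).toReal))
        ∂(lawForward (rayLength C ω α).toReal) = turnMean D C f Prod.snd ω := by
  have h := C.isLocalValidity hCcons hCev hω
  have hL : Measurable fun p => validLength C ω p :=
    (measurable_validLength hCmeas).comp measurable_prodMk_left
  have hm : ∀ x : ℝ, Measurable fun l : ℝ => f (FullPath.state D ω (l - x)) := fun x =>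
    hf.comp ((measurable_state D).comp (f := fun l : ℝ => (ω, l - x)) (by fun_prop))
  refine (h.lintegral_ray_Ioi hL
    fun p l => ∫⁻ q, f (FullPath.state D ω (q - p)) ∂(lawForward l)).trans (lintegral_congr
      fun p => ?_)
  change ENNReal.ofReal (((validLength C ω p).toReal - p) / (validLength C ω p).toReal ^ 2) *
    ∫⁻ q, f (FullPath.state D ω (q - p)) ∂(lawForward (validLength C ω p).toReal) = _
  rcases (ENNReal.toReal_nonneg (a := validLength C ω p)).eq_or_lt with h0 | h0
  · simp [turnDensity, ← h0]
  rw [lintegral_lawForward _ (hm p), ← lintegral_const_mul _ (by have := hm p; fun_prop)]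
  simp only [turnDensity, mul_assoc]

/-- The mean of `f` at the input, over the slopes for which the criterion is hit going forward: the
input is the output with `q` replaced by `p`. -/
lemma lintegral_forwardSet_zero (hCmeas : C.IsMeasurable) (hCcons : C.IsConsistent)
    (hCev : C.DependsOnlyOnEvents D) {ω : FullPath E} (hω : ω.IsProper) :
    ∫⁻ _ in forwardSet C ω, f (FullPath.state D ω 0) = turnMean D C f Prod.fst ω := by
  have h := C.isLocalValidity hCcons hCev hω
  have hL : Measurable fun p => validLength C ω p :=
    (measurable_validLength hCmeas).comp measurable_prodMk_left
  refine (h.lintegral_ray_Ioi hL fun p l => f (FullPath.state D ω 0)).trans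
    (lintegral_congr fun p => ?_)
  change ENNReal.ofReal (((validLength C ω p).toReal - p) / (validLength C ω p).toReal ^ 2) * _ = _
  rcases (ENNReal.toReal_nonneg (a := validLength C ω p)).eq_or_lt with h0 | h0
  · simp [turnDensity, ← h0]
  simp only [turnDensity, sub_self, mul_assoc]
  rw [lintegral_const_mul _ (by fun_prop), setLIntegral_triangle _,
    lintegral_mul_const _ (by fun_prop), lintegral_triangle h0, one_mul]

end

end NUTS

/-! ### Exchanging the two directions of time -/

namespace FullPath

open Skeleton

variable {E : Type*}

lemma mem_events_swap (ω : FullPath E) (t : ℝ) : t ∈ events ω.swap ↔ -t ∈ ω.events := by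
  rcases lt_trichotomy t 0 with ht | rfl | ht
  · rw [mem_events_of_neg ht, mem_events_of_pos (neg_pos.2 ht)]; rfl
  · simp [zero_notMem_events]
  · rw [mem_events_of_pos ht, mem_events_of_neg (neg_neg_iff_pos.2 ht), neg_neg]; rfl

lemma IsProper.swap {ω : FullPath E} (h : ω.IsProper) : IsProper (ω.swap : FullPath E) := by
  rw [isProper_iff] at h ⊢
  exact ⟨h.1.symm, h.2.2, h.2.1⟩

variable [MeasurableSpace E]

/-- The reversed path takes the left limits of the original one. -/
lemma state_swap {D Dr : PDMP E} (hflow : ∀ t z, Dr.flow t z = D.flow (-t) z) (ω : FullPath E)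
    (t : ℝ) : state Dr ω.swap t = stateLeft D ω (-t) := by
  by_cases ht : 0 ≤ t
  · rw [state, if_pos ht, stateLeft, if_neg (by linarith), PDMP.stateAt, hflow, neg_neg, neg_sub,
      neg_add_eq_sub]
    rfl
  · rw [state, if_neg ht, stateLeft, if_pos (by linarith), PDMP.stateBefore, hflow, neg_add']
    rfl

lemma stateLeft_swap {D Dr : PDMP E} (hflow : ∀ t z, Dr.flow t z = D.flow (-t) z)
    (ω : FullPath E) (t : ℝ) : stateLeft Dr ω.swap t = state D ω (-t) := by
  by_cases ht : 0 < t
  · rw [stateLeft, if_pos ht, state, if_neg (by linarith), PDMP.stateBefore, hflow, neg_neg,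
      neg_sub, neg_add_eq_sub]
    rfl
  · rw [stateLeft, if_neg ht, state, if_pos (by linarith), PDMP.stateAt, hflow, neg_add']
    rfl

lemma stateLeft_eq_state (D : PDMP E) {ω : FullPath E} (hω : ω.IsProper) {t : ℝ}
    (ht : t ∉ ω.events) : stateLeft D ω t = state D ω t := by
  obtain ⟨h1, h2, h3⟩ := isProper_iff.1 hω
  have key : ∀ {η : Skeleton E} {s : ℝ}, η.IsRegular → 0 < s →
      (¬ ∃ n, 0 < n ∧ η.time n = ENNReal.ofReal s) → η.lastLE s = η.lastLT s := by
    intro η s hη hs h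
    obtain ⟨n, hn1, hn2⟩ := exists_time_lt_le hη.tendsto hη.fst_zero hs
    rw [lastLT_eq hn1 hn2]
    exact lastLE_eq hn1.le (hn2.lt_of_ne fun h4 => h ⟨n + 1, n.succ_pos, h4.symm⟩)
  have key0 : ∀ {η : Skeleton E}, η.IsRegular → η.lastLE 0 = 0 := fun {η} hη =>
    lastLE_eq (by simp [hη.fst_zero]) (by simpa using hη.time_pos Nat.one_pos)
  rcases lt_trichotomy t 0 with h0 | rfl | h0
  · rw [mem_events_of_neg h0] at ht
    rw [stateLeft, if_neg h0.not_gt, state, if_neg h0.not_ge, key h3 (neg_pos.2 h0) ht]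
  · simp [stateLeft, state, PDMP.stateAt, key0 h2, key0 h3, h3.fst_zero, h1]
  · rw [mem_events_of_pos h0] at ht
    rw [stateLeft, if_pos h0, state, if_pos h0.le, PDMP.stateAt, PDMP.stateBefore, key h2 h0 ht]

end FullPath

namespace Criterion

open FullPath

variable {E : Type*} {C : Criterion E}

/-- The criterion read in the opposite direction of time. -/
def reverse (C : Criterion E) : Criterion E := fun ω a b => C ω.swap (-b) (-a)

lemma IsConsistent.reverse (h : C.IsConsistent) : C.reverse.IsConsistent :=
  fun _ hω _ _ _ _ h1 h2 h3 h4 =>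
    h _ hω.swap _ _ _ _ (neg_le_neg h3) (neg_le_neg h2) (neg_le_neg h1) h4

variable [MeasurableSpace E]

lemma IsMeasurable.reverse (h : C.IsMeasurable) : C.reverse.IsMeasurable := by
  have hm : Measurable fun p : FullPath E × ℝ × ℝ => (p.1.swap, -p.2.2, -p.2.1) := by fun_prop
  exact hm h

lemma DependsOnlyOnEvents.reverse {D Dr : PDMP E}
    (hflow : ∀ t z, Dr.flow t z = D.flow (-t) z) (h : C.DependsOnlyOnEvents D) :
    C.reverse.DependsOnlyOnEvents Dr := by
  have hflow' : ∀ t z, D.flow t z = Dr.flow (-t) z := fun t z => by rw [hflow, neg_neg]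
  rintro ω ω' hω hω' a b a' b' hab hab' ⟨c, h1, h2, h3, h4⟩
  refine h _ _ hω.swap hω'.swap _ _ _ _ (neg_le_neg hab) (neg_le_neg hab')
    ⟨-c, fun t => ?_, fun t ht => ?_, ?_, ?_⟩
  · have := h1 (-t)
    simp only [Set.mem_inter_iff, Set.mem_Icc, mem_events_swap, neg_add, neg_neg] at this ⊢
    rw [show (-b ≤ t ∧ t ≤ -a) ↔ (a ≤ -t ∧ -t ≤ b) by constructor <;> rintro ⟨_, _⟩ <;>
      constructor <;> linarith, this]
    refine and_congr_right fun _ => ?_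
    constructor <;> rintro ⟨_, _⟩ <;> constructor <;> linarith
  · have := h2 (-t) (by
      rw [Set.mem_inter_iff, mem_events_swap, Set.mem_Icc] at ht
      exact ⟨ht.1, by linarith [ht.2.2], by linarith [ht.2.1]⟩)
    rw [stateLeft_swap hflow', stateLeft_swap hflow', state_swap hflow', state_swap hflow',
      neg_add, neg_neg]
    exact this.symm
  · rw [mem_events_swap, mem_events_swap, neg_neg, neg_neg]; exact h4
  · rw [mem_events_swap, mem_events_swap, neg_neg, neg_neg]; exact h3

end Criterion

namespace NUTS

open Skeleton PDMP FullPath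

lemma rayLength_reverse {E : Type*} (C : Criterion E) (ω : FullPath E) (α : ℝ) :
    rayLength C.reverse ω.swap (1 - α) = rayLength C ω α :=
  ratSup_congr fun t _ => by
    simp only [Criterion.reverse, Prod.swap_swap, neg_neg, sub_sub_cancel]

/-- The set of the slopes `α` for which the criterion is not hit going forward. -/
def backwardSet {E : Type*} (C : Criterion E) (ω : FullPath E) : Set ℝ :=
  {α | α ∈ Set.Ioo (0 : ℝ) 1 ∧ ∃ l, 0 < l ∧ rayLength C ω α = ENNReal.ofReal l ∧
    (1 - α) * l ∉ ω.events}

lemma setLIntegral_comp_sub_left (c : ℝ) (s : Set ℝ) (g : ℝ → ℝ≥0∞) :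
    ∫⁻ x in (fun x => c - x) ⁻¹' s, g (c - x) = ∫⁻ x in s, g x :=
  (Measure.measurePreserving_sub_left volume c).setLIntegral_comp_preimage_emb
    (MeasurableEquiv.subLeft c).measurableEmbedding g s

lemma lintegral_lawBackward (l : ℝ) {g : ℝ → ℝ≥0∞} (hg : Measurable g) :
    ∫⁻ q, g q ∂(lawBackward l) = ∫⁻ q, g (l - q) ∂(lawForward l) := by
  have hg' : Measurable fun q => g (l - q) := by fun_prop
  rw [lawBackward, lawForward, lintegral_withDensity_eq_lintegral_mul _ (by fun_prop) hg,
    lintegral_withDensity_eq_lintegral_mul _ (by fun_prop) hg',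
    ← setLIntegral_comp_sub_left l (Set.Icc 0 l)]
  have : (fun x => l - x) ⁻¹' Set.Icc 0 l = Set.Icc 0 l := by simp
  rw [this]
  rfl

lemma lawForward_absolutelyContinuous (l : ℝ) : lawForward l ≪ volume :=
  (withDensity_absolutelyContinuous _ _).trans Measure.restrict_le_self.absolutelyContinuous

section

variable {E : Type*} [MeasurableSpace E] {D Dr : PDMP E} {C : Criterion E} {f : E → ℝ≥0∞}

/-- Reversing time exchanges the two ends: up to the countably many slopes for which both ends are
events, the criterion is hit backward exactly when it is hit forward by the reversed path. -/
lemma backwardSet_ae_eq (hCcons : C.IsConsistent) (hCev : C.DependsOnlyOnEvents D)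
    {ω : FullPath E} (hω : ω.IsProper) :
    backwardSet C ω =ᵐ[volume] (fun α => 1 - α) ⁻¹' forwardSet C.reverse ω.swap := by
  have h := C.isLocalValidity hCcons hCev hω
  have hs : (fun α => 1 - α) ⁻¹' forwardSet C.reverse ω.swap =
      {α | α ∈ Set.Ioo (0 : ℝ) 1 ∧ ∃ l, 0 < l ∧ rayLength C ω α = ENNReal.ofReal l ∧
        -(α * l) ∈ ω.events} := by
    ext α
    simp only [forwardSet, Set.mem_preimage, Set.mem_ofPred_eq, rayLength_reverse, mem_events_swap,
      sub_sub_cancel, Set.mem_Ioo]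
    refine and_congr_left fun _ => ?_
    constructor <;> rintro ⟨_, _⟩ <;> constructor <;> linarith
  rw [hs]
  refine Filter.EventuallyLE.antisymm (LE.le.eventuallyLE ?_) ?_
  · rintro α ⟨hα, l, hl, hT, he⟩
    exact ⟨hα, l, hl, hT, (h.mem_events_or hα hl hT).resolve_left he⟩
  · rw [ae_le_set]
    refine (h.countable_both.mono ?_).measure_zero volume
    rintro α ⟨⟨hα, l, hl, hT, he⟩, hn⟩
    refine ⟨hα, l, hl, ?_, he⟩
    by_contra h1
    exact hn ⟨hα, l, hl, hT, h1⟩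

/-- The mean of `f` at the output, over the slopes for which the criterion is not hit going
forward: it is that of the forward case for the reversed path. The position `l` of the output is
counted from the other end. -/
lemma lintegral_backwardSet (hflow : ∀ t z, Dr.flow t z = D.flow (-t) z)
    (hCmeas : C.IsMeasurable) (hCcons : C.IsConsistent)
    (hCev : C.DependsOnlyOnEvents D) {ω : FullPath E} (hω : ω.IsProper) (hf : Measurable f) :
    ∫⁻ α in backwardSet C ω, ∫⁻ l, f (FullPath.state D ω (l - α * (rayLength C ω α).toReal))
        ∂(lawBackward (rayLength C ω α).toReal) = turnMean Dr C.reverse f Prod.snd ω.swap := by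
  rw [← lintegral_forwardSet hCmeas.reverse hCcons.reverse (hCev.reverse hflow) hω.swap hf,
    setLIntegral_congr (backwardSet_ae_eq hCcons hCev hω),
    ← setLIntegral_comp_sub_left 1 (forwardSet C.reverse ω.swap)]
  refine lintegral_congr fun α => ?_
  rw [rayLength_reverse]
  set l := (rayLength C ω α).toReal
  have hm : Measurable fun q => f (FullPath.state D ω (q - α * l)) :=
    hf.comp ((measurable_state D).comp (f := fun q : ℝ => (ω, q - α * l)) (by fun_prop))
  rw [lintegral_lawBackward l hm]
  -- the reversed path takes left limits, which only differ from the states at events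
  have hc : ∀ᵐ q ∂(lawForward l), q ∉ (fun q => l - q - α * l) ⁻¹' ω.events := by
    refine lawForward_absolutelyContinuous l ?_
    have hinj : Function.Injective fun q => l - q - α * l := fun q q' hq => by simpa using hq
    refine measure_mono_null (fun q hq => not_not.1 hq)
      ((ω.countable_events.preimage hinj).measure_zero volume)
  refine lintegral_congr_ae ?_
  filter_upwards [hc] with q hq
  rw [state_swap hflow, ← stateLeft_eq_state D hω hq]
  congr 2
  ring

lemma lintegral_backwardSet_zero (hflow : ∀ t z, Dr.flow t z = D.flow (-t) z)
    (hCmeas : C.IsMeasurable) (hCcons : C.IsConsistent)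
    (hCev : C.DependsOnlyOnEvents D) {ω : FullPath E} (hω : ω.IsProper) :
    ∫⁻ _ in backwardSet C ω, f (FullPath.state D ω 0) =
      turnMean Dr C.reverse f Prod.fst ω.swap := by
  rw [← lintegral_forwardSet_zero hCmeas.reverse hCcons.reverse (hCev.reverse hflow) hω.swap,
    setLIntegral_congr (backwardSet_ae_eq hCcons hCev hω),
    ← setLIntegral_comp_sub_left 1 (forwardSet C.reverse ω.swap), state_swap hflow, neg_zero,
    stateLeft_eq_state D hω ω.zero_notMem_events]

lemma lintegral_fullPathLaw_swap (π : Measure E) {F : FullPath E → ℝ≥0∞} (hF : Measurable F) :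
    ∫⁻ ω, F ω.swap ∂(π.bind (fullPathLaw D Dr)) = ∫⁻ ω, F ω ∂(π.bind (fullPathLaw Dr D)) := by
  have hF' : Measurable fun ω : FullPath E => F ω.swap := hF.comp measurable_swap
  rw [Measure.lintegral_bind (Kernel.aemeasurable _) hF'.aemeasurable,
    Measure.lintegral_bind (Kernel.aemeasurable _) hF.aemeasurable]
  refine lintegral_congr fun z => ?_
  rw [fullPathLaw, fullPathLaw, Kernel.prod_apply, Kernel.prod_apply, 
    ← Measure.prod_swap (μ := D.pathLaw z), lintegral_map hF measurable_swap]

end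

end NUTS

/-! ### The sampler as a Markov kernel -/

namespace NUTS

open Skeleton PDMP FullPath

lemma lintegral_lawForward_scale {l : ℝ} (hl : 0 < l) {g : ℝ → ℝ≥0∞} (hg : Measurable g) :
    ∫⁻ q, g q ∂(lawForward l) = ∫⁻ s, g (l * s) ∂(lawForward 1) := by
  have hg' : Measurable fun s => g (l * s) := by fun_prop
  have himg : (fun s => l * s) '' Set.Ioi 0 = Set.Ioi 0 := by
    rw [Set.image_mul_left_Ioi hl, mul_zero]
  have h1 := lintegral_image_eq_lintegral_abs_deriv_mul (f := fun s => l * s) (f' := fun _ => l)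
    (measurableSet_Ioi (a := (0 : ℝ)))
    (fun s _ => by simpa using ((hasDerivAt_id s).const_mul l).hasDerivWithinAt)
    (mul_right_injective₀ hl.ne').injOn
    (fun q => ENNReal.ofReal (2 * (l - q) / l ^ 2) * g q)
  rw [himg] at h1
  rw [lintegral_lawForward l hg, lintegral_lawForward 1 hg', h1]
  refine lintegral_congr fun s => ?_
  rw [← mul_assoc, ← ENNReal.ofReal_mul (abs_nonneg l), abs_of_pos hl]
  congr 2
  field_simp

/-- The output of the sampler as a function of the path, of the slope `α` and of a variable `s`
with law `lawForward 1`; it uses the measurable version of the stopping length. -/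
def output {E : Type*} [MeasurableSpace E] (D : PDMP E) (C : Criterion E)
    (x : (FullPath E × ℝ) × ℝ) : E :=
  open Classical in
  if rayLength C x.1.1 x.1.2 = 0 ∨ rayLength C x.1.1 x.1.2 = ∞ then (x.1.1.1 0).2
  else FullPath.state D x.1.1
    ((if (1 - x.1.2) * (rayLength C x.1.1 x.1.2).toReal ∈ x.1.1.events then
      (rayLength C x.1.1 x.1.2).toReal * x.2
      else (rayLength C x.1.1 x.1.2).toReal - (rayLength C x.1.1 x.1.2).toReal * x.2) -
    x.1.2 * (rayLength C x.1.1 x.1.2).toReal)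

instance : IsProbabilityMeasure (lawForward 1) := isProbabilityMeasure_lawForward one_pos

instance : IsProbabilityMeasure (volume.restrict (Set.Ioo (0 : ℝ) 1)) := ⟨by simp⟩

section

variable {E : Type*} [MeasurableSpace E] {D Dr : PDMP E} {C : Criterion E}

lemma measurableSet_events : MeasurableSet {x : FullPath E × ℝ | x.2 ∈ x.1.events} := by
  have h1 : ∀ n, Measurable fun x : FullPath E × ℝ => x.1.1.time n := fun n =>
    (measurable_time n).comp (measurable_fst.comp measurable_fst)
  have h2 : ∀ n, Measurable fun x : FullPath E × ℝ => x.1.2.time n := fun n =>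
    (measurable_time n).comp (measurable_snd.comp measurable_fst)
  have : {x : FullPath E × ℝ | x.2 ∈ x.1.events} = ⋃ n, {x | 0 < n ∧
      ((0 < x.2 ∧ x.1.1.time n = ENNReal.ofReal x.2) ∨
        (x.2 < 0 ∧ x.1.2.time n = ENNReal.ofReal (-x.2)))} := by
    ext x
    simp [FullPath.events]
  rw [this]
  refine MeasurableSet.iUnion fun n => (MeasurableSet.const _).inter (MeasurableSet.union ?_ ?_)
  · exact (measurableSet_lt measurable_const measurable_snd).inter
      (measurableSet_eq_fun (h1 n) (by fun_prop))
  · exact (measurableSet_lt measurable_snd measurable_const).inter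
      (measurableSet_eq_fun (h2 n) (by fun_prop))

lemma measurable_output (hCmeas : C.IsMeasurable) : Measurable (output D C) := by
  have hT : Measurable fun x : (FullPath E × ℝ) × ℝ => rayLength C x.1.1 x.1.2 :=
    (measurable_rayLength hCmeas).comp measurable_fst
  refine Measurable.ite ?_ (by fun_prop) ?_
  · exact (hT (measurableSet_singleton 0)).union (hT (measurableSet_singleton ∞))
  refine (measurable_state D).comp (Measurable.prodMk (by fun_prop) (Measurable.sub ?_ ?_))
  · refine Measurable.ite ?_ (by fun_prop) (by fun_prop)
    have hm : Measurable fun x : (FullPath E × ℝ) × ℝ =>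
      (x.1.1, (1 - x.1.2) * (rayLength C x.1.1 x.1.2).toReal) := by fun_prop
    exact hm measurableSet_events
  · fun_prop

/-- The law of the output given the path and the slope, as a Markov kernel. -/
def outputKernel (D : PDMP E) (C : Criterion E) : Kernel (FullPath E × ℝ) E :=
  (Kernel.id ×ₖ Kernel.const (FullPath E × ℝ) (lawForward 1)).map (output D C)

lemma isMarkovKernel_outputKernel (hCmeas : C.IsMeasurable) :
    IsMarkovKernel (outputKernel D C) :=
  Kernel.IsMarkovKernel.map _ (measurable_output hCmeas)

lemma lintegral_outputKernel (hCmeas : C.IsMeasurable) (x : FullPath E × ℝ) {f : E → ℝ≥0∞}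
    (hf : Measurable f) :
    ∫⁻ y, f y ∂(outputKernel D C x) = ∫⁻ s, f (output D C (x, s)) ∂(lawForward 1) := by
  have h1 : Measurable fun y => f (output D C y) := hf.comp (measurable_output hCmeas)
  rw [outputKernel, Kernel.lintegral_map _ (measurable_output hCmeas) _ hf,
    Kernel.lintegral_id_prod h1, Kernel.const_apply]

lemma stopLength_eq_rayLength (hCcons : C.IsConsistent) (hCev : C.DependsOnlyOnEvents D)
    {ω : FullPath E} (hω : ω.IsProper) {α : ℝ} (hα : α ∈ Set.Ioo (0 : ℝ) 1) :
    stopLength C ω α = rayLength C ω α :=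
  (ratSup_eq_iSup ((C.isLocalValidity hCcons hCev hω).anti_ray ⟨hα.1.le, hα.2.le⟩)).symm

lemma outputLaw_eq_outputKernel (hCmeas : C.IsMeasurable) (hCcons : C.IsConsistent)
    (hCev : C.DependsOnlyOnEvents D) {ω : FullPath E} (hω : ω.IsProper) {α : ℝ}
    (hα : α ∈ Set.Ioo (0 : ℝ) 1) : outputLaw D C ω α = outputKernel D C (ω, α) := by
  refine Measure.ext_of_lintegral _ fun f hf => ?_
  rw [lintegral_outputKernel hCmeas _ hf, outputLaw, stopLength_eq_rayLength hCcons hCev hω hα]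
  by_cases h : rayLength C ω α = 0 ∨ rayLength C ω α = ∞
  · simp only [output, if_pos h]
    rw [lintegral_dirac' _ hf, lintegral_const, measure_univ, mul_one]
  have hl : 0 < (rayLength C ω α).toReal := by
    push Not at h
    exact ENNReal.toReal_pos h.1 h.2
  have hm : Measurable fun q => FullPath.state D ω (q - α * (rayLength C ω α).toReal) :=
    (measurable_state D).comp (f := fun q : ℝ => (ω, q - α * (rayLength C ω α).toReal))
      (by fun_prop)
  have hfm := hf.comp hm
  simp only [output, if_neg h]
  rw [lintegral_map hf hm]
  split_ifs with he
  · exact lintegral_lawForward_scale hl hfm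
  · exact (lintegral_lawBackward _ hfm).trans (lintegral_lawForward_scale hl
      (g := fun q => (f ∘ fun q => FullPath.state D ω (q - α * (rayLength C ω α).toReal))
        ((rayLength C ω α).toReal - q)) (by fun_prop))

/-- The law of the output given the path, as a Markov kernel. -/
def pathOutputKernel (D : PDMP E) (C : Criterion E) : Kernel (FullPath E) E :=
  (Kernel.const (FullPath E) (volume.restrict (Set.Ioo (0 : ℝ) 1)) ⊗ₖ outputKernel D C).snd

lemma lintegral_pathOutputKernel (hCmeas : C.IsMeasurable) (ω : FullPath E) {f : E → ℝ≥0∞}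
    (hf : Measurable f) :
    ∫⁻ y, f y ∂(pathOutputKernel D C ω) =
      ∫⁻ α in Set.Ioo (0 : ℝ) 1, ∫⁻ y, f y ∂(outputKernel D C (ω, α)) := by
  have := isMarkovKernel_outputKernel (D := D) hCmeas
  rw [pathOutputKernel, Kernel.lintegral_snd _ _ hf,
    Kernel.lintegral_compProd _ _ _ (f := fun y : ℝ × E => f y.2) (hf.comp measurable_snd),
    Kernel.const_apply]

lemma bind_outputLaw (hCmeas : C.IsMeasurable) (hCcons : C.IsConsistent)
    (hCev : C.DependsOnlyOnEvents D) {ω : FullPath E} (hω : ω.IsProper) :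
    ((volume.restrict (Set.Ioo (0 : ℝ) 1)).bind fun α => outputLaw D C ω α) =
      pathOutputKernel D C ω := by
  have h1 : (fun α => outputLaw D C ω α) =ᵐ[volume.restrict (Set.Ioo (0 : ℝ) 1)]
      fun α => outputKernel D C (ω, α) := by
    filter_upwards [ae_restrict_mem measurableSet_Ioo] with α hα
    exact outputLaw_eq_outputKernel hCmeas hCcons hCev hω hα
  rw [Measure.bind_congr_right h1]
  refine Measure.ext_of_lintegral _ fun f hf => ?_
  rw [lintegral_pathOutputKernel hCmeas _ hf, Measure.lintegral_bind _ hf.aemeasurable]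
  exact ((outputKernel D C).measurable.comp measurable_prodMk_left).aemeasurable

/-! ### Invariance -/

/-- The set of the slopes `α` for which the sampler does not move. -/
def restSet (C : Criterion E) (ω : FullPath E) : Set ℝ :=
  {α | α ∈ Set.Ioo (0 : ℝ) 1 ∧ (rayLength C ω α = 0 ∨ rayLength C ω α = ∞)}

lemma exists_rayLength_eq_iff {E : Type*} {C : Criterion E} {ω : FullPath E} {α : ℝ}
    {P : ℝ → Prop} :
    (∃ l, 0 < l ∧ rayLength C ω α = ENNReal.ofReal l ∧ P l) ↔
      (rayLength C ω α ≠ 0 ∧ rayLength C ω α ≠ ∞) ∧ P (rayLength C ω α).toReal := by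
  constructor
  · rintro ⟨l, hl, h1, h2⟩
    rw [h1, ENNReal.toReal_ofReal hl.le]
    exact ⟨⟨by simpa using hl, ENNReal.ofReal_ne_top⟩, h2⟩
  · rintro ⟨⟨h1, h2⟩, h3⟩
    exact ⟨_, ENNReal.toReal_pos h1 h2, (ENNReal.ofReal_toReal h2).symm, h3⟩

lemma mem_forwardSet_iff {E : Type*} {C : Criterion E} {ω : FullPath E} {α : ℝ} :
    α ∈ forwardSet C ω ↔ α ∈ Set.Ioo (0 : ℝ) 1 ∧
      (rayLength C ω α ≠ 0 ∧ rayLength C ω α ≠ ∞) ∧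
      (1 - α) * (rayLength C ω α).toReal ∈ ω.events :=
  and_congr_right fun _ => exists_rayLength_eq_iff (P := fun l => (1 - α) * l ∈ ω.events)

lemma mem_backwardSet_iff {E : Type*} {C : Criterion E} {ω : FullPath E} {α : ℝ} :
    α ∈ backwardSet C ω ↔ α ∈ Set.Ioo (0 : ℝ) 1 ∧
      (rayLength C ω α ≠ 0 ∧ rayLength C ω α ≠ ∞) ∧
      (1 - α) * (rayLength C ω α).toReal ∉ ω.events :=
  and_congr_right fun _ => exists_rayLength_eq_iff (P := fun l => (1 - α) * l ∉ ω.events)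

lemma measurableSet_restSet (hCmeas : C.IsMeasurable) (ω : FullPath E) :
    MeasurableSet (restSet C ω) := by
  have hT : Measurable fun α => rayLength C ω α :=
    (measurable_rayLength hCmeas).comp measurable_prodMk_left
  exact measurableSet_Ioo.inter
    ((hT (measurableSet_singleton 0)).union (hT (measurableSet_singleton ∞)))

lemma measurableSet_forwardSet (hCmeas : C.IsMeasurable) (ω : FullPath E) :
    MeasurableSet (forwardSet C ω) := by
  have hT : Measurable fun α => rayLength C ω α :=
    (measurable_rayLength hCmeas).comp measurable_prodMk_left
  have h : forwardSet C ω = Set.Ioo 0 1 ∩ (((fun α => rayLength C ω α) ⁻¹' {0})ᶜ ∩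
      ((fun α => rayLength C ω α) ⁻¹' {∞})ᶜ ∩
      (fun α => (1 - α) * (rayLength C ω α).toReal) ⁻¹' ω.events) := by
    ext α
    exact mem_forwardSet_iff
  rw [h]
  exact measurableSet_Ioo.inter ((((hT (measurableSet_singleton 0)).compl).inter
    (hT (measurableSet_singleton ∞)).compl).inter
    ((by fun_prop : Measurable fun α => (1 - α) * (rayLength C ω α).toReal)
      ω.countable_events.measurableSet))

lemma backwardSet_eq {E : Type*} {C : Criterion E} (ω : FullPath E) :
    backwardSet C ω = (Set.Ioo 0 1 \ restSet C ω) \ forwardSet C ω := by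
  ext α
  simp only [Set.mem_sdiff, mem_forwardSet_iff, mem_backwardSet_iff, restSet, Set.mem_ofPred_eq]
  tauto

lemma measurableSet_backwardSet (hCmeas : C.IsMeasurable) (ω : FullPath E) :
    MeasurableSet (backwardSet C ω) := by
  rw [backwardSet_eq]
  exact (measurableSet_Ioo.diff (measurableSet_restSet hCmeas ω)).diff
    (measurableSet_forwardSet hCmeas ω)

lemma setLIntegral_Ioo_eq_add (hCmeas : C.IsMeasurable) (ω : FullPath E) (g : ℝ → ℝ≥0∞) :
    ∫⁻ α in Set.Ioo (0 : ℝ) 1, g α = (∫⁻ α in restSet C ω, g α) +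
      ((∫⁻ α in forwardSet C ω, g α) + ∫⁻ α in backwardSet C ω, g α) := by
  have h1 : forwardSet C ω ⊆ Set.Ioo 0 1 \ restSet C ω := fun α hα => by
    rw [mem_forwardSet_iff] at hα
    exact ⟨hα.1, fun h => h.2.elim hα.2.1.1 hα.2.1.2⟩
  rw [← lintegral_inter_add_sdiff g _ (measurableSet_restSet hCmeas ω),
    Set.inter_eq_right.2 (fun α hα => hα.1),
    ← lintegral_inter_add_sdiff g (Set.Ioo 0 1 \ restSet C ω) (measurableSet_forwardSet hCmeas ω),
    Set.inter_eq_right.2 h1, backwardSet_eq]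

lemma _root_.FullPath.IsProper.state_zero {ω : FullPath E} (hω : ω.IsProper) :
    FullPath.state D ω 0 = (ω.1 0).2 := by
  have h := (isProper_iff.1 hω).2.1
  have h1 : ω.1.lastLE 0 = 0 :=
    lastLE_eq (by simp [h.fst_zero]) (by simpa using h.time_pos Nat.one_pos)
  simp [FullPath.state, PDMP.stateAt, h1, h.fst_zero, D.flow_zero]

variable {f : E → ℝ≥0∞}

/-- The mean of `f` at the output given the path, according to whether the sampler rests, is
stopped forward or is stopped backward. -/
lemma lintegral_pathOutputKernel_eq (hflow : ∀ t z, Dr.flow t z = D.flow (-t) z)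
    (hCmeas : C.IsMeasurable) (hCcons : C.IsConsistent)
    (hCev : C.DependsOnlyOnEvents D) {ω : FullPath E} (hω : ω.IsProper) (hf : Measurable f) :
    ∫⁻ y, f y ∂(pathOutputKernel D C ω) =
      (∫⁻ _ in restSet C ω, f (ω.1 0).2) +
        (turnMean D C f Prod.snd ω + turnMean Dr C.reverse f Prod.snd ω.swap) := by
  have hm : ∀ x : ℝ, Measurable fun q => FullPath.state D ω (q - x) := fun x =>
    (measurable_state D).comp (f := fun q : ℝ => (ω, q - x)) (by fun_prop)
  have hst : ∀ α ∈ Set.Ioo (0 : ℝ) 1, stopLength C ω α = rayLength C ω α :=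
    fun α hα => stopLength_eq_rayLength hCcons hCev hω hα
  have hout : ∀ α ∈ Set.Ioo (0 : ℝ) 1,
      ∫⁻ y, f y ∂(outputKernel D C (ω, α)) = ∫⁻ y, f y ∂(outputLaw D C ω α) :=
    fun α hα => by rw [outputLaw_eq_outputKernel hCmeas hCcons hCev hω hα]
  rw [lintegral_pathOutputKernel hCmeas _ hf, setLIntegral_Ioo_eq_add hCmeas ω,
    ← lintegral_forwardSet hCmeas hCcons hCev hω hf,
    ← lintegral_backwardSet hflow hCmeas hCcons hCev hω hf]
  congr 1
  · refine setLIntegral_congr_fun (measurableSet_restSet hCmeas ω) fun α hα => ?_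
    rw [hout α hα.1, outputLaw, hst α hα.1, if_pos hα.2, lintegral_dirac' _ hf]
  congr 1
  · refine setLIntegral_congr_fun (measurableSet_forwardSet hCmeas ω) fun α hα => ?_
    rw [mem_forwardSet_iff] at hα
    rw [hout α hα.1, outputLaw, hst α hα.1, if_neg (not_or.2 hα.2.1), if_pos hα.2.2,
      lintegral_map hf (hm _)]
  · refine setLIntegral_congr_fun (measurableSet_backwardSet hCmeas ω) fun α hα => ?_
    rw [mem_backwardSet_iff] at hα
    rw [hout α hα.1, outputLaw, hst α hα.1, if_neg (not_or.2 hα.2.1), if_neg hα.2.2,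
      lintegral_map hf (hm _)]

/-- The decomposition of `f (Z_0)` that corresponds to that of the mean of `f` at the output. -/
lemma apply_eq_add_turnMean (hflow : ∀ t z, Dr.flow t z = D.flow (-t) z)
    (hCmeas : C.IsMeasurable) (hCcons : C.IsConsistent)
    (hCev : C.DependsOnlyOnEvents D) {ω : FullPath E} (hω : ω.IsProper) :
    f (ω.1 0).2 = (∫⁻ _ in restSet C ω, f (ω.1 0).2) +
        (turnMean D C f Prod.fst ω + turnMean Dr C.reverse f Prod.fst ω.swap) := by
  rw [← lintegral_forwardSet_zero hCmeas hCcons hCev hω,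
    ← lintegral_backwardSet_zero hflow hCmeas hCcons hCev hω, hω.state_zero,
    ← setLIntegral_Ioo_eq_add hCmeas ω]
  simp

/-- If the full path starts from equilibrium, then the output is at equilibrium. -/
lemma bind_pathOutputKernel [MeasurableSingletonClass E] {π : Measure E} [SFinite π]
    (hD : D.NonExplosive) (hDr : Dr.NonExplosive) (hrev : D.IsTimeReversal Dr π)
    (hCmeas : C.IsMeasurable) (hCcons : C.IsConsistent) (hCev : C.DependsOnlyOnEvents D) :
    (π.bind (fullPathLaw D Dr)).bind (pathOutputKernel D C) = π := by
  refine Measure.ext_of_lintegral _ fun f hf => ?_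
  have hev' := hCev.reverse hrev.1
  let R : (ℝ × ℝ → ℝ) → FullPath E → ℝ≥0∞ := fun τ ω =>
    turnMean D C f τ ω + turnMean Dr C.reverse f τ ω.swap
  have hR : ∀ {τ : ℝ × ℝ → ℝ}, Measurable τ → Measurable (R τ) := fun hτ =>
    (measurable_turnMean hCmeas hf hτ).add
      ((measurable_turnMean hCmeas.reverse hf hτ).comp measurable_swap)
  have hRR : ∫⁻ ω, R Prod.snd ω ∂(π.bind (fullPathLaw D Dr)) =
      ∫⁻ ω, R Prod.fst ω ∂(π.bind (fullPathLaw D Dr)) := by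
    simp only [R]
    rw [lintegral_add_left (measurable_turnMean hCmeas hf measurable_snd),
      lintegral_add_left (measurable_turnMean hCmeas hf measurable_fst),
      lintegral_fullPathLaw_swap π (measurable_turnMean hCmeas.reverse hf measurable_snd),
      lintegral_fullPathLaw_swap π (measurable_turnMean hCmeas.reverse hf measurable_fst),
      lintegral_turnMean_symm hD hDr hrev hCmeas hCev hf,
      lintegral_turnMean_symm hDr hD hrev.symm hCmeas.reverse hev' hf]
  rw [Measure.lintegral_bind (Kernel.aemeasurable _) (hR measurable_snd).aemeasurable,
    Measure.lintegral_bind (Kernel.aemeasurable _) (hR measurable_fst).aemeasurable] at hRR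
  have hmR : ∀ {τ : ℝ × ℝ → ℝ}, Measurable τ →
      Measurable fun z => ∫⁻ ω, R τ ω ∂(fullPathLaw D Dr z) := fun hτ =>
    (hR hτ).lintegral_kernel
  have hmF : Measurable fun ω => ∫⁻ y, f y ∂(pathOutputKernel D C ω) := hf.lintegral_kernel
  rw [Measure.lintegral_bind (Kernel.aemeasurable _) hf.aemeasurable,
    Measure.lintegral_bind (Kernel.aemeasurable _) hmF.aemeasurable]
  have h1 : ∀ z, ∫⁻ ω, ∫⁻ y, f y ∂(pathOutputKernel D C ω) ∂(fullPathLaw D Dr z) =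
      (∫⁻ ω, (∫⁻ _ in restSet C ω, f (ω.1 0).2) ∂(fullPathLaw D Dr z)) +
        ∫⁻ ω, R Prod.snd ω ∂(fullPathLaw D Dr z) := fun z => by
    rw [← lintegral_add_right _ (hR measurable_snd)]
    refine lintegral_congr_ae ?_
    filter_upwards [ae_fullPathLaw hD hDr z one_pos] with ω hω
    exact lintegral_pathOutputKernel_eq hrev.1 hCmeas hCcons hCev hω.1 hf
  have h2 : ∀ z, f z = (∫⁻ ω, (∫⁻ _ in restSet C ω, f (ω.1 0).2) ∂(fullPathLaw D Dr z)) +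
        ∫⁻ ω, R Prod.fst ω ∂(fullPathLaw D Dr z) := fun z => by
    have hmk : IsMarkovKernel (fullPathLaw D Dr) := by unfold fullPathLaw; infer_instance
    rw [← lintegral_add_right _ (hR measurable_fst)]
    have : f z = ∫⁻ _, f z ∂(fullPathLaw D Dr z) := by simp
    refine this.trans (lintegral_congr_ae ?_)
    filter_upwards [ae_fullPathLaw hD hDr z one_pos] with ω hω
    rw [← hω.2.1]
    exact apply_eq_add_turnMean hrev.1 hCmeas hCcons hCev hω.1
  simp only [h1]
  rw [lintegral_add_right _ (hmR measurable_snd), hRR, ← lintegral_add_right _ (hmR measurable_fst)]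
  exact lintegral_congr fun z => (h2 z).symm

end

section

variable {X V : Type*} [MeasurableSpace X] [MeasurableSpace V] [MeasurableSingletonClass (X × V)]
  {D Dr : PDMP (X × V)} {C : Criterion (X × V)}

/-- In the definition of the sampler, `outputLaw` may be replaced by the measurable `outputKernel`:
they agree on proper paths, which are of full measure from every starting point. -/
lemma samplerLaw_eq (hD : D.NonExplosive) (hDr : Dr.NonExplosive) (ρ : Kernel (X × V) V)
    (hCmeas : C.IsMeasurable) (hCcons : C.IsConsistent) (hCev : C.DependsOnlyOnEvents D)
    (z : X × V) :
    samplerLaw D Dr ρ C z = (pathOutputKernel D C ∘ₖ (fullPathLaw D Dr ∘ₖ refresh ρ)) z := by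
  rw [← Kernel.comp_assoc, Kernel.comp_apply, samplerLaw]
  congr 1
  ext1 z'
  rw [Kernel.comp_apply]
  refine Measure.bind_congr_right ?_
  filter_upwards [ae_fullPathLaw hD hDr z' one_pos] with ω hω
  exact bind_outputLaw hCmeas hCcons hCev hω.1

end

end NUTS

end

theorem mainTheorem2 {X V : Type*} [MeasurableSpace X] [StandardBorelSpace X]
    [MeasurableSpace V] [StandardBorelSpace V]
    (π : Measure (X × V)) [IsProbabilityMeasure π]
    (D Dr : PDMP (X × V)) (hD : D.NonExplosive) (hDr : Dr.NonExplosive)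
    (hπ : D.IsInvariant π) (hrev : D.IsTimeReversal Dr π)
    (ρ : Kernel (X × V) V) [IsMarkovKernel ρ] (hρ : NUTS.IsRefreshment ρ π)
    (C : Criterion (X × V)) (hCmeas : C.IsMeasurable) (hCcons : C.IsConsistent)
    (hCev : C.DependsOnlyOnEvents D) :
    ∃ K : Kernel (X × V) (X × V), IsMarkovKernel K ∧
      (∀ z, K z = NUTS.samplerLaw D Dr ρ C z) ∧ K.Invariant π := by
  refine ⟨NUTS.pathOutputKernel D C ∘ₖ (NUTS.fullPathLaw D Dr ∘ₖ NUTS.refresh ρ), ?_,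
    fun z => (NUTS.samplerLaw_eq hD hDr ρ hCmeas hCcons hCev z).symm, ?_⟩
  · have := NUTS.isMarkovKernel_outputKernel (D := D) hCmeas
    unfold NUTS.pathOutputKernel NUTS.fullPathLaw NUTS.refresh
    infer_instance
  · rw [Kernel.Invariant, ← Measure.comp_assoc, ← Measure.comp_assoc]
    have h : π.bind (NUTS.refresh ρ) = π := hρ
    rw [h]
    exact NUTS.bind_pathOutputKernel hD hDr hrev hCmeas hCcons hCev
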